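/- A partial field is a pair $\mathbb{P}=(R,G)$ where $R$ is a commutative ring with identity and $G$ is a subgroup of the group of units of $R$ with $-1\in G$; its set of elements is $G\cup\{0\}$. A sub-partial field $\mathbb{P}'=(R',G')$ of $\mathbb{P}$ (that is, $R'$ is a subring of $R$ and $-1\in G'\le G$) is *induced* if $G'=G\cap R''$ for some subring $R''\subseteq R'$. All matroids are finite. A $\mathbb{P}$-matrix is a matrix with disjoint finite sets $X$, $Y$ of row and column labels all of whose subdeterminants lie in $\mathbb{P}$; $M[I\,A]$ is the matroid on $X\cup Y$ whose bases are the sets $B$ with $|B|=|X|$ for which the square submatrix of $[I\,A]$ with columns $B$ has nonzero determinant. A *minor* $A'\preceq A$ of a $\mathbb{P}$-matrix $A$ is a matrix obtained from $A$ by scaling rows and columns by elements of $G$, deleting rows and columns, and pivoting over nonzero entries (a pivot over $xy$ exchanges the labels $x$ and $y$). A $\mathbb{P}$-matrix is a *scaled $\mathbb{P}'$-matrix* if it becomes a $\mathbb{P}'$-matrix after scaling rows and columns by elements of $G$. For matroids $N$ and $M$, *$N$ confines $M$ to $\mathbb{P}'$* if for every $\mathbb{P}'$-matrix $B$ with $M[I\,B]\cong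 N$ and every $\mathbb{P}$-matrix $A$ with $M=M[I\,A]$ and $B\preceq A$, the matrix $A$ is a scaled $\mathbb{P}'$-matrix. A $k$-separation of a matroid with ground set $E$ and rank function $r$ is a partition $(Z_1,Z_2)$ of $E$ with $|Z_1|,|Z_2|\ge k$ and $r(Z_1)+r(Z_2)-r(E)<k$; the matroid is 3-connected if it has no 1- or 2-separation. **Theorem 1.4.** Let $\mathbb{P}'$ be an induced sub-partial field of a partial field $\mathbb{P}$. Let $M$ and $N$ be 3-connected matroids such that $N$ is a minor of $M$ and $N$ has at least two elements. Then exactly one of the following holds: 1. $N$ confines $M$ to $\mathbb{P}'$; 2. $M$ has a 3-connected minor $M'$ such that - $N$ does not confine $M'$ to $\mathbb{P}'$, and this is witnessed inside a representation of $M$: there are $\mathbb{P}$-matrices $A$, $A'$ and a $\mathbb{P}'$-matrix $B$ with $M=M[I\,A]$, $M'=M[I\,A']$, $M[I\,B]\cong N$ and $B\preceq A'\preceq A$ such that $A'$ is not a scaled $\mathbb{P}'$-matrix; - $N$ is isomorphic to $M'/x$ for some $x\in E(M')$, or to $M'\backslash y$ for some $y\in E(M')$, or to $M'/x\backslash y$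 for some distinct $x,y\in E(M')$ such that at least one of $M'/x$, $M'\backslash y$ is 3-connected. In particular, at least one of the following holds: $N$ confines $M$ to $\mathbb{P}'$, or $M$ has a 3-connected minor $M'$ that $N$ does not confine to $\mathbb{P}'$ and that satisfies the last condition. -/

import Mathlib

/-- A partial field `(R, G)`: a commutative ring `R` together with a subgroup `G` of its group of
units that contains `-1`. -/
structure PartialField (R : Type*) [CommRing R] where
  /-- The group `G`. -/
  units : Subgroup Rˣ
  neg_one_mem : -1 ∈ units

namespace PartialField

/-- The group `G`, as a set of elements of `R`. -/
def unitSet {R : Type*} [CommRing R] (P : PartialField R) : Set R :=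
  {a | ∃ u ∈ P.units, (u : R) = a}

/-- The set of elements `G ∪ {0}` of the partial field. -/
def elems {R : Type*} [CommRing R] (P : PartialField R) : Set R :=
  P.unitSet ∪ {0}

/-- `(R', G')` is a sub-partial field of `(R, G)`: `R'` is a subring of `R` and `G' ⊆ G`. -/
def IsSubPartialField {R : Type*} [CommRing R] {R' : Subring R}
    (P' : PartialField R') (P : PartialField R) : Prop :=
  R'.subtype '' P'.unitSet ⊆ P.unitSet

/-- The sub-partial field `(R', G')` of `(R, G)` is induced: `G' = G ∩ R''` for some subring `R''`
of `R'`. -/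
def IsInducedSubPartialField {R : Type*} [CommRing R] {R' : Subring R}
    (P' : PartialField R') (P : PartialField R) : Prop :=
  P'.IsSubPartialField P ∧
    ∃ R'' : Subring R, R'' ≤ R' ∧ R'.subtype '' P'.unitSet = P.unitSet ∩ (R'' : Set R)

end PartialField

/-- An `X × Y` matrix over `R`, where `X` and `Y` are finite disjoint sets of labels in `α`.
Entries outside `X × Y` carry the value `0`, so that a labelled matrix is determined by its row
labels, its column labels, and its entries in `X × Y`. -/
structure LabelledMatrix (α : Type*) (R : Type*) [CommRing R] where
  /-- The set `X` of row labels. -/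
  rows : Finset α
  /-- The set `Y` of column labels. -/
  cols : Finset α
  disjoint : Disjoint rows cols
  /-- The entries. -/
  entry : α → α → R
  entry_eq_zero : ∀ x y, ¬ (x ∈ rows ∧ y ∈ cols) → entry x y = 0

namespace LabelledMatrix

open Classical in
/-- The matrix with row labels `X`, column labels `Y`, and entries `f x y`. -/
noncomputable def mk' {α R : Type*} [CommRing R] (X Y : Finset α) (h : Disjoint X Y)
    (f : α → α → R) : LabelledMatrix α R where
  rows := X
  cols := Y
  disjoint := h
  entry x y := if x ∈ X ∧ y ∈ Y then f x y else 0
  entry_eq_zero _ _ hxy := if_neg hxy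

/-- Apply a ring homomorphism to all entries. -/
def map {α R S : Type*} [CommRing R] [CommRing S] (φ : R →+* S) (A : LabelledMatrix α R) :
    LabelledMatrix α S where
  rows := A.rows
  cols := A.cols
  disjoint := A.disjoint
  entry x y := φ (A.entry x y)
  entry_eq_zero x y hxy := by rw [A.entry_eq_zero x y hxy, map_zero]

open Classical in
/-- Multiply the row labelled `x` by `g`. -/
noncomputable def scaleRow {α R : Type*} [CommRing R] (A : LabelledMatrix α R) (x : α) (g : R) :
    LabelledMatrix α R :=
  mk' A.rows A.cols A.disjoint fun u v => if u = x then g * A.entry u v else A.entry u v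

open Classical in
/-- Multiply the column labelled `y` by `g`. -/
noncomputable def scaleCol {α R : Type*} [CommRing R] (A : LabelledMatrix α R) (y : α) (g : R) :
    LabelledMatrix α R :=
  mk' A.rows A.cols A.disjoint fun u v => if v = y then g * A.entry u v else A.entry u v

open Classical in
/-- Delete the row labelled `x`. -/
noncomputable def deleteRow {α R : Type*} [CommRing R] (A : LabelledMatrix α R) (x : α) :
    LabelledMatrix α R :=
  mk' (A.rows.erase x) A.cols (A.disjoint.mono_left (Finset.erase_subset _ _)) A.entry

open Classical in
/-- Delete the column labelled `y`. -/
noncomputable def deleteCol {α R : Type*} [CommRing R] (A : LabelledMatrix α R) (y : α) :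
    LabelledMatrix α R :=
  mk' A.rows (A.cols.erase y) (A.disjoint.mono_right (Finset.erase_subset _ _)) A.entry

open Classical in
theorem disjoint_pivot {α R : Type*} [CommRing R] (A : LabelledMatrix α R) {x y : α}
    (hx : x ∈ A.rows) (hy : y ∈ A.cols) :
    Disjoint (insert y (A.rows.erase x)) (insert x (A.cols.erase y)) := by
  have hxy : x ≠ y := fun e => Finset.disjoint_left.1 A.disjoint hx (e ▸ hy)
  rw [Finset.disjoint_left]
  intro a ha hb
  simp only [Finset.mem_insert, Finset.mem_erase] at ha hb
  have h1 : a ∈ A.rows → a ∉ A.cols := fun h => Finset.disjoint_left.1 A.disjoint h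
  grind

open Classical in
/-- Pivot over the entry `xy`: the rows of the result are `(X \ x) ∪ y`, its columns are
`(Y \ y) ∪ x`. It is only used when `A.entry x y` is a unit of `R`, in which case `Ring.inverse`
is its inverse. -/
noncomputable def pivot {α R : Type*} [CommRing R] (A : LabelledMatrix α R) (x y : α)
    (hx : x ∈ A.rows) (hy : y ∈ A.cols) : LabelledMatrix α R :=
  mk' (insert y (A.rows.erase x)) (insert x (A.cols.erase y)) (A.disjoint_pivot hx hy) fun u v =>
    let i : R := Ring.inverse (A.entry x y)
    if u = y then
      if v = x then i else i * A.entry x v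
    else
      if v = x then - (i * A.entry u y)
      else A.entry u v - i * A.entry u y * A.entry x v

/-- `A` is a `P`-matrix: all its subdeterminants lie in `P`. -/
def IsMatrixOver {α R : Type*} [CommRing R] (A : LabelledMatrix α R) (P : PartialField R) : Prop :=
  ∀ (n : ℕ) (f : Fin n ↪ A.rows) (g : Fin n ↪ A.cols),
    (Matrix.of fun i j => A.entry (f i) (g j)).det ∈ P.elems

/-- One matrix-minor operation over `P`. Permuting rows or columns together with their labels does
not change a labelled matrix. -/
inductive MinorStep {α R : Type*} [CommRing R] (P : PartialField R) :
    LabelledMatrix α R → LabelledMatrix α R → Prop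
  | scaleRow (A : LabelledMatrix α R) (x : α) (hx : x ∈ A.rows) (g : R) (hg : g ∈ P.unitSet) :
      MinorStep P A (A.scaleRow x g)
  | scaleCol (A : LabelledMatrix α R) (y : α) (hy : y ∈ A.cols) (g : R) (hg : g ∈ P.unitSet) :
      MinorStep P A (A.scaleCol y g)
  | deleteRow (A : LabelledMatrix α R) (x : α) (hx : x ∈ A.rows) : MinorStep P A (A.deleteRow x)
  | deleteCol (A : LabelledMatrix α R) (y : α) (hy : y ∈ A.cols) : MinorStep P A (A.deleteCol y)
  | pivot (A : LabelledMatrix α R) (x y : α) (hx : x ∈ A.rows) (hy : y ∈ A.cols)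
      (h : A.entry x y ≠ 0) : MinorStep P A (A.pivot x y hx hy)

/-- The labelled matrix `A'` is a minor of the labelled matrix `A`, over `P`. -/
def IsMinorOver {α R : Type*} [CommRing R] (P : PartialField R) (A' A : LabelledMatrix α R) :
    Prop :=
  Relation.ReflTransGen (MinorStep P) A A'

/-- Scaling-equivalence: `A'` arises from `A` by scaling rows and columns by elements of `G`. -/
def ScalingEquiv {α R : Type*} [CommRing R] (P : PartialField R) (A A' : LabelledMatrix α R) :
    Prop :=
  A.rows = A'.rows ∧ A.cols = A'.cols ∧ ∃ r c : α → R,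
    (∀ x, r x ∈ P.unitSet) ∧ (∀ y, c y ∈ P.unitSet) ∧
      ∀ x y, A'.entry x y = r x * A.entry x y * c y

/-- `A` is a scaled `P'`-matrix: it is scaling-equivalent over `P` to a `P'`-matrix. -/
def IsScaledMatrix {α R : Type*} [CommRing R] (P : PartialField R) {R' : Subring R}
    (P' : PartialField R') (A : LabelledMatrix α R) : Prop :=
  ∃ A' : LabelledMatrix α R', A'.IsMatrixOver P' ∧ ScalingEquiv P A (A'.map R'.subtype)

open Classical in
/-- The entries of the `X × (X ∪ Y)` matrix `[I A]`. -/
noncomputable def augEntry {α R : Type*} [CommRing R] (A : LabelledMatrix α R) (x z : α) : R :=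
  if z ∈ A.rows then (if x = z then 1 else 0) else A.entry x z

open Classical in
/-- `M = M[I A]`: the ground set of `M` is `X ∪ Y`, and its bases are the sets `B ⊆ X ∪ Y` with
`|B| = |X|` for which the `X × B` submatrix of `[I A]` has nonzero determinant. (The bijection `f`
orders the columns; the choice only affects the sign of the determinant.) -/
def Represents {α R : Type*} [CommRing R] (A : LabelledMatrix α R) (M : Matroid α) : Prop :=
  M.E = (A.rows : Set α) ∪ (A.cols : Set α) ∧
    ∀ B : Set α, M.IsBase B ↔ B ⊆ (A.rows : Set α) ∪ (A.cols : Set α) ∧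
      ∃ f : A.rows ≃ B, (Matrix.of fun i j : A.rows => A.augEntry i (f j)).det ≠ 0

end LabelledMatrix

namespace Matroid

/-- `M` and `N` are isomorphic. -/
def IsIsomorphicTo {α : Type*} (M N : Matroid α) : Prop :=
  ∃ (f : α → α) (hf : Set.InjOn f M.E), N = M.map f hf

/-- `(Z, E \ Z)` is a `k`-separation of `M`: both sides have at least `k` elements, and
`r(Z) + r(E \ Z) - r(E) < k`. -/
def IsSeparation {α : Type*} (M : Matroid α) (k : ℕ) (Z : Set α) : Prop :=
  Z ⊆ M.E ∧ (k : ℕ∞) ≤ Z.encard ∧ (k : ℕ∞) ≤ (M.E \ Z).encard ∧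
    M.eRk Z + M.eRk (M.E \ Z) < M.eRank + k

/-- `M` is `k`-connected: it has no `k'`-separation with `k' < k`. -/
def IsKConnected {α : Type*} (M : Matroid α) (k : ℕ) : Prop :=
  ∀ k' < k, ∀ Z, ¬ M.IsSeparation k' Z

end Matroid

/-- The `P'`-matrix `B` confines `M`: every `P`-matrix `A` with `M = M[I A]` that has `B` as a minor
is a scaled `P'`-matrix. -/
def LabelledMatrix.Confines {α R : Type*} [CommRing R] (P : PartialField R) {R' : Subring R}
    (P' : PartialField R') (B : LabelledMatrix α R') (M : Matroid α) : Prop :=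
  ∀ A : LabelledMatrix α R, A.IsMatrixOver P → A.Represents M →
    LabelledMatrix.IsMinorOver P (B.map R'.subtype) A → LabelledMatrix.IsScaledMatrix P P' A

/-- `B` is a `P'`-representation of the matroid `N` up to relabelling: `B` is a `P'`-matrix and
`M[I B]` is isomorphic to `N`. -/
def LabelledMatrix.IsRepresentationOf {α R : Type*} [CommRing R] (P : PartialField R)
    (B : LabelledMatrix α R) (N : Matroid α) : Prop :=
  B.IsMatrixOver P ∧ ∃ N₀ : Matroid α, B.Represents N₀ ∧ N.IsIsomorphicTo N₀

/-- `N` confines `M` to `P'`: every `P'`-representation `B` of (an isomorphic copy of) `N`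
confines `M`. -/
def Matroid.Confines {α R : Type*} [CommRing R] (P : PartialField R) {R' : Subring R}
    (P' : PartialField R') (N M : Matroid α) : Prop :=
  ∀ B : LabelledMatrix α R', B.IsRepresentationOf P' N → B.Confines P P' M

/-!
Let `K` be the subring `R''` that induces `P'`, and let `G` be the group of `P`. The set `G ∩ K`
is a group, a `P`-matrix with entries in `K` is a `P'`-matrix (`LabelledMatrix.exists_map_eq`),
and so a `P`-matrix is a scaled `P'`-matrix if and only if its entries can be scaled into `K`
(`LabelledMatrix.isScaledMatrix_iff`). Scaling into `K` is inherited by minors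
(`LabelledMatrix.IsMinorOver.scalesInto`), which is why the two alternatives exclude each other.

If `N` does not confine `M`, some `P`-matrix `A` with `M = M[I A]` cannot be scaled into `K` but,
after scaling and pivoting, has a submatrix `A[S]` over `K` that represents a copy of `N`. No
splitter theorem is used. Instead the copy is kept fixed as far as possible, and the labels that
are needed to see that `A` is not scaled are reduced to one or two.

* A connected matrix over `K` can be scaled into `K` in essentially one way only (`Conn.rigid`).
  Adding rows and columns to `A[S]` one by one, and removing the superfluous ones again, leads to
  one of four small configurations (`exists_badExt`): one label that makes `A[S]` bad (`BadOne`),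
  a row and a column that make it bad jointly (`BadTwo`), and, up to duality, two rows `f`, `g`
  and a column `e` that is zero on `S`, such that the ratio of the entries `fe` and `ge` is
  outside `K` (`BadThree`).
* In the last case, if the rows `f` and `g` are not parallel on `S` then a pivot over `fe` gives
  `BadOne`. Otherwise `f`, `g`, `e` span a four-point line which is attached to `A[S ∪ f]` by a
  2-sum. As `M` has no 2-separation there is a blocking sequence for it
  (`LineConfig.exists_blocks`). Its first member is exchanged into the line, which shortens the
  sequence, until some label meets both sides of the 2-separation. Then the different ways to
  contract the line onto its basepoint disagree about scaling into `K`, so that one of them yields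
  a bad label (`LineConfig.hasBadExt`).
* A label that makes `A[S]` bad is a one-element extension or coextension of the copy of `N` which
  is 3-connected, because loops, coloops and parallel elements can be scaled into `K`
  (`Represents.isKConnected_insert`).
* For `BadTwo`, if the row or the column gives a 3-connected matroid together with `A[S]`, then
  the same argument makes the matroid with both labels 3-connected. If neither does, the column is
  parallel to an element `p` and the row is in series with an element `s`. For `p ≠ s` the new
  element may take the place of `p` or of `s`, so that a single label is bad for another copy of
  `N`. For `p = s` there is again a line attached to the copy (`ParallelSeries.hasWitness`).

The passage between matrices and matroids rests on two facts: pivoting multiplies determinants of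
`[I A]` by units, so that it does not change the matroid (`PivotEquiv.represents`), and every base
is the row set of some matrix obtained by pivoting (`Nonsing.exists_pivotEquiv`).
-/

/-! ### Partial fields -/

namespace PartialField

variable {R : Type*} [CommRing R] (P : PartialField R)

/-- A subring `K` is closed under inverses of elements of the group of `P`. If this holds then
`G ∩ K` is a group; the induced sub-partial fields are the ones with group `G ∩ K` for such `K`. -/
def InvClosed (K : Subring R) : Prop :=
  ∀ u ∈ P.units, (u : R) ∈ K → ((u⁻¹ : Rˣ) : R) ∈ K

variable {P}

theorem zero_mem_elems : (0 : R) ∈ P.elems := Or.inr rfl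

theorem coe_mem_elems {u : Rˣ} (hu : u ∈ P.units) : (u : R) ∈ P.elems := Or.inl ⟨u, hu, rfl⟩

theorem one_mem_elems : (1 : R) ∈ P.elems := Or.inl ⟨1, P.units.one_mem, rfl⟩

theorem mul_mem_elems {a b : R} (ha : a ∈ P.elems) (hb : b ∈ P.elems) : a * b ∈ P.elems := by
  rcases ha with ⟨u, hu, rfl⟩ | rfl
  · rcases hb with ⟨v, hv, rfl⟩ | rfl
    · exact Or.inl ⟨u * v, P.units.mul_mem hu hv, by simp⟩
    · simpa using zero_mem_elems
  · simpa using zero_mem_elems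

theorem neg_mem_elems {a : R} (ha : a ∈ P.elems) : -a ∈ P.elems := by
  have h := mul_mem_elems (coe_mem_elems P.neg_one_mem) ha
  simpa using h

theorem neg_one_pow_mem_elems (n : ℕ) : (-1 : R) ^ n ∈ P.elems := by
  rcases neg_one_pow_eq_or R n with h | h <;> rw [h]
  · exact one_mem_elems
  · exact neg_mem_elems one_mem_elems

theorem exists_unit {a : R} (ha : a ∈ P.elems) (h0 : a ≠ 0) : ∃ u ∈ P.units, (u : R) = a := by
  rcases ha with ha | ha
  · exact ha
  · exact absurd ha h0

theorem inverse_mem_elems {a : R} (ha : a ∈ P.elems) : Ring.inverse a ∈ P.elems := by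
  rcases ha with ⟨u, hu, rfl⟩ | rfl
  · rw [Ring.inverse_unit]
    exact coe_mem_elems (P.units.inv_mem hu)
  · rw [Ring.inverse_zero]
    exact zero_mem_elems

end PartialField

/-! ### Labelled matrices and their submatrices -/

namespace LabelledMatrix

variable {α R : Type*} [CommRing R]

theorem ext' {A B : LabelledMatrix α R} (h1 : A.rows = B.rows) (h2 : A.cols = B.cols)
    (h3 : ∀ x y, A.entry x y = B.entry x y) : A = B := by
  cases A; cases B
  simp only at h1 h2
  subst h1 h2
  congr
  funext x y
  exact h3 x y

theorem entry_eq_zero_of_row {A : LabelledMatrix α R} {x y : α} (h : x ∉ A.rows) :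
    A.entry x y = 0 := A.entry_eq_zero x y fun h' => h h'.1

theorem entry_eq_zero_of_col {A : LabelledMatrix α R} {x y : α} (h : y ∉ A.cols) :
    A.entry x y = 0 := A.entry_eq_zero x y fun h' => h h'.2

theorem mem_rows_of_entry {A : LabelledMatrix α R} {x y : α} (h : A.entry x y ≠ 0) :
    x ∈ A.rows := by
  by_contra h'
  exact h (entry_eq_zero_of_row h')

theorem mem_cols_of_entry {A : LabelledMatrix α R} {x y : α} (h : A.entry x y ≠ 0) :
    y ∈ A.cols := by
  by_contra h'
  exact h (entry_eq_zero_of_col h')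

theorem notMem_cols {A : LabelledMatrix α R} {x : α} (h : x ∈ A.rows) : x ∉ A.cols :=
  Finset.disjoint_left.1 A.disjoint h

theorem notMem_rows {A : LabelledMatrix α R} {x : α} (h : x ∈ A.cols) : x ∉ A.rows :=
  Finset.disjoint_right.1 A.disjoint h

theorem row_ne_col {A : LabelledMatrix α R} {x y : α} (hx : x ∈ A.rows) (hy : y ∈ A.cols) :
    x ≠ y := fun e => notMem_cols hx (e ▸ hy)

/-- The set `X ∪ Y` of all labels. -/
def ground (A : LabelledMatrix α R) : Set α := (A.rows : Set α) ∪ (A.cols : Set α)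

theorem mem_ground {A : LabelledMatrix α R} {z : α} : z ∈ A.ground ↔ z ∈ A.rows ∨ z ∈ A.cols := by
  simp [ground]

theorem ground_finite (A : LabelledMatrix α R) : A.ground.Finite :=
  A.rows.finite_toSet.union A.cols.finite_toSet

/-- Multiply every row and every column by a unit. -/
def scale (A : LabelledMatrix α R) (r c : α → Rˣ) : LabelledMatrix α R where
  rows := A.rows
  cols := A.cols
  disjoint := A.disjoint
  entry x y := r x * A.entry x y * c y
  entry_eq_zero x y h := by rw [A.entry_eq_zero x y h]; simp

/-- The transposed matrix. -/
def transpose (A : LabelledMatrix α R) : LabelledMatrix α R where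
  rows := A.cols
  cols := A.rows
  disjoint := A.disjoint.symm
  entry x y := A.entry y x
  entry_eq_zero x y h := A.entry_eq_zero y x fun h' => h ⟨h'.2, h'.1⟩

open Classical in
/-- The submatrix `A[S]` on the labels in `S`. As no label is both a row and a column label, one
set of labels selects the rows as well as the columns. -/
noncomputable def restrict (A : LabelledMatrix α R) (S : Set α) : LabelledMatrix α R where
  rows := A.rows.filter (· ∈ S)
  cols := A.cols.filter (· ∈ S)
  disjoint := Finset.disjoint_filter_filter A.disjoint
  entry x y := if x ∈ S ∧ y ∈ S then A.entry x y else 0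
  entry_eq_zero x y h := by
    split_ifs with h'
    · apply A.entry_eq_zero
      simp only [Finset.mem_filter] at h
      tauto
    · rfl

theorem mem_restrict_rows {A : LabelledMatrix α R} {S : Set α} {x : α} :
    x ∈ (A.restrict S).rows ↔ x ∈ A.rows ∧ x ∈ S := by
  simp [restrict]

theorem mem_restrict_cols {A : LabelledMatrix α R} {S : Set α} {x : α} :
    x ∈ (A.restrict S).cols ↔ x ∈ A.cols ∧ x ∈ S := by
  simp [restrict]

theorem restrict_entry {A : LabelledMatrix α R} {S : Set α} {x y : α} (hx : x ∈ S) (hy : y ∈ S) :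
    (A.restrict S).entry x y = A.entry x y := by
  simp [restrict, hx, hy]

theorem restrict_restrict {A : LabelledMatrix α R} {S T : Set α} :
    (A.restrict S).restrict T = A.restrict (S ∩ T) := by
  apply ext'
  · ext x; simp [restrict, and_assoc]
  · ext x; simp [restrict, and_assoc]
  · intro x y
    simp only [restrict, Set.mem_inter_iff]
    by_cases h1 : x ∈ S <;> by_cases h2 : x ∈ T <;> by_cases h3 : y ∈ S <;>
      by_cases h4 : y ∈ T <;> simp [h1, h2, h3, h4]

theorem restrict_ground {A : LabelledMatrix α R} {S : Set α} :
    (A.restrict S).ground = A.ground ∩ S := by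
  ext z
  simp only [mem_ground, mem_restrict_rows, mem_restrict_cols, Set.mem_inter_iff]
  tauto

theorem restrict_eq_self {A : LabelledMatrix α R} {S : Set α} (h : A.ground ⊆ S) :
    A.restrict S = A := by
  apply ext'
  · ext x
    rw [mem_restrict_rows]
    exact ⟨fun h => h.1, fun hx => ⟨hx, h (mem_ground.2 (Or.inl hx))⟩⟩
  · ext x
    rw [mem_restrict_cols]
    exact ⟨fun h => h.1, fun hx => ⟨hx, h (mem_ground.2 (Or.inr hx))⟩⟩
  · intro x y
    by_cases hx : x ∈ A.rows
    · by_cases hy : y ∈ A.cols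
      · exact restrict_entry (h (mem_ground.2 (Or.inl hx))) (h (mem_ground.2 (Or.inr hy)))
      · rw [entry_eq_zero_of_col hy, entry_eq_zero_of_col]
        rw [mem_restrict_cols]; tauto
    · rw [entry_eq_zero_of_row hx, entry_eq_zero_of_row]
      rw [mem_restrict_rows]; tauto

/-! ### Pivoting -/

section Pivot

variable {A : LabelledMatrix α R} {x y : α} {hx : x ∈ A.rows} {hy : y ∈ A.cols}

theorem mem_pivot_rows {z : α} : z ∈ (A.pivot x y hx hy).rows ↔ z = y ∨ (z ∈ A.rows ∧ z ≠ x) := by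
  simp [pivot, mk', and_comm]

theorem mem_pivot_cols {z : α} : z ∈ (A.pivot x y hx hy).cols ↔ z = x ∨ (z ∈ A.cols ∧ z ≠ y) := by
  simp [pivot, mk', and_comm]

theorem pivot_ground : (A.pivot x y hx hy).ground = A.ground := by
  ext z
  simp only [mem_ground, mem_pivot_rows, mem_pivot_cols]
  by_cases h1 : z = x
  · subst h1; simp [hx]
  · by_cases h2 : z = y
    · subst h2; simp [hy]
    · tauto

theorem pivot_entry_pivot : (A.pivot x y hx hy).entry y x = Ring.inverse (A.entry x y) := by
  simp [pivot, mk']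

theorem pivot_entry_row {v : α} (h1 : v ≠ x) (h2 : v ≠ y) :
    (A.pivot x y hx hy).entry y v = Ring.inverse (A.entry x y) * A.entry x v := by
  by_cases hv : v ∈ A.cols
  · simp [pivot, mk', h1, h2, hv]
  · simp [pivot, mk', h1, hv, entry_eq_zero_of_col hv]

theorem pivot_entry_col {u : α} (h1 : u ≠ x) (h2 : u ≠ y) :
    (A.pivot x y hx hy).entry u x = -(Ring.inverse (A.entry x y) * A.entry u y) := by
  by_cases hv : u ∈ A.rows
  · simp [pivot, mk', h1, h2, hv]
  · simp [pivot, mk', h2, hv, entry_eq_zero_of_row hv]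

theorem pivot_entry {u v : α} (hu1 : u ≠ x) (hu2 : u ≠ y) (hv1 : v ≠ x) (hv2 : v ≠ y) :
    (A.pivot x y hx hy).entry u v =
      A.entry u v - Ring.inverse (A.entry x y) * A.entry u y * A.entry x v := by
  by_cases hu : u ∈ A.rows
  · by_cases hv : v ∈ A.cols
    · simp [pivot, mk', hu1, hu2, hv1, hv2, hu, hv]
    · simp [pivot, mk', hv1, hv, entry_eq_zero_of_col hv]
  · simp [pivot, mk', hu2, hu, entry_eq_zero_of_row hu]

end Pivot

/-! ### Subdeterminants of `[I A]` -/

section Det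

variable {A : LabelledMatrix α R}

theorem augEntry_row {x z : α} (hz : z ∈ A.rows) (h : x ≠ z) : A.augEntry x z = 0 := by
  simp [augEntry, hz, h]

theorem augEntry_self {z : α} (hz : z ∈ A.rows) : A.augEntry z z = 1 := by
  simp [augEntry, hz]

theorem augEntry_of_notMem {x z : α} (hz : z ∉ A.rows) : A.augEntry x z = A.entry x z := by
  simp [augEntry, hz]

/-- Expanding along a column of the identity matrix reduces a subdeterminant of `[I A]` to a smaller
one, and in the end to a subdeterminant of `A`. -/
theorem det_augEntry_mem {P : PartialField R} (hA : A.IsMatrixOver P) :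
    ∀ (n : ℕ) (u w : Fin n → α), (∀ i, u i ∈ A.rows) →
      (Matrix.of fun i j => A.augEntry (u i) (w j)).det ∈ P.elems := by
  intro n
  induction n with
  | zero => intro u w _; simpa using PartialField.one_mem_elems
  | succ n ih =>
    intro u w hu
    by_cases hui : Function.Injective u
    swap
    · rw [Function.Injective] at hui
      push Not at hui
      obtain ⟨i, j, h1, h2⟩ := hui
      rw [Matrix.det_zero_of_row_eq h2]
      · exact PartialField.zero_mem_elems
      · funext k; simp [h1]
    by_cases hwi : Function.Injective w
    swap
    · rw [Function.Injective] at hwi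
      push Not at hwi
      obtain ⟨i, j, h1, h2⟩ := hwi
      rw [Matrix.det_zero_of_column_eq h2]
      · exact PartialField.zero_mem_elems
      · intro k; simp [h1]
    by_cases hr : ∃ j, w j ∈ A.rows
    · obtain ⟨j, hj⟩ := hr
      rw [Matrix.det_succ_column _ j]
      -- the column `w j` of `[I A]` is a unit vector, so at most one summand is nonzero
      by_cases hex : ∃ i, u i = w j
      · obtain ⟨i, hi⟩ := hex
        rw [Finset.sum_eq_single i]
        · refine PartialField.mul_mem_elems (PartialField.mul_mem_elems
            (PartialField.neg_one_pow_mem_elems _) ?_) ?_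
          · simp only [Matrix.of_apply]
            rw [hi, augEntry_self hj]
            exact PartialField.one_mem_elems
          · exact ih (fun k => u (i.succAbove k)) (fun k => w (j.succAbove k)) fun k => hu _
        · intro k _ hk
          simp only [Matrix.of_apply]
          rw [augEntry_row hj]
          · simp
          · intro h; exact hk (hui (h.trans hi.symm))
        · simp
      · rw [Finset.sum_eq_zero]
        · exact PartialField.zero_mem_elems
        · intro k _
          simp only [Matrix.of_apply]
          rw [augEntry_row hj]
          · simp
          · intro h; exact hex ⟨k, h⟩
    · push Not at hr
      by_cases hc : ∀ j, w j ∈ A.cols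
      · have := hA (n + 1) ⟨fun i => ⟨u i, hu i⟩, fun i j h => hui (by simpa using h)⟩
          ⟨fun i => ⟨w i, hc i⟩, fun i j h => hwi (by simpa using h)⟩
        convert this using 3
        ext i j
        simp only [augEntry_of_notMem (hr j)]
        rfl
      · push Not at hc
        obtain ⟨j, hj⟩ := hc
        rw [Matrix.det_eq_zero_of_column_eq_zero j]
        · exact PartialField.zero_mem_elems
        · intro i
          simp only [Matrix.of_apply]
          rw [augEntry_of_notMem (hr j), entry_eq_zero_of_col hj]

theorem isMatrixOver_of_det_augEntry {P : PartialField R}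
    (h : ∀ (n : ℕ) (u w : Fin n → α), (∀ i, u i ∈ A.rows) →
      (Matrix.of fun i j => A.augEntry (u i) (w j)).det ∈ P.elems) : A.IsMatrixOver P := by
  intro n f g
  convert h n (fun i => f i) (fun i => g i) (fun i => (f i).2) using 3
  ext i j
  rw [augEntry_of_notMem (notMem_rows (g j).2)]

theorem entry_mem_elems {P : PartialField R} (hA : A.IsMatrixOver P) (x y : α) :
    A.entry x y ∈ P.elems := by
  by_cases hx : x ∈ A.rows
  · by_cases hy : y ∈ A.cols
    · have := det_augEntry_mem hA 1 (fun _ => x) (fun _ => y) (fun _ => hx)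
      simpa [augEntry_of_notMem (notMem_rows hy)] using this
    · rw [entry_eq_zero_of_col hy]; exact PartialField.zero_mem_elems
  · rw [entry_eq_zero_of_row hx]; exact PartialField.zero_mem_elems

theorem det_two_mem_elems {P : PartialField R} (hA : A.IsMatrixOver P) (x x' y y' : α) :
    A.entry x y * A.entry x' y' - A.entry x y' * A.entry x' y ∈ P.elems := by
  by_cases hx : x ∈ A.rows
  swap
  · simpa [entry_eq_zero_of_row hx] using PartialField.zero_mem_elems
  by_cases hx' : x' ∈ A.rows
  swap
  · simpa [entry_eq_zero_of_row hx'] using PartialField.zero_mem_elems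
  by_cases hy : y ∈ A.cols
  swap
  · simpa [entry_eq_zero_of_col hy] using PartialField.zero_mem_elems
  by_cases hy' : y' ∈ A.cols
  swap
  · simpa [entry_eq_zero_of_col hy'] using PartialField.zero_mem_elems
  have := det_augEntry_mem hA 2 ![x, x'] ![y, y'] (by intro i; fin_cases i <;> simpa)
  simpa [Matrix.det_fin_two, augEntry_of_notMem (notMem_rows hy),
    augEntry_of_notMem (notMem_rows hy')] using this

theorem inverse_mul_entry {P : PartialField R} (hA : A.IsMatrixOver P) {x y : α}
    (h : A.entry x y ≠ 0) : Ring.inverse (A.entry x y) * A.entry x y = 1 := by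
  obtain ⟨u, _, hu⟩ := PartialField.exists_unit (entry_mem_elems hA x y) h
  rw [← hu]; simp

theorem pivot_augEntry_pivot {x y : α} {hx : x ∈ A.rows} {hy : y ∈ A.cols}
    (h : Ring.inverse (A.entry x y) * A.entry x y = 1) (z : α) :
    (A.pivot x y hx hy).augEntry y z = Ring.inverse (A.entry x y) * A.augEntry x z := by
  by_cases h1 : z = y
  · subst h1
    rw [augEntry_self (mem_pivot_rows.2 (Or.inl rfl)), augEntry_of_notMem (notMem_rows hy), h]
  by_cases h2 : z = x
  · subst h2
    rw [augEntry_of_notMem (by rw [mem_pivot_rows]; tauto), augEntry_self hx, pivot_entry_pivot,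
      mul_one]
  by_cases h3 : z ∈ A.rows
  · rw [augEntry_row (mem_pivot_rows.2 (Or.inr ⟨h3, h2⟩)) (Ne.symm h1),
      augEntry_row h3 (Ne.symm h2), mul_zero]
  · rw [augEntry_of_notMem (by rw [mem_pivot_rows]; tauto), augEntry_of_notMem h3,
      pivot_entry_row h2 h1]

theorem pivot_augEntry {x y : α} {hx : x ∈ A.rows} {hy : y ∈ A.cols}
    (h : Ring.inverse (A.entry x y) * A.entry x y = 1) {r : α} (h1 : r ≠ x) (h2 : r ≠ y) (z : α) :
    (A.pivot x y hx hy).augEntry r z =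
      A.augEntry r z - A.entry r y * (Ring.inverse (A.entry x y) * A.augEntry x z) := by
  by_cases hz : z = y
  · subst hz
    rw [augEntry_row (mem_pivot_rows.2 (Or.inl rfl)) h2, augEntry_of_notMem (notMem_rows hy),
      augEntry_of_notMem (notMem_rows hy), h]
    ring
  by_cases hzx : z = x
  · subst hzx
    rw [augEntry_of_notMem (by rw [mem_pivot_rows]; tauto), augEntry_self hx,
      augEntry_row hx h1, pivot_entry_col h1 h2]
    ring
  by_cases h3 : z ∈ A.rows
  · by_cases hrz : r = z
    · subst hrz
      rw [augEntry_self (mem_pivot_rows.2 (Or.inr ⟨h3, h1⟩)), augEntry_self h3,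
        augEntry_row h3 (Ne.symm h1)]
      ring
    · rw [augEntry_row (mem_pivot_rows.2 (Or.inr ⟨h3, hzx⟩)) hrz, augEntry_row h3 hrz,
        augEntry_row h3 (Ne.symm hzx)]
      ring
  · rw [augEntry_of_notMem (by rw [mem_pivot_rows]; tauto), augEntry_of_notMem h3,
      augEntry_of_notMem h3, pivot_entry h1 h2 hzx hz]
    ring

/-- Pivoting over `xy` acts on `[I A]` by invertible row operations, which multiply the
determinant of a set of rows that contains the new row `y` by the inverse of the pivot entry. -/
theorem det_pivot_augEntry {x y : α} {hx : x ∈ A.rows} {hy : y ∈ A.cols}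
    (h : Ring.inverse (A.entry x y) * A.entry x y = 1) {ι : Type*} [Fintype ι] [DecidableEq ι]
    (u w : ι → α) (hu : ∀ i, u i ∈ (A.pivot x y hx hy).rows) (k : ι) (hk : u k = y)
    (hk' : ∀ i, u i = y → i = k) :
    (Matrix.of fun i j => (A.pivot x y hx hy).augEntry (u i) (w j)).det =
      Ring.inverse (A.entry x y) *
        (Matrix.of fun i j => A.augEntry (if i = k then x else u i) (w j)).det := by
  set a := Ring.inverse (A.entry x y)
  have h1 : (Matrix.of fun i j => (A.pivot x y hx hy).augEntry (u i) (w j)).det =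
      (Matrix.of fun i j => (if i = k then a else 1) *
        (Matrix.of fun i j => A.augEntry (if i = k then x else u i) (w j)) i j).det := by
    refine Matrix.det_eq_of_forall_row_eq_smul_add_const
      (fun i => if i = k then 0 else - A.entry (u i) y) k (by simp) ?_
    intro i j
    by_cases hi : i = k
    · subst hi
      simp [hk, pivot_augEntry_pivot h, a]
    · have h2 : u i ≠ y := fun e => hi (hk' i e)
      have h3 : u i ≠ x := by
        rintro e
        rcases mem_pivot_rows.1 (hu i) with h | h
        · exact h2 h
        · exact h.2 e
      simp only [Matrix.of_apply, if_neg hi, if_true]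
      rw [pivot_augEntry h h3 h2]
      ring
  rw [h1, Matrix.det_mul_column]
  simp

end Det

/-- Subdeterminants of a pivot of `A` are, up to a unit of the group, subdeterminants of `[I A]`. -/
theorem isMatrixOver_pivot {P : PartialField R} {A : LabelledMatrix α R} (hA : A.IsMatrixOver P)
    {x y : α} {hx : x ∈ A.rows} {hy : y ∈ A.cols} (h0 : A.entry x y ≠ 0) :
    (A.pivot x y hx hy).IsMatrixOver P := by
  have h := inverse_mul_entry hA h0
  have hx' : ∀ {z}, z ∈ (A.pivot x y hx hy).rows → z ≠ y → z ∈ A.rows := by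
    intro z hz hzy
    rcases mem_pivot_rows.1 hz with h | h
    · exact absurd h hzy
    · exact h.1
  -- determinants of sets of rows that contain `y`
  have key : ∀ (n : ℕ) (u w : Fin n → α), (∀ i, u i ∈ (A.pivot x y hx hy).rows) →
      (∃ k, u k = y) →
      (Matrix.of fun i j => (A.pivot x y hx hy).augEntry (u i) (w j)).det ∈ P.elems := by
    rintro n u w hu ⟨k, hk⟩
    by_cases hk' : ∀ i, u i = y → i = k
    · rw [det_pivot_augEntry h u w hu k hk hk']
      refine PartialField.mul_mem_elems
        (PartialField.inverse_mem_elems (entry_mem_elems hA x y))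
        (det_augEntry_mem hA n (fun i => if i = k then x else u i) w ?_)
      intro i
      split_ifs with hi
      · exact hx
      · exact hx' (hu i) fun e => hi (hk' i e)
    · push Not at hk'
      obtain ⟨i, hi, hik⟩ := hk'
      rw [Matrix.det_zero_of_row_eq hik]
      · exact PartialField.zero_mem_elems
      · funext j; simp [hi, hk]
  apply isMatrixOver_of_det_augEntry
  intro n u w hu
  by_cases hk : ∃ k, u k = y
  · exact key n u w hu hk
  -- otherwise add the row `y` and the column `y`, which is a unit vector of `[I A]`
  push Not at hk
  have hy' : y ∈ (A.pivot x y hx hy).rows := mem_pivot_rows.2 (Or.inl rfl)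
  have := key (n + 1) (Fin.cons y u) (Fin.cons y w)
    (fun i => by refine Fin.cases ?_ (fun i => ?_) i <;> simp [hy', hu]) ⟨0, by simp⟩
  rw [Matrix.det_succ_column_zero, Finset.sum_eq_single 0] at this
  · simpa [augEntry_self hy', Matrix.submatrix, Fin.succAbove_zero] using this
  · intro i _ hi
    obtain ⟨j, rfl⟩ := Fin.exists_succ_eq.2 hi
    simp [augEntry_row hy' (hk j)]
  · simp

/-- Pivoting back over the same position gives the original matrix; with the sign convention of
`pivot` no scaling is needed. -/
theorem pivot_pivot {P : PartialField R} {A : LabelledMatrix α R}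
    (hA : A.IsMatrixOver P) {x y : α} {hx : x ∈ A.rows} {hy : y ∈ A.cols} (h0 : A.entry x y ≠ 0)
    {hy' : y ∈ (A.pivot x y hx hy).rows}
    {hx' : x ∈ (A.pivot x y hx hy).cols} : (A.pivot x y hx hy).pivot y x hy' hx' = A := by
  have hxy : x ≠ y := row_ne_col hx hy
  obtain ⟨a, ha, ha'⟩ := PartialField.exists_unit (entry_mem_elems hA x y) h0
  have hin : Ring.inverse ((A.pivot x y hx hy).entry y x) = A.entry x y := by
    rw [pivot_entry_pivot, ← ha', Ring.inverse_unit, Ring.inverse_unit, inv_inv]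
  have hmul := inverse_mul_entry hA h0
  have hyr : y ∉ A.rows := notMem_rows hy
  have hxc : x ∉ A.cols := notMem_cols hx
  have hrows : ((A.pivot x y hx hy).pivot y x hy' hx').rows = A.rows := by
    ext z
    rw [mem_pivot_rows, mem_pivot_rows]
    constructor
    · rintro (rfl | ⟨rfl | h, h'⟩)
      exacts [hx, absurd rfl h', h.1]
    · intro hz
      by_cases h : z = x
      · exact Or.inl h
      · exact Or.inr ⟨Or.inr ⟨hz, h⟩, fun e => hyr (e ▸ hz)⟩
  have hcols : ((A.pivot x y hx hy).pivot y x hy' hx').cols = A.cols := by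
    ext z
    rw [mem_pivot_cols, mem_pivot_cols]
    constructor
    · rintro (rfl | ⟨rfl | h, h'⟩)
      exacts [hy, absurd rfl h', h.1]
    · intro hz
      by_cases h : z = y
      · exact Or.inl h
      · exact Or.inr ⟨Or.inr ⟨hz, h⟩, fun e => hxc (e ▸ hz)⟩
  refine ext' hrows hcols fun u v => ?_
  by_cases huv : u ∈ A.rows ∧ v ∈ A.cols
  swap
  · rw [A.entry_eq_zero u v huv, entry_eq_zero]
    rwa [hrows, hcols]
  obtain ⟨hu, hv⟩ := huv
  have huy : u ≠ y := fun e => hyr (e ▸ hu)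
  have hvx : v ≠ x := fun e => hxc (e ▸ hv)
  by_cases h1 : u = x
  · subst h1
    by_cases h2 : v = y
    · subst h2
      rw [pivot_entry_pivot, hin]
    · rw [pivot_entry_row h2 hvx, hin, pivot_entry_row hvx h2]
      linear_combination A.entry u v * hmul
  · by_cases h2 : v = y
    · subst h2
      rw [pivot_entry_col huy h1, hin, pivot_entry_col h1 huy]
      linear_combination A.entry u v * hmul
    · rw [pivot_entry huy h1 h2 hvx, hin, pivot_entry_row hvx h2, pivot_entry_col h1 huy,
        pivot_entry h1 huy hvx h2]
      linear_combination
        A.entry u y * A.entry x v * Ring.inverse (A.entry x y) * hmul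

theorem isMatrixOver_scale {P : PartialField R} {A : LabelledMatrix α R} (hA : A.IsMatrixOver P)
    {r c : α → Rˣ} (hr : ∀ x, r x ∈ P.units) (hc : ∀ y, c y ∈ P.units) :
    (A.scale r c).IsMatrixOver P := by
  intro n f g
  have : (Matrix.of fun i j => (A.scale r c).entry (f i) (g j)).det =
      (∏ i, (c (g i) : R)) * ((∏ i, (r (f i) : R)) *
        (Matrix.of fun i j => A.entry (f i) (g j)).det) := by
    rw [← Matrix.det_mul_column, ← Matrix.det_mul_row]
    congr 1
    ext i j
    simp [scale]
    ring
  rw [this]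
  refine PartialField.mul_mem_elems ?_ (PartialField.mul_mem_elems ?_ (hA n f g))
  · have := PartialField.coe_mem_elems
      (P.units.prod_mem (t := Finset.univ) (f := fun i => c (g i)) fun i _ => hc _)
    simpa using this
  · have := PartialField.coe_mem_elems
      (P.units.prod_mem (t := Finset.univ) (f := fun i => r (f i)) fun i _ => hr _)
    simpa using this

theorem isMatrixOver_restrict {P : PartialField R} {A : LabelledMatrix α R}
    (hA : A.IsMatrixOver P) (S : Set α) : (A.restrict S).IsMatrixOver P := by
  intro n f g
  have hf : ∀ i, (f i : α) ∈ A.rows ∧ (f i : α) ∈ S := fun i => mem_restrict_rows.1 (f i).2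
  have hg : ∀ i, (g i : α) ∈ A.cols ∧ (g i : α) ∈ S := fun i => mem_restrict_cols.1 (g i).2
  convert hA n ⟨fun i => ⟨f i, (hf i).1⟩, fun i j h => f.injective (Subtype.ext (by simpa using h))⟩
    ⟨fun i => ⟨g i, (hg i).1⟩, fun i j h => g.injective (Subtype.ext (by simpa using h))⟩ using 3
  ext i j
  simp only [restrict_entry (hf i).2 (hg j).2]
  rfl

theorem isMatrixOver_transpose {P : PartialField R} {A : LabelledMatrix α R}
    (hA : A.IsMatrixOver P) : A.transpose.IsMatrixOver P := by
  intro n f g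
  rw [← Matrix.det_transpose]
  exact hA n g f

/-! ### Scaling and pivoting as an equivalence -/

variable (P : PartialField R)

/-- One step that does not change the represented matroid: scaling rows and columns by elements
of the group, or pivoting over a nonzero entry. -/
inductive EquivStep : LabelledMatrix α R → LabelledMatrix α R → Prop
  | scale (A : LabelledMatrix α R) (r c : α → Rˣ) (hr : ∀ x, r x ∈ P.units)
      (hc : ∀ y, c y ∈ P.units) : EquivStep A (A.scale r c)
  | pivot (A : LabelledMatrix α R) (x y : α) (hx : x ∈ A.rows) (hy : y ∈ A.cols)
      (h : A.entry x y ≠ 0) : EquivStep A (A.pivot x y hx hy)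

/-- `A'` arises from `A` by scaling and pivoting. -/
def PivotEquiv (A A' : LabelledMatrix α R) : Prop := Relation.ReflTransGen (EquivStep P) A A'

variable {P}

theorem PivotEquiv.refl (A : LabelledMatrix α R) : PivotEquiv P A A := Relation.ReflTransGen.refl

theorem PivotEquiv.trans {A B C : LabelledMatrix α R} (h : PivotEquiv P A B)
    (h' : PivotEquiv P B C) : PivotEquiv P A C := Relation.ReflTransGen.trans h h'

theorem pivotEquiv_scale {A : LabelledMatrix α R} {r c : α → Rˣ} (hr : ∀ x, r x ∈ P.units)
    (hc : ∀ y, c y ∈ P.units) : PivotEquiv P A (A.scale r c) :=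
  Relation.ReflTransGen.single (EquivStep.scale A r c hr hc)

theorem pivotEquiv_pivot {A : LabelledMatrix α R} {x y : α} {hx : x ∈ A.rows} {hy : y ∈ A.cols}
    (h : A.entry x y ≠ 0) : PivotEquiv P A (A.pivot x y hx hy) :=
  Relation.ReflTransGen.single (EquivStep.pivot A x y hx hy h)

theorem PivotEquiv.isMatrixOver {A B : LabelledMatrix α R} (h : PivotEquiv P A B)
    (hA : A.IsMatrixOver P) : B.IsMatrixOver P := by
  induction h with
  | refl => exact hA
  | tail _ h ih =>
    cases h with
    | scale r c hr hc => exact isMatrixOver_scale ih hr hc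
    | pivot x y hx hy h => exact isMatrixOver_pivot ih h

theorem PivotEquiv.ground_eq {A B : LabelledMatrix α R} (h : PivotEquiv P A B) :
    B.ground = A.ground := by
  induction h with
  | refl => rfl
  | tail _ h ih =>
    cases h with
    | scale r c hr hc => exact ih
    | pivot x y hx hy h => rw [pivot_ground, ih]

theorem PivotEquiv.transpose {A B : LabelledMatrix α R} (h : PivotEquiv P A B) :
    PivotEquiv P A.transpose B.transpose := by
  classical
  induction h with
  | refl => exact PivotEquiv.refl _
  | @tail B C _ h ih =>
    cases h with
    | scale r c hr hc =>
      refine ih.trans ?_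
      have : (B.scale r c).transpose = B.transpose.scale c r := by
        refine ext' (by rfl) (by rfl) fun x y => ?_
        simp only [LabelledMatrix.transpose, LabelledMatrix.scale]
        ring
      rw [this]
      exact pivotEquiv_scale hc hr
    | pivot x y hx hy h =>
      -- transposing a pivot changes the signs of the pivot row and of the pivot column
      have h1 : PivotEquiv P B.transpose (B.transpose.pivot y x hy hx) := pivotEquiv_pivot h
      have hs : ∀ (w z : α), (if z = w then (-1 : Rˣ) else 1) ∈ P.units := by
        intro w z
        split_ifs
        · exact P.neg_one_mem
        · exact P.units.one_mem
      refine ih.trans (h1.trans ?_)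
      have hxy : x ≠ y := row_ne_col hx hy
      have : (B.pivot x y hx hy).transpose = (B.transpose.pivot y x hy hx).scale
          (fun z => if z = x then -1 else 1) (fun z => if z = y then -1 else 1) := by
        apply ext'
        · rfl
        · rfl
        · intro u v
          simp only [LabelledMatrix.transpose, LabelledMatrix.scale, LabelledMatrix.pivot, mk']
          by_cases h1 : u = x <;> by_cases h2 : v = y <;> by_cases h3 : u = y <;>
            by_cases h4 : v = x <;> by_cases h5 : v ∈ B.rows <;> by_cases h6 : u ∈ B.cols <;>
            (simp_all; try ring)
      rw [this]
      exact pivotEquiv_scale (hs x) (hs y)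

end LabelledMatrix

/-! ### Scaling into a subring -/

namespace PartialField

variable {R : Type*} [CommRing R] {P : PartialField R} {K : Subring R}

/-- The group `G ∩ K`. -/
def subgroupIn (hK : P.InvClosed K) : Subgroup Rˣ where
  carrier := {u | u ∈ P.units ∧ (u : R) ∈ K}
  one_mem' := ⟨P.units.one_mem, K.one_mem⟩
  mul_mem' ha hb := ⟨P.units.mul_mem ha.1 hb.1, by simpa using K.mul_mem ha.2 hb.2⟩
  inv_mem' ha := ⟨P.units.inv_mem ha.1, hK _ ha.1 ha.2⟩

theorem mul_ne_zero {a b : R} (ha : a ∈ P.elems) (ha0 : a ≠ 0) (hb0 : b ≠ 0) : a * b ≠ 0 := by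
  obtain ⟨u, _, rfl⟩ := exists_unit ha ha0
  intro h
  exact hb0 (by simpa using h)

theorem inverse_ne_zero {a : R} (ha : a ∈ P.elems) (ha0 : a ≠ 0) : Ring.inverse a ≠ 0 := by
  obtain ⟨u, _, rfl⟩ := exists_unit ha ha0
  rw [Ring.inverse_unit]
  intro h
  apply ha0
  have := u.mul_inv
  rw [h, mul_zero] at this
  rw [← mul_one (u : R), ← this, mul_zero]

theorem inverse_mem (hK : P.InvClosed K) {a : R} (ha : a ∈ P.elems) (haK : a ∈ K) :
    Ring.inverse a ∈ K := by
  rcases ha with ⟨u, hu, rfl⟩ | rfl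
  · rw [Ring.inverse_unit]
    exact hK u hu haK
  · rw [Ring.inverse_zero]
    exact K.zero_mem

/-- `b` is not a multiple of `a` with a factor in `K`. For nonzero elements of a partial field this
says that the ratio of `a` and `b` is outside `K`. -/
def NotMultiple (K : Subring R) (a b : R) : Prop := a ≠ 0 ∧ ∀ k ∈ K, b ≠ k * a

theorem NotMultiple.ne_zero {a b : R} (h : NotMultiple K a b) : b ≠ 0 := by
  intro hb
  exact h.2 0 K.zero_mem (by rw [hb, zero_mul])

theorem NotMultiple.symm (hK : P.InvClosed K) {a b : R} (ha : a ∈ P.elems) (hb : b ∈ P.elems)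
    (h : NotMultiple K a b) : NotMultiple K b a := by
  refine ⟨h.ne_zero, ?_⟩
  intro k hk hab
  obtain ⟨u, hu, rfl⟩ := exists_unit ha h.1
  obtain ⟨v, hv, rfl⟩ := exists_unit hb h.ne_zero
  have hk' : k = ((u * v⁻¹ : Rˣ) : R) := by
    rw [Units.val_mul, hab, mul_assoc, Units.mul_inv, mul_one]
  have := hK _ (P.units.mul_mem hu (P.units.inv_mem hv)) (hk' ▸ hk)
  exact h.2 _ this (by simp)

end PartialField

open PartialField

namespace LabelledMatrix

variable {α R : Type*} [CommRing R] {P : PartialField R} {K : Subring R}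
variable {A A' : LabelledMatrix α R} {S T : Set α}

/-- All entries of `A[S]` lie in `K`. -/
def EntriesIn (K : Subring R) (A : LabelledMatrix α R) (S : Set α) : Prop :=
  ∀ x ∈ S, ∀ y ∈ S, A.entry x y ∈ K

/-- The entries of `A[S]` can be scaled into `K`. -/
def ScalesInto (P : PartialField R) (K : Subring R) (A : LabelledMatrix α R) (S : Set α) : Prop :=
  ∃ r c : α → Rˣ, (∀ x, r x ∈ P.units) ∧ (∀ y, c y ∈ P.units) ∧
    ∀ x ∈ S, ∀ y ∈ S, (r x : R) * A.entry x y * c y ∈ K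

/-- The bipartite graph of `A[S]`, whose edges are the nonzero entries, is connected: a set of
labels that no edge leaves contains all labels in `S` or none. -/
def Conn (A : LabelledMatrix α R) (S : Set α) : Prop :=
  ∀ W : Set α, (∀ x ∈ S, ∀ y ∈ S, A.entry x y ≠ 0 → (x ∈ W ↔ y ∈ W)) →
    (∃ z ∈ A.ground, z ∈ S ∧ z ∈ W) → ∀ z ∈ A.ground, z ∈ S → z ∈ W

/-- `A[S] = A'[S]`. -/
structure AgreeOn (A A' : LabelledMatrix α R) (S : Set α) : Prop where
  rows : ∀ x ∈ S, (x ∈ A'.rows ↔ x ∈ A.rows)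
  cols : ∀ x ∈ S, (x ∈ A'.cols ↔ x ∈ A.cols)
  entry : ∀ x ∈ S, ∀ y ∈ S, A'.entry x y = A.entry x y

theorem AgreeOn.refl (A : LabelledMatrix α R) (S : Set α) : AgreeOn A A S :=
  ⟨fun _ _ => Iff.rfl, fun _ _ => Iff.rfl, fun _ _ _ _ => rfl⟩

theorem AgreeOn.trans {A'' : LabelledMatrix α R} (h : AgreeOn A A' S) (h' : AgreeOn A' A'' S) :
    AgreeOn A A'' S :=
  ⟨fun x hx => (h'.rows x hx).trans (h.rows x hx), fun x hx => (h'.cols x hx).trans (h.cols x hx),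
    fun x hx y hy => (h'.entry x hx y hy).trans (h.entry x hx y hy)⟩

theorem AgreeOn.mono (h : AgreeOn A A' S) (hT : T ⊆ S) : AgreeOn A A' T :=
  ⟨fun x hx => h.rows x (hT hx), fun x hx => h.cols x (hT hx),
    fun x hx y hy => h.entry x (hT hx) y (hT hy)⟩

theorem AgreeOn.transpose (h : AgreeOn A A' S) : AgreeOn A.transpose A'.transpose S :=
  ⟨h.cols, h.rows, fun x hx y hy => h.entry y hy x hx⟩

theorem AgreeOn.restrict_eq (h : AgreeOn A A' S) : A'.restrict S = A.restrict S := by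
  apply ext'
  · ext x
    rw [mem_restrict_rows, mem_restrict_rows]
    exact ⟨fun hx => ⟨(h.rows x hx.2).1 hx.1, hx.2⟩, fun hx => ⟨(h.rows x hx.2).2 hx.1, hx.2⟩⟩
  · ext x
    rw [mem_restrict_cols, mem_restrict_cols]
    exact ⟨fun hx => ⟨(h.cols x hx.2).1 hx.1, hx.2⟩, fun hx => ⟨(h.cols x hx.2).2 hx.1, hx.2⟩⟩
  · intro x y
    by_cases hx : x ∈ S
    · by_cases hy : y ∈ S
      · rw [restrict_entry hx hy, restrict_entry hx hy, h.entry x hx y hy]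
      · simp [restrict, hy]
    · simp [restrict, hx]

theorem AgreeOn.mem_ground (h : AgreeOn A A' S) {x : α} (hx : x ∈ S) :
    x ∈ A'.ground ↔ x ∈ A.ground := by
  rw [LabelledMatrix.mem_ground, LabelledMatrix.mem_ground, h.rows x hx, h.cols x hx]

theorem AgreeOn.entriesIn (h : AgreeOn A A' S) (hS : EntriesIn K A S) : EntriesIn K A' S :=
  fun x hx y hy => by rw [h.entry x hx y hy]; exact hS x hx y hy

theorem AgreeOn.conn (h : AgreeOn A A' S) (hS : Conn A S) : Conn A' S := by
  rintro W hW ⟨z, hz, hzS, hzW⟩ t ht htS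
  refine hS W ?_ ⟨z, (h.mem_ground hzS).1 hz, hzS, hzW⟩ t ((h.mem_ground htS).1 ht) htS
  intro x hx y hy hxy
  exact hW x hx y hy (by rwa [h.entry x hx y hy])

theorem EntriesIn.mono (h : EntriesIn K A S) (hT : T ⊆ S) : EntriesIn K A T :=
  fun x hx y hy => h x (hT hx) y (hT hy)

theorem ScalesInto.mono (h : ScalesInto P K A S) (hT : T ⊆ S) : ScalesInto P K A T := by
  obtain ⟨r, c, hr, hc, hrc⟩ := h
  exact ⟨r, c, hr, hc, fun x hx y hy => hrc x (hT hx) y (hT hy)⟩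

theorem EntriesIn.scalesInto (h : EntriesIn K A S) : ScalesInto P K A S :=
  ⟨1, 1, fun _ => P.units.one_mem, fun _ => P.units.one_mem, fun x hx y hy => by
    simpa using h x hx y hy⟩

theorem EntriesIn.transpose (h : EntriesIn K A S) : EntriesIn K A.transpose S :=
  fun x hx y hy => h y hy x hx

theorem ScalesInto.transpose (h : ScalesInto P K A S) : ScalesInto P K A.transpose S := by
  obtain ⟨r, c, hr, hc, hrc⟩ := h
  refine ⟨c, r, hc, hr, fun x hx y hy => ?_⟩
  have := hrc y hy x hx
  rw [mul_assoc, mul_comm, mul_comm (A.entry y x)] at this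
  exact this

theorem transpose_ground : A.transpose.ground = A.ground := Set.union_comm _ _

theorem Conn.transpose (h : Conn A S) : Conn A.transpose S := by
  intro W hW hz
  rw [transpose_ground] at *
  exact h W (fun x hx y hy hxy => (hW y hy x hx hxy).symm) hz

theorem ScalesInto.of_scale {r c : α → Rˣ} (hr : ∀ x, r x ∈ P.units) (hc : ∀ y, c y ∈ P.units)
    (h : ScalesInto P K (A.scale r c) S) : ScalesInto P K A S := by
  obtain ⟨r', c', hr', hc', h⟩ := h
  refine ⟨r' * r, c * c', fun x => P.units.mul_mem (hr' x) (hr x),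
    fun x => P.units.mul_mem (hc x) (hc' x), fun x hx y hy => ?_⟩
  have := h x hx y hy
  simp only [scale] at this
  simpa [mul_assoc] using this

theorem ScalesInto.of_inter_ground (h : ScalesInto P K A (S ∩ A.ground)) : ScalesInto P K A S := by
  obtain ⟨r, c, hr, hc, h⟩ := h
  refine ⟨r, c, hr, hc, fun x hx y hy => ?_⟩
  by_cases h0 : A.entry x y = 0
  · simp [h0]
  · exact h x ⟨hx, mem_ground.2 (Or.inl (mem_rows_of_entry h0))⟩ y
      ⟨hy, mem_ground.2 (Or.inr (mem_cols_of_entry h0))⟩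

/-- A scaling into `K` of a connected matrix over `G ∩ K` is unique up to `G ∩ K` and up to
multiplying the rows by some element of the group and dividing the columns by it. -/
theorem Conn.rigid (hA : A.IsMatrixOver P) (hK : P.InvClosed K) (hS : Conn A S)
    (hSK : EntriesIn K A S) {r c : α → Rˣ} (hr : ∀ x, r x ∈ P.units) (hc : ∀ y, c y ∈ P.units)
    (hrc : ∀ x ∈ S, ∀ y ∈ S, (r x : R) * A.entry x y * c y ∈ K) :
    ∃ g ∈ P.units, (∀ x ∈ A.rows, x ∈ S → ((r x * g : Rˣ) : R) ∈ K) ∧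
      ∀ y ∈ A.cols, y ∈ S → ((c y * g⁻¹ : Rˣ) : R) ∈ K := by
  by_cases hne : ∃ z ∈ A.ground, z ∈ S
  swap
  · push Not at hne
    exact ⟨1, P.units.one_mem, fun x hx hxS => absurd hxS (hne x (mem_ground.2 (Or.inl hx))),
      fun x hx hxS => absurd hxS (hne x (mem_ground.2 (Or.inr hx)))⟩
  obtain ⟨z, hz, hzS⟩ := hne
  classical
  -- normalise the scaling to have a factor in `G ∩ K` at the label `z`; the labels whose normalised
  -- factor is in `G ∩ K` form a union of components
  set g : Rˣ := if z ∈ A.rows then (r z)⁻¹ else c z with hg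
  have hgP : g ∈ P.units := by
    rw [hg]; split_ifs
    · exact P.units.inv_mem (hr z)
    · exact hc z
  let H := subgroupIn hK
  let W : Set α := {t | (t ∈ A.rows ∧ r t * g ∈ H) ∨ (t ∈ A.cols ∧ c t * g⁻¹ ∈ H)}
  have hzW : z ∈ W := by
    rcases mem_ground.1 hz with h | h
    · left
      refine ⟨h, ?_⟩
      rw [hg, if_pos h, mul_inv_cancel]
      exact H.one_mem
    · right
      refine ⟨h, ?_⟩
      rw [hg, if_neg (notMem_rows h), mul_inv_cancel]
      exact H.one_mem
  have hW := hS W (by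
    intro x hx y hy hxy
    have hxr := mem_rows_of_entry hxy
    have hyc := mem_cols_of_entry hxy
    obtain ⟨u, hu, hu'⟩ := exists_unit (entry_mem_elems hA x y) hxy
    have huH : u ∈ H := ⟨hu, by rw [hu']; exact hSK x hx y hy⟩
    have h1 : r x * u * c y ∈ H :=
      ⟨P.units.mul_mem (P.units.mul_mem (hr x) hu) (hc y), by
        simpa [hu'] using hrc x hx y hy⟩
    have h2 : r x * g * (c y * g⁻¹) ∈ H := by
      have : r x * g * (c y * g⁻¹) = r x * u * c y * u⁻¹ := by
        rw [mul_mul_mul_comm, mul_inv_cancel, mul_one, mul_right_comm (r x), mul_assoc _ u,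
          mul_inv_cancel, mul_one]
      rw [this]
      exact H.mul_mem h1 (H.inv_mem huH)
    have hxc := notMem_cols hxr
    have hyr := notMem_rows hyc
    simp only [W, Set.mem_ofPred_eq, hxr, hxc, hyr, hyc, true_and, false_and, or_false, false_or]
    constructor
    · intro h
      exact (H.mul_mem_cancel_left h).1 h2
    · intro h
      exact (H.mul_mem_cancel_right h).1 h2) ⟨z, hz, hzS, hzW⟩
  refine ⟨g, hgP, fun x hx hxS => ?_, fun y hy hyS => ?_⟩
  · rcases hW x (mem_ground.2 (Or.inl hx)) hxS with h | h
    · exact h.2.2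
    · exact absurd h.1 (notMem_cols hx)
  · rcases hW y (mem_ground.2 (Or.inr hy)) hyS with h | h
    · exact absurd h.1 (notMem_rows hy)
    · exact h.2.2

/-- If `A[S]` is over `K` and `A[S ∪ v]` can be scaled into `K`, then it suffices to scale `v`. -/
theorem exists_col_scale (hA : A.IsMatrixOver P) (hK : P.InvClosed K) (hS : Conn A S)
    (hSK : EntriesIn K A S) {v : α} (h : ScalesInto P K A (insert v S)) :
    ∃ g ∈ P.units, ∀ x ∈ S, A.entry x v * g ∈ K := by
  obtain ⟨r, c, hr, hc, hrc⟩ := h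
  obtain ⟨g, hg, h1, h2⟩ := hS.rigid hA hK hSK hr hc
    fun x hx y hy => hrc x (Or.inr hx) y (Or.inr hy)
  refine ⟨g⁻¹ * c v, P.units.mul_mem (P.units.inv_mem hg) (hc v), fun x hx => ?_⟩
  by_cases h0 : A.entry x v = 0
  · simp [h0]
  have h3 := h1 x (mem_rows_of_entry h0) hx
  have h4 := hK _ (P.units.mul_mem (hr x) hg) h3
  have h5 := K.mul_mem h4 (hrc x (Or.inr hx) v (Or.inl rfl))
  convert h5 using 1
  have : ((r x * g)⁻¹ : Rˣ) * (r x : R) = (g⁻¹ : Rˣ) := by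
    rw [← Units.val_mul]
    congr 1
    rw [mul_inv, mul_comm (r x)⁻¹, mul_assoc, inv_mul_cancel, mul_one]
  rw [mul_assoc, ← mul_assoc, this, Units.val_mul]
  ring

theorem exists_row_scale (hA : A.IsMatrixOver P) (hK : P.InvClosed K) (hS : Conn A S)
    (hSK : EntriesIn K A S) {v : α} (h : ScalesInto P K A (insert v S)) :
    ∃ g ∈ P.units, ∀ y ∈ S, A.entry v y * g ∈ K :=
  exists_col_scale (isMatrixOver_transpose hA) hK hS.transpose hSK.transpose h.transpose

open Classical in
/-- Multiply the row or column labelled `v` by `g`. -/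
noncomputable def scaleAt (A : LabelledMatrix α R) (v : α) (g : Rˣ) : LabelledMatrix α R :=
  A.scale (fun z => if z = v then g else 1) (fun z => if z = v then g else 1)

theorem pivotEquiv_scaleAt {v : α} {g : Rˣ} (hg : g ∈ P.units) :
    PivotEquiv P A (A.scaleAt v g) := by
  classical
  refine pivotEquiv_scale ?_ ?_ <;> intro z <;> split_ifs <;>
    first | exact hg | exact P.units.one_mem

theorem ScalesInto.of_scaleAt {v : α} {g : Rˣ} (hg : g ∈ P.units)
    (h : ScalesInto P K (A.scaleAt v g) S) : ScalesInto P K A S := by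
  classical
  refine ScalesInto.of_scale ?_ ?_ h <;> intro z <;> split_ifs <;>
    first | exact hg | exact P.units.one_mem

theorem scaleAt_entry {v : α} {g : Rˣ} {x y : α} (hx : x ≠ v) (hy : y ≠ v) :
    (A.scaleAt v g).entry x y = A.entry x y := by
  simp [scaleAt, scale, hx, hy]

theorem scaleAt_entry_left {v y : α} {g : Rˣ} (hy : y ≠ v) :
    (A.scaleAt v g).entry v y = g * A.entry v y := by
  simp [scaleAt, scale, hy]

theorem scaleAt_entry_right {v x : α} {g : Rˣ} (hx : x ≠ v) :
    (A.scaleAt v g).entry x v = A.entry x v * g := by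
  simp [scaleAt, scale, hx]

theorem agreeOn_scaleAt {v : α} {g : Rˣ} (hv : v ∉ S) : AgreeOn A (A.scaleAt v g) S :=
  ⟨fun _ _ => Iff.rfl, fun _ _ => Iff.rfl, fun _ hx _ hy =>
    scaleAt_entry (ne_of_mem_of_not_mem hx hv) (ne_of_mem_of_not_mem hy hv)⟩

theorem scaleAt_rows {v : α} {g : Rˣ} : (A.scaleAt v g).rows = A.rows := rfl

theorem scaleAt_cols {v : α} {g : Rˣ} : (A.scaleAt v g).cols = A.cols := rfl

/-! ### Growing a bad extension -/

/-- Some one-element extension of `A[S]` cannot be scaled into `K`. -/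
def BadOne (P : PartialField R) (K : Subring R) (A : LabelledMatrix α R) (S : Set α) : Prop :=
  ∃ v ∈ A.ground, v ∉ S ∧ ¬ ScalesInto P K A (insert v S)

/-- Adding a row `v` and a column `w` to `A[S]`, both with a nonzero entry in `A[S]`, keeps all
entries in `K` except for the entry `vw`. -/
def BadTwo (K : Subring R) (A : LabelledMatrix α R) (S : Set α) : Prop :=
  ∃ v ∈ A.rows, ∃ w ∈ A.cols, v ∉ S ∧ w ∉ S ∧ (∃ y ∈ S, A.entry v y ≠ 0) ∧
    (∃ x ∈ S, A.entry x w ≠ 0) ∧ EntriesIn K A (insert v S) ∧ EntriesIn K A (insert w S) ∧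
    A.entry v w ∉ K

/-- Two rows `f`, `g` with entries in `K`, nonzero on `S`, and a column `e` that is zero on `S`
and whose entries in the rows `f` and `g` have a ratio outside `K`. -/
def BadThree (K : Subring R) (A : LabelledMatrix α R) (S : Set α) : Prop :=
  ∃ f ∈ A.rows, ∃ g ∈ A.rows, ∃ e ∈ A.cols, f ≠ g ∧ f ∉ S ∧ g ∉ S ∧ e ∉ S ∧
    (∃ y ∈ S, A.entry f y ≠ 0) ∧ (∃ y ∈ S, A.entry g y ≠ 0) ∧
    EntriesIn K A (insert f S) ∧ EntriesIn K A (insert g S) ∧ (∀ x ∈ S, A.entry x e = 0) ∧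
    NotMultiple K (A.entry f e) (A.entry g e)

theorem BadOne.transpose (h : BadOne P K A S) : BadOne P K A.transpose S := by
  obtain ⟨v, hv, hvS, h⟩ := h
  exact ⟨v, by rwa [transpose_ground], hvS, fun h' => h h'.transpose⟩

theorem BadTwo.transpose (h : BadTwo K A S) : BadTwo K A.transpose S := by
  obtain ⟨v, hv, w, hw, hvS, hwS, h1, h2, h3, h4, h5⟩ := h
  exact ⟨w, hw, v, hv, hwS, hvS, h2, h1, h4.transpose, h3.transpose, h5⟩

/-- If `A[S ∪ u ∪ v]` cannot be scaled into `K` while `A[S ∪ u]` is over `K`, then `u` may be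
dropped unless `u` and `v` are a row and a column that interact in the entry `uv` only. -/
theorem badOne_or_badTwo_of_insert (hA : A.IsMatrixOver P) (hK : P.InvClosed K) (hS : Conn A S)
    {u v : α} (hu : u ∈ A.rows) (huS : u ∉ S) (hdom : ∃ y ∈ S, A.entry u y ≠ 0)
    (huK : EntriesIn K A (insert u S)) (hv : v ∈ A.ground) (hvu : v ≠ u) (hvS : v ∉ S)
    (hbad : ¬ ScalesInto P K A (insert v (insert u S))) :
    ∃ A', PivotEquiv P A A' ∧ AgreeOn A A' S ∧ (BadOne P K A' S ∨ BadTwo K A' S) := by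
  by_cases hvg : ScalesInto P K A (insert v S)
  swap
  · exact ⟨A, PivotEquiv.refl A, AgreeOn.refl A S, Or.inl ⟨v, hv, hvS, hvg⟩⟩
  have hSK : EntriesIn K A S := huK.mono (Set.subset_insert _ _)
  have hv0 : A.entry v v = 0 := by
    by_cases h : v ∈ A.rows
    · exact entry_eq_zero_of_col (notMem_cols h)
    · exact entry_eq_zero_of_row h
  rcases mem_ground.1 hv with hvr | hvc
  -- two rows do not interact: scaling the row `v` alone would be enough
  · exfalso
    obtain ⟨g, hg, hgK⟩ := exists_row_scale hA hK hS hSK hvg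
    apply hbad
    apply ScalesInto.of_scaleAt (v := v) hg
    apply EntriesIn.scalesInto
    intro x hx y hy
    by_cases hyv : y = v
    · subst hyv
      rw [entry_eq_zero_of_col]
      · exact K.zero_mem
      · exact notMem_cols hvr
    have hy' := Set.mem_of_mem_insert_of_ne hy hyv
    by_cases hxv : x = v
    · subst hxv
      rw [scaleAt_entry_left hyv]
      rcases hy' with rfl | hy'
      · rw [entry_eq_zero_of_col (notMem_cols hu), mul_zero]; exact K.zero_mem
      · rw [mul_comm]; exact hgK y hy'
    · rw [scaleAt_entry hxv hyv]
      exact huK x (Set.mem_of_mem_insert_of_ne hx hxv) y hy'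
  -- a scaling of the column `v` that works on `S` fails in the row `u`
  · obtain ⟨g, hg, hgK⟩ := exists_col_scale hA hK hS hSK hvg
    have key : ∀ g : Rˣ, g ∈ P.units → (∀ x ∈ S, A.entry x v * g ∈ K) → A.entry u v * g ∉ K := by
      intro g hg hgK hugK
      apply hbad
      apply ScalesInto.of_scaleAt (v := v) hg
      apply EntriesIn.scalesInto
      intro x hx y hy
      by_cases hxv : x = v
      · subst hxv
        rw [entry_eq_zero_of_row]
        · exact K.zero_mem
        · exact notMem_rows hvc
      have hx' := Set.mem_of_mem_insert_of_ne hx hxv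
      by_cases hyv : y = v
      · subst hyv
        rw [scaleAt_entry_right hxv]
        rcases hx' with rfl | hx'
        · exact hugK
        · exact hgK x hx'
      · rw [scaleAt_entry hxv hyv]
        exact huK x hx' y (Set.mem_of_mem_insert_of_ne hy hyv)
    -- a column `v` that is zero on `S` could be scaled by the inverse of its entry in the row `u`
    have hdomv : ∃ x ∈ S, A.entry x v ≠ 0 := by
      by_contra hcon
      push Not at hcon
      by_cases h0 : A.entry u v = 0
      · exact key 1 P.units.one_mem (fun x hx => by rw [hcon x hx]; simp) (by rw [h0]; simp)
      · obtain ⟨w, hw, hw'⟩ := exists_unit (entry_mem_elems hA u v) h0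
        refine key w⁻¹ (P.units.inv_mem hw) (fun x hx => by rw [hcon x hx]; simp) ?_
        rw [← hw']; simp
    refine ⟨A.scaleAt v g, pivotEquiv_scaleAt hg, agreeOn_scaleAt hvS, Or.inr
      ⟨u, hu, v, hvc, huS, hvS, ?_, ?_, ?_, ?_, ?_⟩⟩
    · obtain ⟨y, hy, h⟩ := hdom
      refine ⟨y, hy, ?_⟩
      rwa [scaleAt_entry hvu.symm (ne_of_mem_of_not_mem hy hvS)]
    · obtain ⟨x, hx, h⟩ := hdomv
      refine ⟨x, hx, ?_⟩
      rw [scaleAt_entry_right (ne_of_mem_of_not_mem hx hvS)]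
      intro h'
      exact h (by simpa using h')
    · exact (agreeOn_scaleAt (by simp [hvu, hvS])).entriesIn huK
    · intro x hx y hy
      by_cases hxv : x = v
      · subst hxv
        rw [entry_eq_zero_of_row]
        · exact K.zero_mem
        · exact notMem_rows hvc
      have hx' := Set.mem_of_mem_insert_of_ne hx hxv
      by_cases hyv : y = v
      · subst hyv
        rw [scaleAt_entry_right hxv]
        exact hgK x hx'
      · rw [scaleAt_entry hxv hyv]
        exact hSK x hx' y (Set.mem_of_mem_insert_of_ne hy hyv)
    · rw [scaleAt_entry_right hvu.symm]
      exact key g hg hgK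

end LabelledMatrix

namespace LabelledMatrix

variable {α R : Type*} [CommRing R] {P : PartialField R} {K : Subring R}
variable {A A' : LabelledMatrix α R} {S T : Set α}

theorem agreeOn_pivot {x y : α} {hx : x ∈ A.rows} {hy : y ∈ A.cols} (hxS : x ∉ S) (hyS : y ∉ S)
    (h : (∀ u ∈ S, A.entry u y = 0) ∨ ∀ v ∈ S, A.entry x v = 0) :
    AgreeOn A (A.pivot x y hx hy) S := by
  refine ⟨fun z hz => ?_, fun z hz => ?_, fun u hu v hv => ?_⟩
  · rw [mem_pivot_rows]
    simp [ne_of_mem_of_not_mem hz hxS, ne_of_mem_of_not_mem hz hyS]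
  · rw [mem_pivot_cols]
    simp [ne_of_mem_of_not_mem hz hxS, ne_of_mem_of_not_mem hz hyS]
  · rw [pivot_entry (ne_of_mem_of_not_mem hu hxS) (ne_of_mem_of_not_mem hu hyS)
      (ne_of_mem_of_not_mem hv hxS) (ne_of_mem_of_not_mem hv hyS)]
    rcases h with h | h
    · rw [h u hu]; ring
    · rw [h v hv]; ring

theorem EntriesIn.insert_row {v : α} (hv : v ∈ A.rows) (h : EntriesIn K A S)
    (h' : ∀ y ∈ S, A.entry v y ∈ K) : EntriesIn K A (insert v S) := by
  intro x hx y hy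
  rcases hy with rfl | hy
  · rw [entry_eq_zero_of_col (notMem_cols hv)]; exact K.zero_mem
  · rcases hx with rfl | hx
    · exact h' y hy
    · exact h x hx y hy

theorem EntriesIn.insert_col {v : α} (hv : v ∈ A.cols) (h : EntriesIn K A S)
    (h' : ∀ x ∈ S, A.entry x v ∈ K) : EntriesIn K A (insert v S) :=
  (EntriesIn.insert_row (A := A.transpose) hv h.transpose h').transpose

/-- One of the configurations that a minimal bad extension of `A[S]` takes. -/
def BadExt (P : PartialField R) (K : Subring R) (A : LabelledMatrix α R) (S : Set α) : Prop :=
  BadOne P K A S ∨ BadTwo K A S ∨ BadThree K A S ∨ BadThree K A.transpose S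

theorem BadExt.transpose (h : BadExt P K A S) : BadExt P K A.transpose S := by
  rcases h with h | h | h | h
  · exact Or.inl h.transpose
  · exact Or.inr (Or.inl h.transpose)
  · exact Or.inr (Or.inr (Or.inr h))
  · exact Or.inr (Or.inr (Or.inl h))

/-- The case of `badExt_of_insert_row` where the configuration over `S ∪ u` consists of columns
`f`, `g` and a row `e`, and `f` is zero on `S`. After scaling the row `e`, pivoting over `uf`
makes the row `e` nonzero on `S`. -/
theorem badExt_of_col_eq_zero (hA : A.IsMatrixOver P) (hK : P.InvClosed K)
    {u f g e : α} (hu : u ∈ A.rows) (huS : u ∉ S) (hdom : ∃ y ∈ S, A.entry u y ≠ 0)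
    (huK : EntriesIn K A (insert u S)) (hf : f ∈ A.cols) (hg : g ∈ A.cols) (he : e ∈ A.rows)
    (hfg : f ≠ g) (hfS : f ∉ S) (hgS : g ∉ S) (heS : e ∉ S) (heu : e ≠ u)
    (hfu : A.entry u f ≠ 0) (hf0 : ∀ x ∈ S, A.entry x f = 0)
    (hfK : EntriesIn K A (insert f (insert u S))) (hgK : EntriesIn K A (insert g (insert u S)))
    (hgdom : ∃ x ∈ insert u S, A.entry x g ≠ 0) (he0 : ∀ y ∈ S, A.entry e y = 0)
    (hnm : NotMultiple K (A.entry e f) (A.entry e g)) :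
    ∃ A', PivotEquiv P A A' ∧ AgreeOn A A' S ∧ BadExt P K A' S := by
  obtain ⟨a, ha, ha'⟩ := exists_unit (entry_mem_elems hA e f) hnm.1
  have hfe : f ≠ e := (row_ne_col he hf).symm
  have hge : g ≠ e := (row_ne_col he hg).symm
  have huf : u ≠ f := row_ne_col hu hf
  have hug : u ≠ g := row_ne_col hu hg
  -- scale the row `e` to have the entry `1` in the column `f`, and a bad entry in the column `g`
  set B := A.scaleAt e a⁻¹ with hB
  have hAB : PivotEquiv P A B := pivotEquiv_scaleAt (P.units.inv_mem ha)
  have hBP := hAB.isMatrixOver hA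
  have hent : ∀ x y, x ≠ e → y ≠ e → B.entry x y = A.entry x y := fun x y => scaleAt_entry
  have hef : B.entry e f = 1 := by
    rw [hB, scaleAt_entry_left hfe, ← ha']; simp
  have heg : B.entry e g ∉ K := by
    rw [hB, scaleAt_entry_left hge]
    intro h
    apply hnm.2 _ h
    rw [← ha', mul_assoc, mul_comm (A.entry e g), ← mul_assoc]
    simp
  have heS' : ∀ y ∈ S, B.entry e y = 0 := by
    intro y hy
    rw [hB, scaleAt_entry_left (ne_of_mem_of_not_mem hy heS), he0 y hy, mul_zero]
  have huf0 : B.entry u f ≠ 0 := by rwa [hent u f heu.symm hfe]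
  set i := Ring.inverse (B.entry u f) with hi
  have hi0 : i ≠ 0 := inverse_ne_zero (entry_mem_elems hBP u f) huf0
  have hiP : i ∈ P.elems := inverse_mem_elems (entry_mem_elems hBP u f)
  have hiK : i ∈ K := by
    apply inverse_mem hK (entry_mem_elems hBP u f)
    rw [hent u f heu.symm hfe]
    exact hfK u (by simp) f (by simp)
  have hyu : ∀ {y}, y ∈ S → y ≠ u := fun hy => ne_of_mem_of_not_mem hy huS
  have hyf : ∀ {y}, y ∈ S → y ≠ f := fun hy => ne_of_mem_of_not_mem hy hfS
  have hye : ∀ {y}, y ∈ S → y ≠ e := fun hy => ne_of_mem_of_not_mem hy heS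
  have huB : u ∈ B.rows := hu
  have hfB : f ∈ B.cols := hf
  -- the pivot subtracts a multiple over `K` of the row `u` from the row `e`; the entry `eg` remains
  -- bad
  set C := B.pivot u f huB hfB with hC
  have hAC : PivotEquiv P A C := hAB.trans (pivotEquiv_pivot huf0)
  have hagr : AgreeOn A C S := by
    refine (agreeOn_scaleAt heS).trans (agreeOn_pivot huS hfS (Or.inl fun x hx => ?_))
    rw [← hB, hent x f (hye hx) hfe, hf0 x hx]
  have hCS : EntriesIn K C S := hagr.entriesIn (huK.mono (Set.subset_insert _ _))
  have hey : ∀ y ∈ S, C.entry e y = -(i * A.entry u y) := by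
    intro y hy
    rw [hC, pivot_entry heu hfe.symm (hyu hy) (hyf hy), heS' y hy, hef,
      hent u y heu.symm (hye hy)]
    ring
  have hegC : C.entry e g = B.entry e g - i * A.entry u g := by
    rw [hC, pivot_entry heu hfe.symm hug.symm hfg.symm, hef, hent u g heu.symm hge]
    ring
  have hxg : ∀ x ∈ S, C.entry x g = A.entry x g := by
    intro x hx
    rw [hC, pivot_entry (hyu hx) (hyf hx) hug.symm hfg.symm, hent x f (hye hx) hfe, hf0 x hx,
      hent x g (hye hx) hge]
    ring
  have heC : e ∈ C.rows := mem_pivot_rows.2 (Or.inr ⟨he, heu⟩)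
  have hgC : g ∈ C.cols := mem_pivot_cols.2 (Or.inr ⟨hg, hfg.symm⟩)
  have huyK : ∀ y ∈ S, A.entry u y ∈ K := fun y hy => huK u (by simp) y (by simp [hy])
  have hugK : A.entry u g ∈ K := hgK u (by simp) g (by simp)
  have heC' : EntriesIn K C (insert e S) := by
    refine hCS.insert_row heC fun y hy => ?_
    rw [hey y hy]
    exact K.neg_mem (K.mul_mem hiK (huyK y hy))
  obtain ⟨y0, hy0, hy0'⟩ := hdom
  have heCdom : C.entry e y0 ≠ 0 := by
    rw [hey y0 hy0, neg_ne_zero]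
    exact PartialField.mul_ne_zero hiP hi0 hy0'
  by_cases hgd : ∃ x ∈ S, A.entry x g ≠ 0
  -- the row `e` and the column `g` form a `BadTwo`
  · obtain ⟨x0, hx0, hx0'⟩ := hgd
    refine ⟨C, hAC, hagr, Or.inr (Or.inl ⟨e, heC, g, hgC, heS, hgS, ⟨y0, hy0, heCdom⟩,
      ⟨x0, hx0, ?_⟩, heC', ?_, ?_⟩)⟩
    · rwa [hxg x0 hx0]
    · refine hCS.insert_col hgC fun x hx => ?_
      rw [hxg x hx]
      exact hgK x (by simp [hx]) g (by simp)
    · rw [hegC]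
      intro h
      exact heg (by simpa using K.add_mem h (K.mul_mem hiK hugK))
  -- the column `g` is zero on `S`: the rows `f` and `e` and the column `g` form a `BadThree`
  · push Not at hgd
    have hug0 : A.entry u g ≠ 0 := by
      obtain ⟨x, hx, hx'⟩ := hgdom
      rcases hx with rfl | hx
      · exact hx'
      · exact absurd (hgd x hx) hx'
    have hfy : ∀ y ∈ S, C.entry f y = i * A.entry u y := by
      intro y hy
      rw [hC, pivot_entry_row (hyu hy) (hyf hy), hent u y heu.symm (hye hy)]
    have hfC : f ∈ C.rows := mem_pivot_rows.2 (Or.inl rfl)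
    have hfgC : C.entry f g = i * A.entry u g := by
      rw [hC, pivot_entry_row hug.symm hfg.symm, hent u g heu.symm hge]
    refine ⟨C, hAC, hagr, Or.inr (Or.inr (Or.inl ⟨f, hfC, e, heC, g, hgC, hfe, hfS, heS, hgS,
      ⟨y0, hy0, ?_⟩, ⟨y0, hy0, heCdom⟩, ?_, heC', ?_, ?_, ?_⟩))⟩
    · rw [hfy y0 hy0]
      exact PartialField.mul_ne_zero hiP hi0 hy0'
    · refine hCS.insert_row hfC fun y hy => ?_
      rw [hfy y hy]
      exact K.mul_mem hiK (huyK y hy)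
    · intro x hx
      rw [hxg x hx, hgd x hx]
    · rw [hfgC]
      exact PartialField.mul_ne_zero hiP hi0 hug0
    · intro k hk h
      rw [hfgC, hegC] at h
      apply heg
      have : B.entry e g = k * (i * A.entry u g) + i * A.entry u g := by rw [← h]; ring
      rw [this]
      exact K.add_mem (K.mul_mem hk (K.mul_mem hiK hugK)) (K.mul_mem hiK hugK)

/-- A minimal bad extension of `A[S ∪ u]` yields one of `A[S]`. -/
theorem badExt_of_insert_row (hA : A.IsMatrixOver P) (hK : P.InvClosed K) (hS : Conn A S)
    {u : α} (hu : u ∈ A.rows) (huS : u ∉ S) (hdom : ∃ y ∈ S, A.entry u y ≠ 0)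
    (huK : EntriesIn K A (insert u S)) (hbad : BadExt P K A (insert u S)) :
    ∃ A', PivotEquiv P A A' ∧ AgreeOn A A' S ∧ BadExt P K A' S := by
  have hSK : EntriesIn K A S := huK.mono (Set.subset_insert _ _)
  rcases hbad with ⟨v, hv, hvS, hbad⟩ | ⟨v, hv, w, hw, hvS, hwS, hvd, hwd, hvK, hwK, hvw⟩ |
      ⟨f, hf, g, hg, e, he, hfg, hfS, hgS, heS, hfd, hgd, hfK, hgK, he0, hnm⟩ |
      ⟨f, hf, g, hg, e, he, hfg, hfS, hgS, heS, hfd, hgd, hfK, hgK, he0, hnm⟩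
  -- one bad label
  · simp only [Set.mem_insert_iff, not_or] at hvS
    obtain ⟨A', h1, h2, h3⟩ :=
      badOne_or_badTwo_of_insert hA hK hS hu huS hdom huK hv hvS.1 hvS.2 hbad
    exact ⟨A', h1, h2, h3.imp id Or.inl⟩
  -- a row `v` and a column `w`: if `w` is nonzero only in the row `u` then `u`, `v`, `w` are a
  -- `BadThree`
  · simp only [Set.mem_insert_iff, not_or] at hvS hwS
    refine ⟨A, PivotEquiv.refl A, AgreeOn.refl A S, ?_⟩
    have hvd' : ∃ y ∈ S, A.entry v y ≠ 0 := by
      obtain ⟨y, hy, hvy⟩ := hvd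
      refine ⟨y, Set.mem_of_mem_insert_of_ne hy ?_, hvy⟩
      rintro rfl
      exact hvy (entry_eq_zero_of_col (notMem_cols hu))
    by_cases hwd' : ∃ x ∈ S, A.entry x w ≠ 0
    · exact Or.inr (Or.inl ⟨v, hv, w, hw, hvS.2, hwS.2, hvd', hwd',
        hvK.mono (Set.insert_subset_insert (Set.subset_insert _ _)),
        hwK.mono (Set.insert_subset_insert (Set.subset_insert _ _)), hvw⟩)
    · push Not at hwd'
      have huw : A.entry u w ≠ 0 := by
        obtain ⟨x, hx, hxw⟩ := hwd
        rcases hx with rfl | hx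
        · exact hxw
        · exact absurd (hwd' x hx) hxw
      refine Or.inr (Or.inr (Or.inl ⟨u, hu, v, hv, w, hw, fun h => hvS.1 h.symm, huS, hvS.2, hwS.2,
        hdom, hvd', huK, hvK.mono (Set.insert_subset_insert (Set.subset_insert _ _)), hwd',
        huw, ?_⟩))
      intro k hk h
      exact hvw (by rw [h]; exact K.mul_mem hk (hwK u (by simp) w (by simp)))
  -- two rows and a column: the row `u` may simply be dropped
  · simp only [Set.mem_insert_iff, not_or] at hfS hgS heS
    refine ⟨A, PivotEquiv.refl A, AgreeOn.refl A S, Or.inr (Or.inr (Or.inl ⟨f, hf, g, hg, e, he,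
      hfg, hfS.2, hgS.2, heS.2, ?_, ?_,
      hfK.mono (Set.insert_subset_insert (Set.subset_insert _ _)),
      hgK.mono (Set.insert_subset_insert (Set.subset_insert _ _)),
      fun x hx => he0 x (Or.inr hx), hnm⟩))⟩
    · obtain ⟨y, hy, h⟩ := hfd
      refine ⟨y, Set.mem_of_mem_insert_of_ne hy ?_, h⟩
      rintro rfl
      exact h (entry_eq_zero_of_col (notMem_cols hu))
    · obtain ⟨y, hy, h⟩ := hgd
      refine ⟨y, Set.mem_of_mem_insert_of_ne hy ?_, h⟩
      rintro rfl
      exact h (entry_eq_zero_of_col (notMem_cols hu))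
  -- two columns and a row: the columns may be nonzero only in the row `u`
  · simp only [Set.mem_insert_iff, not_or] at hfS hgS heS
    have hfK' : EntriesIn K A (insert f (insert u S)) := hfK.transpose
    have hgK' : EntriesIn K A (insert g (insert u S)) := hgK.transpose
    have hcase : ∀ h, (∃ x ∈ insert u S, A.entry x h ≠ 0) → (∀ x ∈ S, A.entry x h = 0) →
        A.entry u h ≠ 0 := by
      rintro h ⟨x, hx, hx'⟩ h0
      rcases hx with rfl | hx
      · exact hx'
      · exact absurd (h0 x hx) hx'
    by_cases hfd' : ∃ x ∈ S, A.entry x f ≠ 0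
    · by_cases hgd' : ∃ x ∈ S, A.entry x g ≠ 0
      · exact ⟨A, PivotEquiv.refl A, AgreeOn.refl A S, Or.inr (Or.inr (Or.inr ⟨f, hf, g, hg, e, he,
          hfg, hfS.2, hgS.2, heS.2, hfd', hgd',
          hfK.mono (Set.insert_subset_insert (Set.subset_insert _ _)),
          hgK.mono (Set.insert_subset_insert (Set.subset_insert _ _)),
          fun x hx => he0 x (Or.inr hx), hnm⟩))⟩
      · push Not at hgd'
        exact badExt_of_col_eq_zero hA hK hu huS hdom huK hg hf he hfg.symm hgS.2 hfS.2 heS.2 heS.1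
          (hcase g hgd hgd') hgd' hgK' hfK' hfd (fun x hx => he0 x (Or.inr hx))
          (hnm.symm hK (entry_mem_elems hA e f) (entry_mem_elems hA e g))
    · push Not at hfd'
      exact badExt_of_col_eq_zero hA hK hu huS hdom huK hf hg he hfg hfS.2 hgS.2 heS.2 heS.1
        (hcase f hfd hfd') hfd' hfK' hgK' hgd (fun x hx => he0 x (Or.inr hx)) hnm

theorem scaleAt_conn {v : α} {g : Rˣ} (h : Conn A S) : Conn (A.scaleAt v g) S := by
  intro W hW
  apply h W
  intro x hx y hy hxy
  apply hW x hx y hy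
  simp only [scaleAt, scale]
  rwa [ne_eq, Units.mul_left_eq_zero, Units.mul_right_eq_zero]

theorem conn_insert_row (hS : Conn A S) {u : α} (hu : u ∈ A.rows)
    (hdom : ∃ y ∈ S, A.entry u y ≠ 0) : Conn A (insert u S) := by
  obtain ⟨y, hy, huy⟩ := hdom
  rintro W hW ⟨z, hz, hzS, hzW⟩
  have huW := hW u (by simp) y (by simp [hy]) huy
  have hyg : y ∈ A.ground := mem_ground.2 (Or.inr (mem_cols_of_entry huy))
  have h1 := hS W fun x hx y hy => hW x (Or.inr hx) y (Or.inr hy)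
  have hyW : y ∈ W := by
    rcases hzS with rfl | hzS
    · exact huW.1 hzW
    · exact h1 ⟨z, hz, hzS, hzW⟩ y hyg hy
  rintro t ht (rfl | htS)
  · exact huW.2 hyW
  · exact h1 ⟨y, hyg, hy, hyW⟩ t ht htS

/-- A connected matrix that cannot be scaled into `K` but has a connected submatrix over `K`
contains, up to pivots that fix this submatrix, one of the four minimal bad extensions of it. -/
theorem exists_badExt (hK : P.InvClosed K) (n : ℕ) :
    ∀ (A : LabelledMatrix α R) (S : Set α), (A.ground \ S).ncard = n → A.IsMatrixOver P →
      Conn A Set.univ → ¬ ScalesInto P K A Set.univ → (∃ z ∈ A.ground, z ∈ S) → Conn A S →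
      EntriesIn K A S → ∃ A', PivotEquiv P A A' ∧ AgreeOn A A' S ∧ BadExt P K A' S := by
  induction n with
  | zero =>
    intro A S hn _ _ hbad _ _ hSK
    -- all labels are in `S`
    exfalso
    rw [Set.ncard_eq_zero (A.ground_finite.subset Set.sdiff_subset)] at hn
    apply hbad
    apply ScalesInto.of_inter_ground
    rw [Set.univ_inter]
    exact (hSK.mono (Set.sdiff_eq_empty.1 hn)).scalesInto
  | succ n ih =>
    -- it suffices to treat the case that a row outside `S` is nonzero on `S`
    have row : ∀ (A : LabelledMatrix α R) (S : Set α), (A.ground \ S).ncard = n + 1 →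
        A.IsMatrixOver P → Conn A Set.univ → ¬ ScalesInto P K A Set.univ →
        (∃ z ∈ A.ground, z ∈ S) → Conn A S → EntriesIn K A S →
        (∃ u ∈ A.rows, u ∉ S ∧ ∃ y ∈ S, A.entry u y ≠ 0) →
        ∃ A', PivotEquiv P A A' ∧ AgreeOn A A' S ∧ BadExt P K A' S := by
      rintro A S hn hA hconn hbad ⟨z, hz, hzS⟩ hS hSK ⟨u, hu, huS, hdom⟩
      by_cases hug : ScalesInto P K A (insert u S)
      swap
      · exact ⟨A, PivotEquiv.refl A, AgreeOn.refl A S,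
          Or.inl ⟨u, mem_ground.2 (Or.inl hu), huS, hug⟩⟩
      obtain ⟨g, hg, hgK⟩ := exists_row_scale hA hK hS hSK hug
      have hAB : PivotEquiv P A (A.scaleAt u g) := pivotEquiv_scaleAt hg
      have hagr : AgreeOn A (A.scaleAt u g) S := agreeOn_scaleAt huS
      have hBK : EntriesIn K (A.scaleAt u g) (insert u S) := by
        refine EntriesIn.insert_row hu (hagr.entriesIn hSK) fun y hy => ?_
        rw [scaleAt_entry_left (ne_of_mem_of_not_mem hy huS), mul_comm]
        exact hgK y hy
      have hBdom : ∃ y ∈ S, (A.scaleAt u g).entry u y ≠ 0 := by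
        obtain ⟨y, hy, huy⟩ := hdom
        refine ⟨y, hy, ?_⟩
        rw [scaleAt_entry_left (ne_of_mem_of_not_mem hy huS)]
        rwa [ne_eq, Units.mul_right_eq_zero]
      have hBu : Conn (A.scaleAt u g) (insert u S) := conn_insert_row (hagr.conn hS) hu hBdom
      obtain ⟨C, hBC, hagr', hC⟩ := ih (A.scaleAt u g) (insert u S) (by
          have h1 : A.ground \ S = insert u ((A.scaleAt u g).ground \ insert u S) := by
            ext t
            have : (A.scaleAt u g).ground = A.ground := rfl
            simp only [Set.mem_sdiff, Set.mem_insert_iff, this]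
            by_cases h : t = u
            · subst h; simp [huS, mem_ground, hu]
            · simp [h]
          rw [h1, Set.ncard_insert_of_notMem (by simp)
            ((A.scaleAt u g).ground_finite.subset Set.sdiff_subset)] at hn
          omega)
        (hAB.isMatrixOver hA) (scaleAt_conn hconn) (fun h => hbad (h.of_scaleAt hg))
        ⟨z, hz, Or.inr hzS⟩ hBu hBK
      have huC : u ∈ C.rows := (hagr'.rows u (by simp)).2 hu
      have hagr'' := hagr'.mono (Set.subset_insert u S)
      obtain ⟨D, hCD, hD, hbadD⟩ := badExt_of_insert_row
        (hBC.isMatrixOver (hAB.isMatrixOver hA)) hK (hagr''.conn (hagr.conn hS)) huC huS (by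
          obtain ⟨y, hy, huy⟩ := hBdom
          exact ⟨y, hy, by rwa [hagr'.entry u (by simp) y (by simp [hy])]⟩)
        (hagr'.entriesIn hBK) hC
      exact ⟨D, hAB.trans (hBC.trans hCD), hagr.trans (hagr''.trans hD), hbadD⟩
    intro A S hn hA hconn hbad hne hS hSK
    by_cases hr : ∃ u ∈ A.rows, u ∉ S ∧ ∃ y ∈ S, A.entry u y ≠ 0
    · exact row A S hn hA hconn hbad hne hS hSK hr
    -- the case of a column is the case of a row in the transposed matrix
    by_cases hc : ∃ u ∈ A.cols, u ∉ S ∧ ∃ x ∈ S, A.entry x u ≠ 0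
    · obtain ⟨B, hB1, hB2, hB3⟩ := row A.transpose S (by rwa [transpose_ground])
        (isMatrixOver_transpose hA) hconn.transpose (fun h => hbad h.transpose)
        (by rwa [transpose_ground]) hS.transpose hSK.transpose hc
      exact ⟨B.transpose, hB1.transpose, hB2.transpose, hB3.transpose⟩
    -- no entry joins `S` to its complement, so that all labels are in `S`
    · exfalso
      push Not at hr hc
      obtain ⟨z, hz, hzS⟩ := hne
      have hall := hconn S (by
        intro x _ y _ hxy
        constructor
        · intro hx
          by_contra hy
          exact hxy (hc y (mem_cols_of_entry hxy) hy x hx)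
        · intro hy
          by_contra hx
          exact hxy (hr x (mem_rows_of_entry hxy) hx y hy)) ⟨z, hz, Set.mem_univ _, hzS⟩
      apply hbad
      apply ScalesInto.of_inter_ground
      rw [Set.univ_inter]
      exact (hSK.mono fun t ht => hall t ht (Set.mem_univ _)).scalesInto

end LabelledMatrix

/-! ### A line attached by a 2-sum -/

namespace PartialField

variable {R : Type*} [CommRing R] {P : PartialField R} {K : Subring R}

theorem mem_elems_of_mul {a b : R} (ha : a ∈ P.elems) (ha0 : a ≠ 0) (hab : a * b ∈ P.elems) :
    b ∈ P.elems := by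
  obtain ⟨u, hu, rfl⟩ := exists_unit ha ha0
  have := mul_mem_elems (coe_mem_elems (P.units.inv_mem hu)) hab
  simpa using this

theorem mul_left_cancel' {a b c : R} (ha : a ∈ P.elems) (ha0 : a ≠ 0) (h : a * b = a * c) :
    b = c := by
  obtain ⟨u, hu, rfl⟩ := exists_unit ha ha0
  simpa using h

theorem units_ne_zero {a : R} (ha : a ≠ 0) (u : Rˣ) : (u : R) ≠ 0 :=
  haveI : Nontrivial R := ⟨a, 0, ha⟩
  u.ne_zero

theorem mem_of_mul_mem (hK : P.InvClosed K) {a b : R} (ha : a ∈ P.elems) (ha0 : a ≠ 0)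
    (haK : a ∈ K) (hab : a * b ∈ K) : b ∈ K := by
  obtain ⟨u, hu, rfl⟩ := exists_unit ha ha0
  have := K.mul_mem (hK u hu haK) hab
  simpa using this

theorem NotMultiple.false_of_mul_eq (hK : P.InvClosed K) {a b p q : R} (h : NotMultiple K a b)
    (hp : p ∈ K) (hq : q ∈ K) (hpP : p ∈ P.elems) (hp0 : p ≠ 0) (hpq : b * p = a * q) : False := by
  obtain ⟨u, hu, rfl⟩ := exists_unit hpP hp0
  apply h.2 _ (K.mul_mem hq (hK u hu hp))
  have : b = b * u * (u⁻¹ : Rˣ) := by simp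
  rw [this, hpq]
  ring

/-- If the vectors `ρ` and `η` over `K` are linearly independent, as two of their coordinates show,
then `η - τ ρ` cannot be scaled into `K` unless `τ` lies in `K`. -/
theorem mem_of_sub_mul_mem (hK : P.InvClosed K) {ρ ρ' η η' τ g : R} (hρ : ρ ∈ K) (hρ' : ρ' ∈ K)
    (hη : η ∈ K) (hη' : η' ∈ K) (hΔ : ρ * η' - ρ' * η ∈ P.elems) (hΔ0 : ρ * η' - ρ' * η ≠ 0)
    (hg : g ∈ P.elems) (hg0 : g ≠ 0) (h : g * (η - τ * ρ) ∈ K) (h' : g * (η' - τ * ρ') ∈ K) :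
    τ ∈ K := by
  set Δ := ρ * η' - ρ' * η with hd
  have hΔK : Δ ∈ K := K.sub_mem (K.mul_mem hρ hη') (K.mul_mem hρ' hη)
  have h1 : Δ * g ∈ K := by
    have : Δ * g = g * (η' - τ * ρ') * ρ - g * (η - τ * ρ) * ρ' := by rw [hd]; ring
    rw [this]
    exact K.sub_mem (K.mul_mem h' hρ) (K.mul_mem h hρ')
  have hgK : g ∈ K := mem_of_mul_mem hK hΔ hΔ0 hΔK h1
  have h2 : Δ * (g * τ) ∈ K := by
    have : Δ * (g * τ) = g * (η' - τ * ρ') * η - g * (η - τ * ρ) * η' := by rw [hd]; ring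
    rw [this]
    exact K.sub_mem (K.mul_mem h' hη) (K.mul_mem h hη')
  exact mem_of_mul_mem hK hg hg0 hgK (mem_of_mul_mem hK hΔ hΔ0 hΔK h2)

end PartialField

namespace LabelledMatrix

variable {α R : Type*} [CommRing R] {P : PartialField R} {K : Subring R}
variable {A₀ A A' : LabelledMatrix α R} {S T : Set α} {f₀ f g e z : α}

theorem conn_relabel_row (h : AgreeOn A₀ A S) (hf₀ : f₀ ∈ A₀.rows) (hf₀S : f₀ ∉ S)
    (hf : f ∈ A.rows) (hfS : f ∉ S) (hrow : ∀ y ∈ S, A.entry f y = A₀.entry f₀ y)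
    (hS : Conn A₀ (insert f₀ S)) : Conn A (insert f S) := by
  rintro W hW ⟨z, hz, hzS, hzW⟩ t ht htS
  have key := hS {t | (t ∈ S ∧ t ∈ W) ∨ (t = f₀ ∧ f ∈ W)} (by
    rintro x hx y hy hxy
    simp only [Set.mem_ofPred_eq]
    have hyc := mem_cols_of_entry hxy
    have hyf : y ≠ f₀ := (row_ne_col hf₀ hyc).symm
    have hyS : y ∈ S := Set.mem_of_mem_insert_of_ne hy hyf
    rcases hx with rfl | hxS
    · have := hW f (by simp) y (by simp [hyS]) (by rwa [hrow y hyS])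
      simp [hf₀S, hyS, hyf, this]
    · have hxf : x ≠ f₀ := ne_of_mem_of_not_mem hxS hf₀S
      have := hW x (by simp [hxS]) y (by simp [hyS]) (by rwa [h.entry x hxS y hyS])
      simp [hxS, hyS, hxf, hyf, this])
  have key2 := key (by
    rcases hzS with rfl | hzS
    · exact ⟨f₀, mem_ground.2 (Or.inl hf₀), by simp, Or.inr ⟨rfl, hzW⟩⟩
    · exact ⟨z, (h.mem_ground hzS).1 hz, by simp [hzS], Or.inl ⟨hzS, hzW⟩⟩)
  rcases htS with rfl | htS
  · rcases key2 f₀ (mem_ground.2 (Or.inl hf₀)) (by simp) with h | h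
    · exact absurd h.1 hf₀S
    · exact h.2
  · rcases key2 t ((h.mem_ground htS).1 ht) (by simp [htS]) with h | h
    · exact h.2
    · exact absurd h.1 (ne_of_mem_of_not_mem htS hf₀S)

/-- `A` contains a copy of `A₀[S ∪ f₀]` with the row `f₀` doubled into two rows `f` and `g`, and a
column `e` that is zero on `S` and whose ratio of the entries in the rows `f`, `g` is outside `K`.
The matroid of this submatrix is the 2-sum of that of `A₀[S ∪ f₀]` and a four-point line, with
basepoint `f₀`. -/
structure LineConfig (K : Subring R) (A₀ : LabelledMatrix α R) (f₀ : α) (S : Set α)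
    (A : LabelledMatrix α R) (f g e : α) : Prop where
  agree : AgreeOn A₀ A S
  f_mem : f ∈ A.rows
  g_mem : g ∈ A.rows
  e_mem : e ∈ A.cols
  f_ne_g : f ≠ g
  f_notMem : f ∉ S
  g_notMem : g ∉ S
  e_notMem : e ∉ S
  row_f : ∀ y ∈ S, A.entry f y = A₀.entry f₀ y
  row_g : ∀ y ∈ S, A.entry g y = A₀.entry f₀ y
  col_e : ∀ x ∈ S, A.entry x e = 0
  ratio : NotMultiple K (A.entry f e) (A.entry g e)

/-- The facts about `A₀[S ∪ f₀]` that do not change during the argument. -/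
structure LineBase (K : Subring R) (A₀ : LabelledMatrix α R) (f₀ : α) (S : Set α) : Prop where
  mem : f₀ ∈ A₀.rows
  notMem : f₀ ∉ S
  conn : Conn A₀ (insert f₀ S)
  entriesIn : EntriesIn K A₀ (insert f₀ S)
  exists_ne : ∃ y ∈ S, A₀.entry f₀ y ≠ 0

/-- Up to scaling and pivoting, `A` contains a copy of `A₀[S ∪ f₀]`, with `f₀` relabelled, and one
more row or column such that the result cannot be scaled into `K`. -/
def HasBadExt (P : PartialField R) (K : Subring R) (A₀ : LabelledMatrix α R) (f₀ : α) (S : Set α)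
    (A : LabelledMatrix α R) : Prop :=
  ∃ A' f z, PivotEquiv P A A' ∧ AgreeOn A₀ A' S ∧ f ∈ A'.rows ∧ f ∉ S ∧
    (∀ y ∈ S, A'.entry f y = A₀.entry f₀ y) ∧ z ∈ A'.ground ∧ z ≠ f ∧ z ∉ S ∧
    ¬ ScalesInto P K A' (insert z (insert f S))

theorem HasBadExt.of_pivotEquiv (h : PivotEquiv P A A') (h' : HasBadExt P K A₀ f₀ S A') :
    HasBadExt P K A₀ f₀ S A := by
  obtain ⟨B, f, z, h1, h2⟩ := h'
  exact ⟨B, f, z, h.trans h1, h2⟩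

theorem LineConfig.f_ne_e (h : LineConfig K A₀ f₀ S A f g e) : f ≠ e := row_ne_col h.f_mem h.e_mem

theorem LineConfig.g_ne_e (h : LineConfig K A₀ f₀ S A f g e) : g ≠ e := row_ne_col h.g_mem h.e_mem

theorem LineConfig.symm (hA : A.IsMatrixOver P) (hK : P.InvClosed K)
    (h : LineConfig K A₀ f₀ S A f g e) : LineConfig K A₀ f₀ S A g f e :=
  ⟨h.agree, h.g_mem, h.f_mem, h.e_mem, h.f_ne_g.symm, h.g_notMem, h.f_notMem, h.e_notMem,
    h.row_g, h.row_f, h.col_e, h.ratio.symm hK (entry_mem_elems hA _ _) (entry_mem_elems hA _ _)⟩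

theorem LineConfig.entriesIn (hB : LineBase K A₀ f₀ S) (h : AgreeOn A₀ A S) (hf : f ∈ A.rows)
    (hrow : ∀ y ∈ S, A.entry f y = A₀.entry f₀ y) : EntriesIn K A (insert f S) := by
  refine (h.entriesIn (hB.entriesIn.mono (Set.subset_insert _ _))).insert_row hf fun y hy => ?_
  rw [hrow y hy]
  exact hB.entriesIn f₀ (by simp) y (by simp [hy])

/-- The rows `f` and `g` agree on `S`, and are nonzero there, so that differences of their entries
in one column are subdeterminants up to a unit. -/
theorem LineConfig.sub_mem (hA : A.IsMatrixOver P) (hB : LineBase K A₀ f₀ S)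
    (h : LineConfig K A₀ f₀ S A f g e) {z : α} : A.entry g z - A.entry f z ∈ P.elems := by
  obtain ⟨y, hy, hy0⟩ := hB.exists_ne
  have h1 := det_two_mem_elems hA f g y z
  rw [h.row_f y hy, h.row_g y hy] at h1
  refine mem_elems_of_mul (b := A.entry g z - A.entry f z) ?_ hy0 ?_
  · rw [← h.row_f y hy]; exact entry_mem_elems hA f y
  · convert h1 using 1; ring

theorem LineConfig.sub_ne_zero (h : LineConfig K A₀ f₀ S A f g e) :
    A.entry g e - A.entry f e ≠ 0 := by
  intro h0
  exact h.ratio.2 1 K.one_mem (by rw [one_mul]; exact sub_eq_zero.1 h0)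

/-- Pivoting over `ge` and rescaling the rows `f` and `e` turns the rows `f`, `e` into the two
copies of the row `f₀`. -/
theorem LineConfig.exists_exchange (hA : A.IsMatrixOver P) (hB : LineBase K A₀ f₀ S)
    (h : LineConfig K A₀ f₀ S A f g e) :
    ∃ A', PivotEquiv P A A' ∧ AgreeOn A₀ A' S ∧
      (∀ x, x ≠ g → x ≠ e → (x ∈ A'.rows ↔ x ∈ A.rows)) ∧
      (∀ x, x ≠ g → x ≠ e → (x ∈ A'.cols ↔ x ∈ A.cols)) ∧ e ∈ A'.rows ∧
      (∀ y, y ≠ f → y ≠ g → y ≠ e → A'.entry e y = A.entry g y) ∧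
      (∀ y, y ≠ f → y ≠ g → y ≠ e → (A.entry g e - A.entry f e) * A'.entry f y =
        A.entry g e * A.entry f y - A.entry f e * A.entry g y) ∧
      ∀ x, x ≠ f → x ≠ g → x ≠ e → ∀ y, y ≠ f → y ≠ g → y ≠ e →
        A.entry g e * A'.entry x y = A.entry g e * A.entry x y - A.entry x e * A.entry g y := by
  obtain ⟨b, hb, hb'⟩ := exists_unit (entry_mem_elems hA g e) h.ratio.ne_zero
  obtain ⟨d, hd, hd'⟩ := exists_unit (h.sub_mem hA hB) h.sub_ne_zero
  have hge0 : A.entry g e ≠ 0 := h.ratio.ne_zero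
  have hfe := h.f_ne_e
  have hge := h.g_ne_e
  have hfg := h.f_ne_g
  -- with `a`, `b` the entries `fe`, `ge`, the pivot turns the row `f` into `(1 - a / b) f₀` and the
  -- row `e` into `f₀ / b` on `S`
  set B := A.pivot g e h.g_mem h.e_mem with hBdef
  have hi : Ring.inverse (A.entry g e) = (b⁻¹ : Rˣ) := by rw [← hb', Ring.inverse_unit]
  have hbb : (b : R) * (b⁻¹ : Rˣ) = 1 := by simp
  have hBA : PivotEquiv P A B := pivotEquiv_pivot hge0
  have h1 : PivotEquiv P B (B.scaleAt f (b * d⁻¹)) :=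
    pivotEquiv_scaleAt (P.units.mul_mem hb (P.units.inv_mem hd))
  have h2 : PivotEquiv P (B.scaleAt f (b * d⁻¹)) ((B.scaleAt f (b * d⁻¹)).scaleAt e b) :=
    pivotEquiv_scaleAt hb
  have hagr : AgreeOn A B S := agreeOn_pivot h.g_notMem h.e_notMem (Or.inl h.col_e)
  refine ⟨_, hBA.trans (h1.trans h2), h.agree.trans (hagr.trans ((agreeOn_scaleAt h.f_notMem).trans
    (agreeOn_scaleAt h.e_notMem))), ?_, ?_, ?_, ?_, ?_, ?_⟩
  · intro x hxg hxe
    rw [scaleAt_rows, scaleAt_rows, hBdef, mem_pivot_rows]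
    simp [hxg, hxe]
  · intro x hxg hxe
    rw [scaleAt_cols, scaleAt_cols, hBdef, mem_pivot_cols]
    simp [hxg, hxe]
  · rw [scaleAt_rows, scaleAt_rows, hBdef, mem_pivot_rows]
    simp
  · intro y hyf hyg hye
    rw [scaleAt_entry_left hye, scaleAt_entry hfe.symm hyf, hBdef, pivot_entry_row hyg hye, hi,
      ← mul_assoc, hbb, one_mul]
  · intro y hyf hyg hye
    rw [scaleAt_entry hfe hye, scaleAt_entry_left hyf, hBdef, pivot_entry hfg hfe hyg hye, hi,
      ← hd', Units.val_mul]
    have : (d : R) * (d⁻¹ : Rˣ) = 1 := by simp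
    rw [← hb']
    linear_combination (b * A.entry f y - b * (b⁻¹ : Rˣ) * A.entry f e * A.entry g y) * this -
      (A.entry f e * A.entry g y) * hbb
  · intro x hxf hxg hxe y hyf hyg hye
    rw [scaleAt_entry hxe hye, scaleAt_entry hxf hyf, hBdef, pivot_entry hxg hxe hyg hye, hi,
      ← hb']
    linear_combination (-A.entry x e * A.entry g y) * hbb

/-- The three contractions of a four-point line onto its basepoint send a column `z` that meets
both sides of the 2-separation to three columns that cannot all be scaled into `K`. -/
theorem LineConfig.hasBadExt_of_col (hA : A.IsMatrixOver P) (hK : P.InvClosed K)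
    (hB : LineBase K A₀ f₀ S) (h : LineConfig K A₀ f₀ S A f g e) (hz : z ∈ A.cols) (hzS : z ∉ S)
    (hze : z ≠ e) (hx : ∃ x ∈ S, A.entry x z ≠ 0) (hne : A.entry f z ≠ A.entry g z) :
    HasBadExt P K A₀ f₀ S A := by
  by_contra hcon
  have hzf : z ≠ f := (row_ne_col h.f_mem hz).symm
  have hzg : z ≠ g := (row_ne_col h.g_mem hz).symm
  -- otherwise every copy of `A₀[S ∪ f₀]` together with `z` can be scaled into `K`
  have key : ∀ A' p, PivotEquiv P A A' → AgreeOn A₀ A' S → p ∈ A'.rows → p ∉ S →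
      (∀ y ∈ S, A'.entry p y = A₀.entry f₀ y) → z ∈ A'.ground → z ≠ p →
      ∃ k ∈ P.units, ∀ x ∈ insert p S, A'.entry x z * k ∈ K := by
    intro A' p h1 h2 h3 h4 h5 h6 h7
    refine exists_col_scale (h1.isMatrixOver hA) hK (conn_relabel_row h2 hB.mem hB.notMem h3 h4 h5
      hB.conn) (LineConfig.entriesIn hB h2 h3 h5) ?_
    by_contra h8
    exact hcon ⟨A', p, z, h1, h2, h3, h4, h5, h6, h7, hzS, h8⟩
  -- the three copies have the rows `f`, `g`, and `f` after the pivot over `ge`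
  obtain ⟨k1, hk1, hf⟩ := key A f (PivotEquiv.refl A) h.agree h.f_mem h.f_notMem h.row_f
    (mem_ground.2 (Or.inr hz)) hzf
  obtain ⟨k2, hk2, hg⟩ := key A g (PivotEquiv.refl A) h.agree h.g_mem h.g_notMem h.row_g
    (mem_ground.2 (Or.inr hz)) hzg
  obtain ⟨A', hA', hagr, hrows, hcols, he, _, hfy, hxy⟩ := h.exists_exchange hA hB
  have hSne : ∀ {y}, y ∈ S → y ≠ f ∧ y ≠ g ∧ y ≠ e := fun hy =>
    ⟨ne_of_mem_of_not_mem hy h.f_notMem, ne_of_mem_of_not_mem hy h.g_notMem,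
      ne_of_mem_of_not_mem hy h.e_notMem⟩
  have hda := h.sub_mem hA hB (z := e)
  have hd0 := h.sub_ne_zero
  obtain ⟨k3, hk3, hf'⟩ := key A' f hA' hagr ((hrows f h.f_ne_g h.f_ne_e).2 h.f_mem) h.f_notMem
    (fun y hy => by
      have h1 := hfy y (hSne hy).1 (hSne hy).2.1 (hSne hy).2.2
      rw [h.row_f y hy, h.row_g y hy, ← sub_mul] at h1
      exact mul_left_cancel' hda hd0 h1)
    (mem_ground.2 (Or.inr ((hcols z hzg hze).2 hz))) hzf
  obtain ⟨x, hxS, hx0⟩ := hx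
  have hxz : A'.entry x z = A.entry x z := by
    have h1 := hxy x (hSne hxS).1 (hSne hxS).2.1 (hSne hxS).2.2 z hzf hzg hze
    rw [h.col_e x hxS, zero_mul, sub_zero] at h1
    exact mul_left_cancel' (entry_mem_elems hA g e) h.ratio.ne_zero h1
  -- the three scalars agree up to `G ∩ K`
  have hxP := entry_mem_elems hA x z
  have htrans : ∀ (k : Rˣ) (c : R), k ∈ P.units → A.entry x z * k ∈ K → c * k ∈ K →
      c * k1 ∈ K := by
    intro k c hk h1 h2
    apply mem_of_mul_mem hK (a := A.entry x z * k) (mul_mem_elems hxP (coe_mem_elems hk)) ?_ h1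
    · have : A.entry x z * k * (c * k1) = (A.entry x z * k1) * (c * k) := by ring
      rw [this]
      exact K.mul_mem (hf x (by simp [hxS])) h2
    · rwa [ne_eq, Units.mul_left_eq_zero]
  have hα := hf f (by simp)
  have hβ := htrans k2 _ hk2 (hg x (by simp [hxS])) (hg g (by simp))
  have hγ := htrans k3 _ hk3 (by rw [← hxz]; exact hf' x (by simp [hxS])) (hf' f (by simp))
  have hrel := hfy z hzf hzg hze
  set γ := A'.entry f z
  -- `(b - a) (γ - α) = a (α - β)`
  have h1 : (A.entry g e - A.entry f e) * (γ - A.entry f z) =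
      A.entry f e * -(A.entry g z - A.entry f z) := by linear_combination hrel
  have hne' : A.entry g z - A.entry f z ≠ 0 := fun h0 => hne (sub_eq_zero.1 h0).symm
  have h2 : γ - A.entry f z ∈ P.elems := by
    apply mem_elems_of_mul hda hd0
    rw [h1]
    exact mul_mem_elems (entry_mem_elems hA f e) (neg_mem_elems (h.sub_mem hA hB))
  have h3 : γ - A.entry f z ≠ 0 := by
    intro h0
    rw [h0, mul_zero] at h1
    exact PartialField.mul_ne_zero (entry_mem_elems hA f e) h.ratio.1 (neg_ne_zero.2 hne') h1.symm
  -- the ratio of the entries `fe` and `ge` is then the ratio of two elements of `K`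
  refine h.ratio.false_of_mul_eq hK (p := (γ - A.entry f z) * k1) (q := (γ - A.entry g z) * k1)
    ?_ ?_ (mul_mem_elems h2 (coe_mem_elems hk1)) ?_ ?_
  · rw [sub_mul]; exact K.sub_mem hγ hα
  · rw [sub_mul]; exact K.sub_mem hγ hβ
  · rwa [ne_eq, Units.mul_left_eq_zero]
  · linear_combination k1 * hrel

/-- The dual of `LineConfig.hasBadExt_of_col`. -/
theorem LineConfig.hasBadExt_of_row (hA : A.IsMatrixOver P) (hK : P.InvClosed K)
    (hB : LineBase K A₀ f₀ S) (h : LineConfig K A₀ f₀ S A f g e) (hz : z ∈ A.rows) (hzS : z ∉ S)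
    (hzf : z ≠ f) (hzg : z ≠ g)
    (hy : ∃ y ∈ S, ∃ y' ∈ S, A.entry z y * A₀.entry f₀ y' ≠ A.entry z y' * A₀.entry f₀ y)
    (hne : A.entry z e ≠ 0) : HasBadExt P K A₀ f₀ S A := by
  by_contra hcon
  have hze : z ≠ e := row_ne_col hz h.e_mem
  have key : ∀ A' p, PivotEquiv P A A' → AgreeOn A₀ A' S → p ∈ A'.rows → p ∉ S →
      (∀ y ∈ S, A'.entry p y = A₀.entry f₀ y) → z ∈ A'.ground → z ≠ p →
      ∃ k ∈ P.units, ∀ y ∈ insert p S, A'.entry z y * k ∈ K := by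
    intro A' p h1 h2 h3 h4 h5 h6 h7
    refine exists_row_scale (h1.isMatrixOver hA) hK (conn_relabel_row h2 hB.mem hB.notMem h3 h4 h5
      hB.conn) (LineConfig.entriesIn hB h2 h3 h5) ?_
    by_contra h8
    exact hcon ⟨A', p, z, h1, h2, h3, h4, h5, h6, h7, hzS, h8⟩
  obtain ⟨k1, hk1, hf⟩ := key A f (PivotEquiv.refl A) h.agree h.f_mem h.f_notMem h.row_f
    (mem_ground.2 (Or.inl hz)) hzf
  obtain ⟨y, hyS, y', hyS', hyy⟩ := hy
  have hΔ : A₀.entry f₀ y * (A.entry z y' * k1) - A₀.entry f₀ y' * (A.entry z y * k1) ∈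
      P.elems := by
    have := mul_mem_elems (det_two_mem_elems hA f z y y') (coe_mem_elems hk1)
    rw [h.row_f y hyS, h.row_f y' hyS'] at this
    convert this using 1
    ring
  have hΔ0 : A₀.entry f₀ y * (A.entry z y' * k1) - A₀.entry f₀ y' * (A.entry z y * k1) ≠ 0 := by
    have : A₀.entry f₀ y * (A.entry z y' * k1) - A₀.entry f₀ y' * (A.entry z y * k1) =
        (A.entry z y' * A₀.entry f₀ y - A.entry z y * A₀.entry f₀ y') * k1 := by ring
    rw [this, ne_eq, Units.mul_left_eq_zero, sub_eq_zero]
    exact fun h => hyy h.symm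
  have hρK : ∀ y ∈ S, A₀.entry f₀ y ∈ K := fun y hy => hB.entriesIn f₀ (by simp) y (by simp [hy])
  obtain ⟨w, hw, hw'⟩ := exists_unit (entry_mem_elems hA z e) hne
  -- pivoting over `fe` or `ge` replaces the row `z` by its difference with a multiple of `f₀`
  have hmul : ∀ f g, z ≠ f → z ≠ g → LineConfig K A₀ f₀ S A f g e → ∀ b : Rˣ, b ∈ P.units →
      (b : R) = A.entry g e → ((w * b⁻¹ * k1 : Rˣ) : R) ∈ K := by
    clear hzf hzg h hcon
    intro f g hzf hzg h b hb hb'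
    have hSne : ∀ {y}, y ∈ S → y ≠ f ∧ y ≠ g ∧ y ≠ e := fun hy =>
      ⟨ne_of_mem_of_not_mem hy h.f_notMem, ne_of_mem_of_not_mem hy h.g_notMem,
        ne_of_mem_of_not_mem hy h.e_notMem⟩
    obtain ⟨A', hA', hagr, hrows, _, _, _, hfy, hxy⟩ := h.exists_exchange hA hB
    obtain ⟨k2, hk2, hf'⟩ := key A' f hA' hagr ((hrows f h.f_ne_g h.f_ne_e).2 h.f_mem) h.f_notMem
      (fun y hy => by
        have h1 := hfy y (hSne hy).1 (hSne hy).2.1 (hSne hy).2.2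
        rw [h.row_f y hy, h.row_g y hy, ← sub_mul] at h1
        exact mul_left_cancel' (h.sub_mem hA hB) h.sub_ne_zero h1)
      (mem_ground.2 (Or.inl ((hrows z hzg hze).2 hz))) hzf
    have hzy : ∀ y ∈ S, A'.entry z y = A.entry z y - w * (b⁻¹ : Rˣ) * A₀.entry f₀ y := by
      intro y hy
      have h1 := hxy z hzf hzg hze y (hSne hy).1 (hSne hy).2.1 (hSne hy).2.2
      rw [h.row_g y hy, ← hw', ← hb'] at h1
      apply mul_left_cancel' (coe_mem_elems hb) (by rw [hb']; exact h.ratio.ne_zero)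
      rw [h1]
      have h2 : (b : R) * (b⁻¹ : Rˣ) = 1 := by simp
      linear_combination w * A₀.entry f₀ y * h2
    have hsub : ∀ y ∈ S, ((k1⁻¹ * k2 : Rˣ) : R) *
        (A.entry z y * k1 - ((w * b⁻¹ * k1 : Rˣ) : R) * A₀.entry f₀ y) ∈ K := by
      intro y hy
      have h1 := hf' y (by simp [hy])
      rw [hzy y hy] at h1
      convert h1 using 1
      have h2 : ((k1⁻¹ : Rˣ) : R) * k1 = 1 := by simp
      simp only [Units.val_mul]
      linear_combination (A.entry z y - w * (b⁻¹ : Rˣ) * A₀.entry f₀ y) * k2 * h2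
    refine mem_of_sub_mul_mem hK (hρK y hyS) (hρK y' hyS') (hf y (by simp [hyS]))
      (hf y' (by simp [hyS'])) hΔ hΔ0
      (coe_mem_elems (P.units.mul_mem (P.units.inv_mem hk1) hk2))
      (units_ne_zero hne _) (hsub y hyS) (hsub y' hyS')
  obtain ⟨a, ha, ha'⟩ := exists_unit (entry_mem_elems hA f e) h.ratio.1
  obtain ⟨b, hb, hb'⟩ := exists_unit (entry_mem_elems hA g e) h.ratio.ne_zero
  have h1 := hmul f g hzf hzg h b hb hb'
  have h2 := hmul g f hzg hzf (h.symm hA hK) a ha ha'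
  have hP : ∀ c ∈ P.units, w * c⁻¹ * k1 ∈ P.units := fun c hc =>
    P.units.mul_mem (P.units.mul_mem hw (P.units.inv_mem hc)) hk1
  have := h.ratio.false_of_mul_eq hK h1 h2 (coe_mem_elems (hP b hb))
    (units_ne_zero hne _) (by
    rw [← ha', ← hb', ← Units.val_mul, ← Units.val_mul]
    congr 1
    rw [mul_comm w b⁻¹, mul_comm w a⁻¹, mul_assoc, mul_inv_cancel_left, mul_assoc,
      mul_inv_cancel_left])
  exact this

end LabelledMatrix

/-! ### Blocking sequences -/

namespace LabelledMatrix

variable {α R : Type*} [CommRing R] {P : PartialField R} {K : Subring R}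
variable {A₀ A A' : LabelledMatrix α R} {S T : Set α} {f₀ f g e z : α}

/-- `z` may join the line side `{f, g, e}` of the 2-separation of a `LineConfig`. -/
def JoinsLine (A₀ : LabelledMatrix α R) (f₀ : α) (S : Set α) (A : LabelledMatrix α R) (z : α) :
    Prop :=
  (z ∈ A.cols → ∀ x ∈ S, A.entry x z = 0) ∧
    (z ∈ A.rows → ∀ y ∈ S, ∀ y' ∈ S,
      A.entry z y * A₀.entry f₀ y' = A.entry z y' * A₀.entry f₀ y)

/-- `z` may join the side `S` of the 2-separation of a `LineConfig`. -/
def JoinsBase (A : LabelledMatrix α R) (f g e z : α) : Prop :=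
  (z ∈ A.cols → A.entry f z = A.entry g z) ∧ (z ∈ A.rows → A.entry z e = 0)

/-- Putting `z` on the line side and `z'` on the side `S` destroys the 2-separation. -/
def Conflict (A₀ : LabelledMatrix α R) (f₀ : α) (S : Set α) (A : LabelledMatrix α R) (f z z' : α) :
    Prop :=
  (z ∈ A.rows ∧ z' ∈ A.cols ∧
      ∃ y ∈ S, A.entry z z' * A₀.entry f₀ y ≠ A.entry z y * A.entry f z') ∨
    (z ∈ A.cols ∧ z' ∈ A.rows ∧ A.entry z' z ≠ 0)

/-- `z` is a label outside the submatrix of a `LineConfig`. -/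
structure IsOutside (S : Set α) (A : LabelledMatrix α R) (f g e z : α) : Prop where
  mem : z ∈ A.ground
  notMem : z ∉ S
  ne_f : z ≠ f
  ne_g : z ≠ g
  ne_e : z ≠ e

/-- The list `l` continues `z` to a blocking sequence: consecutive members conflict, all members of
`l` may join the side `S`, and the last member of `z :: l` may not join the line side. -/
def Blocks (A₀ : LabelledMatrix α R) (f₀ : α) (S : Set α) (A : LabelledMatrix α R) (f g e : α) :
    α → List α → Prop
  | z, [] => ¬ JoinsLine A₀ f₀ S A z
  | z, z' :: l => IsOutside S A f g e z' ∧ JoinsBase A f g e z' ∧ Conflict A₀ f₀ S A f z z' ∧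
      Blocks A₀ f₀ S A f g e z' l

theorem IsOutside.symm (h : IsOutside S A f g e z) : IsOutside S A g f e z :=
  ⟨h.mem, h.notMem, h.ne_g, h.ne_f, h.ne_e⟩

theorem JoinsBase.symm (h : JoinsBase A f g e z) : JoinsBase A g f e z :=
  ⟨fun hz => (h.1 hz).symm, h.2⟩

theorem JoinsBase.conflict_symm {u : α} (h : JoinsBase A f g e u) :
    Conflict A₀ f₀ S A g z u ↔ Conflict A₀ f₀ S A f z u := by
  unfold Conflict
  by_cases hu : u ∈ A.cols
  · rw [h.1 hu]
  · simp [hu]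

/-- The configuration `f', g', e'` in `A'` arises from `f, g, e` in `A` by exchanging one of `f`,
`g`, `e` for `z`. Nothing changes for labels that may join the side `S`, except that those in
conflict with `z` may not join it any more. -/
structure IsExchange (A₀ : LabelledMatrix α R) (f₀ : α) (S : Set α) (A : LabelledMatrix α R)
    (f g e z : α) (A' : LabelledMatrix α R) (f' g' e' : α) : Prop where
  outside : ∀ u, IsOutside S A f g e u → JoinsBase A f g e u → u ≠ f' ∧ u ≠ g' ∧ u ≠ e' ∧
    (u ∈ A'.rows ↔ u ∈ A.rows) ∧ (u ∈ A'.cols ↔ u ∈ A.cols)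
  row_entry : ∀ u ∈ A.rows, IsOutside S A f g e u → JoinsBase A f g e u →
    (∀ v ∈ S, A'.entry u v = A.entry u v) ∧ ∀ v ∈ A.cols, IsOutside S A f g e v →
      JoinsBase A f g e v → A'.entry u v = A.entry u v
  row_e : ∀ u ∈ A.rows, IsOutside S A f g e u → JoinsBase A f g e u →
    (A'.entry u e' = 0 ↔ ¬ Conflict A₀ f₀ S A f z u)
  col_entry : ∀ u ∈ A.cols, IsOutside S A f g e u → JoinsBase A f g e u →
    ∀ x ∈ S, A'.entry x u = A.entry x u
  col_fg : ∀ u ∈ A.cols, IsOutside S A f g e u → JoinsBase A f g e u →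
    ¬ Conflict A₀ f₀ S A f z u → A'.entry f' u = A.entry f u ∧ A'.entry g' u = A.entry f u
  col_ne : ∀ u ∈ A.cols, IsOutside S A f g e u → JoinsBase A f g e u →
    Conflict A₀ f₀ S A f z u → A'.entry f' u ≠ A'.entry g' u

/-- The label `z` can be exchanged into the configuration. -/
def CanExchange (P : PartialField R) (K : Subring R) (A₀ : LabelledMatrix α R) (f₀ : α) (S : Set α)
    (A : LabelledMatrix α R) (f g e z : α) : Prop :=
  ∃ A' f' g' e', PivotEquiv P A A' ∧ LineConfig K A₀ f₀ S A' f' g' e' ∧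
    IsExchange A₀ f₀ S A f g e z A' f' g' e'

theorem CanExchange.symm (h : CanExchange P K A₀ f₀ S A g f e z) :
    CanExchange P K A₀ f₀ S A f g e z := by
  obtain ⟨A', f', g', e', h1, h2, h3⟩ := h
  refine ⟨A', f', g', e', h1, h2, fun u hu hb => h3.outside u hu.symm hb.symm,
    fun u hur hu hb => ⟨(h3.row_entry u hur hu.symm hb.symm).1, fun v hv hv1 hv2 =>
      (h3.row_entry u hur hu.symm hb.symm).2 v hv hv1.symm hv2.symm⟩,
    fun u hur hu hb => ?_, fun u hur hu hb => h3.col_entry u hur hu.symm hb.symm,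
    fun u huc hu hb hc => ?_, fun u huc hu hb hc => ?_⟩
  · rw [h3.row_e u hur hu.symm hb.symm, hb.conflict_symm]
  · rw [hb.1 huc]
    exact h3.col_fg u huc hu.symm hb.symm (by rwa [hb.conflict_symm])
  · exact h3.col_ne u huc hu.symm hb.symm (by rwa [hb.conflict_symm])

theorem not_conflict_cols {u : α} (hz : z ∈ A.cols) (hu : u ∈ A.cols) :
    ¬ Conflict A₀ f₀ S A f z u := by
  rintro (h | h)
  · exact notMem_cols h.1 hz
  · exact notMem_cols h.2.1 hu

theorem not_conflict_rows {u : α} (hz : z ∈ A.rows) (hu : u ∈ A.rows) :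
    ¬ Conflict A₀ f₀ S A f z u := by
  rintro (h | h)
  · exact notMem_cols hu h.2.1
  · exact notMem_cols hz h.1

/-- A column `z` on the line that is not parallel to the basepoint, `f`, or `g`, and forms a bad
line with them, takes the place of `e`. -/
theorem LineConfig.canExchange_col (h : LineConfig K A₀ f₀ S A f g e) (hz : z ∈ A.cols)
    (ho : IsOutside S A f g e z) (hj : JoinsLine A₀ f₀ S A z) (hb : ¬ JoinsBase A f g e z)
    (hnm : NotMultiple K (A.entry f z) (A.entry g z)) : CanExchange P K A₀ f₀ S A f g e z := by
  have hne : ∀ {u}, JoinsBase A f g e u → u ≠ z := by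
    rintro u hu rfl
    exact hb hu
  refine ⟨A, f, g, z, PivotEquiv.refl A, ⟨h.agree, h.f_mem, h.g_mem, hz, h.f_ne_g, h.f_notMem,
    h.g_notMem, ho.notMem, h.row_f, h.row_g, hj.1 hz, hnm⟩,
    fun u hu hub => ⟨hu.ne_f, hu.ne_g, hne hub, Iff.rfl, Iff.rfl⟩,
    fun _ _ _ _ => ⟨fun _ _ => rfl, fun _ _ _ _ => rfl⟩, fun u hu _ _ => ?_,
    fun _ _ _ _ _ _ => rfl, fun u hu _ hub _ => ⟨rfl, (hub.1 hu).symm⟩,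
    fun u hu _ _ hc => absurd hc (not_conflict_cols hz hu)⟩
  unfold Conflict
  simp [hz, hu, notMem_rows hz]

/-- A column `z` on the line for which the cross ratio of `f`, `g`, `z` and the basepoint lies in
`K` is exchanged for `g`. -/
theorem LineConfig.canExchange_col' (hA : A.IsMatrixOver P) (hK : P.InvClosed K)
    (hB : LineBase K A₀ f₀ S) (h : LineConfig K A₀ f₀ S A f g e) (hz : z ∈ A.cols)
    (ho : IsOutside S A f g e z) (hj : JoinsLine A₀ f₀ S A z) (hb : ¬ JoinsBase A f g e z)
    {k : R} (hk : k ∈ K) (hkz : A.entry f z = k * A.entry g z) :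
    CanExchange P K A₀ f₀ S A f g e z := by
  have hne : ∀ {u}, JoinsBase A f g e u → u ≠ z := by
    rintro u hu rfl
    exact hb hu
  have hfz : A.entry f z ≠ A.entry g z := fun h0 => hb ⟨fun _ => h0, fun hzr =>
    absurd hz (notMem_cols hzr)⟩
  have hgz : A.entry g z ≠ 0 := by
    intro h0
    rw [h0, mul_zero] at hkz
    exact hfz (hkz.trans h0.symm)
  obtain ⟨A', hAA', hagr, hrows, hcols, he, hey, hfy, hxy⟩ := h.exists_exchange hA hB
  have hSne : ∀ {y}, y ∈ S → y ≠ f ∧ y ≠ g ∧ y ≠ e := fun hy =>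
    ⟨ne_of_mem_of_not_mem hy h.f_notMem, ne_of_mem_of_not_mem hy h.g_notMem,
      ne_of_mem_of_not_mem hy h.e_notMem⟩
  have hba := h.sub_mem hA hB (z := e)
  have hba0 := h.sub_ne_zero
  have hbP := entry_mem_elems hA g e
  have hb0 := h.ratio.ne_zero
  have hx : ∀ x, x ≠ f → x ≠ g → x ≠ e → A.entry x e = 0 → ∀ y, y ≠ f → y ≠ g → y ≠ e →
      A'.entry x y = A.entry x y := by
    intro x h1 h2 h3 h0 y h4 h5 h6
    have := hxy x h1 h2 h3 y h4 h5 h6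
    rw [h0, zero_mul, sub_zero] at this
    exact mul_left_cancel' hbP hb0 this
  have hf : ∀ y, y ≠ f → y ≠ g → y ≠ e → A.entry f y = A.entry g y →
      A'.entry f y = A.entry f y := by
    intro y h1 h2 h3 h0
    have := hfy y h1 h2 h3
    rw [← h0, ← sub_mul] at this
    exact mul_left_cancel' hba hba0 this
  -- after the pivot over `ge` the two copies of `f₀` are `f` and `e`, and `z` replaces `e`
  refine ⟨A', f, e, z, hAA', ⟨hagr, (hrows f h.f_ne_g h.f_ne_e).2 h.f_mem, he,
    (hcols z ho.ne_g ho.ne_e).2 hz, h.f_ne_e, h.f_notMem, h.e_notMem, ho.notMem, fun y hy => ?_,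
    fun y hy => ?_, fun x hxS => ?_, ?_⟩, ?_⟩
  · rw [hf y (hSne hy).1 (hSne hy).2.1 (hSne hy).2.2 (by rw [h.row_f y hy, h.row_g y hy]),
      h.row_f y hy]
  · rw [hey y (hSne hy).1 (hSne hy).2.1 (hSne hy).2.2, h.row_g y hy]
  · rw [hx x (hSne hxS).1 (hSne hxS).2.1 (hSne hxS).2.2 (h.col_e x hxS) z ho.ne_f ho.ne_g ho.ne_e]
    exact hj.1 hz x hxS
  · rw [hey z ho.ne_f ho.ne_g ho.ne_e]
    have hrel := hfy z ho.ne_f ho.ne_g ho.ne_e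
    set a := A.entry f e
    set b := A.entry g e
    set β := A.entry g z with hβ
    set γ := A'.entry f z
    rw [hkz] at hrel
    have hrel' : (b - a) * γ = β * (b * k - a) := by linear_combination hrel
    have hβP : β ∈ P.elems := entry_mem_elems hA g z
    constructor
    · intro h0
      rw [h0, mul_zero] at hrel'
      have h1 : b * k - a = 0 := mul_left_cancel' hβP hgz (by rw [← hrel', mul_zero])
      exact (h.ratio.symm hK (entry_mem_elems hA _ _) (entry_mem_elems hA _ _)).2 k hk
        (by linear_combination -h1)
    · intro k' hk' h0
      -- `(b - a) = k' (b k - a)`, so that `b (1 - k' k) = a (1 - k')`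
      have h1 : b - a = k' * (b * k - a) := by
        apply mul_left_cancel' hβP hgz
        linear_combination (b - a) * h0 + k' * hrel'
      have h2 : b * k - a ∈ P.elems := by
        apply mem_elems_of_mul hβP hgz
        have := neg_mem_elems (det_two_mem_elems hA f g e z)
        convert this using 1
        rw [hkz]
        ring
      have h20 : b * k - a ≠ 0 := by
        intro h3
        rw [h3, mul_zero] at h1
        exact hba0 h1
      have h3 : k - 1 ∈ P.elems := by
        apply mem_elems_of_mul hβP hgz
        have := neg_mem_elems (h.sub_mem hA hB (z := z))
        convert this using 1
        rw [hkz]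
        ring
      have h30 : k - 1 ≠ 0 := by
        intro h4
        apply hfz
        rw [hkz]
        linear_combination β * h4
      have h4 : (b * k - a) * (1 - k' * k) = a * (k - 1) := by linear_combination k * h1
      refine h.ratio.false_of_mul_eq hK (p := 1 - k' * k) (q := 1 - k')
        (K.sub_mem K.one_mem (K.mul_mem hk' hk)) (K.sub_mem K.one_mem hk')
        (mem_elems_of_mul h2 h20 ?_) ?_ ?_
      · rw [h4]; exact mul_mem_elems (entry_mem_elems hA f e) h3
      · intro h5
        rw [h5, mul_zero] at h4
        exact PartialField.mul_ne_zero (entry_mem_elems hA f e) h.ratio.1 h30 h4.symm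
      · linear_combination h1
  · have hu0 : ∀ u ∈ A.rows, IsOutside S A f g e u → JoinsBase A f g e u →
        ∀ y, y ≠ f → y ≠ g → y ≠ e → A'.entry u y = A.entry u y := fun u hur hu hub y =>
      hx u hu.ne_f hu.ne_g hu.ne_e (hub.2 hur) y
    refine ⟨fun u hu hub => ⟨hu.ne_f, hu.ne_e, hne hub, hrows u hu.ne_g hu.ne_e,
      hcols u hu.ne_g hu.ne_e⟩, fun u hur hu hub => ⟨fun y hy =>
      hu0 u hur hu hub y (hSne hy).1 (hSne hy).2.1 (hSne hy).2.2, fun v _ hv _ =>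
      hu0 u hur hu hub v hv.ne_f hv.ne_g hv.ne_e⟩, fun u hur hu hub => ?_,
      fun u _ hu _ x hxS => hx x (hSne hxS).1 (hSne hxS).2.1 (hSne hxS).2.2 (h.col_e x hxS) u
        hu.ne_f hu.ne_g hu.ne_e,
      fun u huc hu hub _ => ⟨hf u hu.ne_f hu.ne_g hu.ne_e (hub.1 huc), ?_⟩,
      fun u huc _ _ hc => absurd hc (not_conflict_cols hz huc)⟩
    · rw [hu0 u hur hu hub z ho.ne_f ho.ne_g ho.ne_e]
      unfold Conflict
      simp [hz, hur, notMem_rows hz]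
    · rw [hey u hu.ne_f hu.ne_g hu.ne_e, hub.1 huc]

/-- A row `z` that is parallel on `S` to the basepoint, and forms a bad line with `f`, takes the
place of `g`. -/
theorem LineConfig.canExchange_row (hA : A.IsMatrixOver P)
    (h : LineConfig K A₀ f₀ S A f g e) (hz : z ∈ A.rows)
    (ho : IsOutside S A f g e z) (hb : ¬ JoinsBase A f g e z) {c : Rˣ} (hc : c ∈ P.units)
    (hcz : ∀ y ∈ S, A.entry z y = c * A₀.entry f₀ y) (hρ : ∃ y ∈ S, A₀.entry f₀ y ≠ 0)
    (hnm : NotMultiple K (A.entry f e) ((c⁻¹ : Rˣ) * A.entry z e)) :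
    CanExchange P K A₀ f₀ S A f g e z := by
  have hne : ∀ {u}, JoinsBase A f g e u → u ≠ z := by
    rintro u hu rfl
    exact hb hu
  have hcc : ((c⁻¹ : Rˣ) : R) * c = 1 := by simp
  have hcc' : ∀ {s t : R}, (c⁻¹ : Rˣ) * s = t ↔ s = c * t := by
    intro s t
    constructor
    · rintro rfl; simp
    · rintro rfl; simp
  have hagr := agreeOn_scaleAt (A := A) (g := c⁻¹) ho.notMem
  have hSz : ∀ {y}, y ∈ S → y ≠ z := fun hy => ne_of_mem_of_not_mem hy ho.notMem
  have hfz := ho.ne_f.symm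
  -- no pivot is needed: `z` becomes a copy of `f₀` by scaling
  refine ⟨A.scaleAt z c⁻¹, f, z, e, pivotEquiv_scaleAt (P.units.inv_mem hc),
    ⟨h.agree.trans hagr, h.f_mem, hz, h.e_mem, ho.ne_f.symm, h.f_notMem, ho.notMem, h.e_notMem,
      fun y hy => ?_, fun y hy => ?_, fun x hx => ?_, ?_⟩,
    fun u hu hub => ⟨hu.ne_f, hne hub, hu.ne_e, Iff.rfl, Iff.rfl⟩,
    fun u _ _ hub => ⟨fun y hy => scaleAt_entry (hne hub) (hSz hy), fun v _ _ hvb =>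
      scaleAt_entry (hne hub) (hne hvb)⟩, fun u hur hu hub => ?_, fun u _ _ hub x hx =>
      scaleAt_entry (hSz hx) (hne hub), fun u huc hu hub hcon => ⟨scaleAt_entry hfz (hne hub), ?_⟩,
      fun u huc hu hub hcon => ?_⟩
  · rw [scaleAt_entry hfz (hSz hy), h.row_f y hy]
  · rw [scaleAt_entry_left (hSz hy), hcz y hy, ← mul_assoc, hcc, one_mul]
  · rw [scaleAt_entry (hSz hx) ho.ne_e.symm, h.col_e x hx]
  · rwa [scaleAt_entry hfz ho.ne_e.symm, scaleAt_entry_left ho.ne_e.symm]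
  · rw [scaleAt_entry (hne hub) ho.ne_e.symm]
    simp [hub.2 hur, not_conflict_rows hz hur]
  · rw [scaleAt_entry_left (hne hub), hcc']
    by_contra h0
    apply hcon
    obtain ⟨y, hy, hy0⟩ := hρ
    refine Or.inl ⟨hz, huc, y, hy, fun h1 => h0 ?_⟩
    rw [hcz y hy] at h1
    have hρP : A₀.entry f₀ y ∈ P.elems := by
      rw [← h.row_f y hy]; exact entry_mem_elems hA f y
    refine mul_left_cancel' hρP hy0 ?_
    linear_combination h1
  · rw [scaleAt_entry_left (hne hub), scaleAt_entry hfz (hne hub), ne_comm, ne_eq, hcc']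
    rcases hcon with ⟨_, _, y, hy, h1⟩ | h1
    · intro h2
      apply h1
      rw [h2, hcz y hy]
      ring
    · exact absurd h1.1 (notMem_cols hz)

/-- A row `z` that is zero on `S` is in series with `e`, and is exchanged for it. -/
theorem LineConfig.canExchange_row' (hA : A.IsMatrixOver P)
    (h : LineConfig K A₀ f₀ S A f g e) (hz : z ∈ A.rows)
    (ho : IsOutside S A f g e z) (hb : ¬ JoinsBase A f g e z)
    (hcz : ∀ y ∈ S, A.entry z y = 0) (hρ : ∃ y ∈ S, A₀.entry f₀ y ≠ 0) :
    CanExchange P K A₀ f₀ S A f g e z := by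
  have hne : ∀ {u}, JoinsBase A f g e u → u ≠ z := by
    rintro u hu rfl
    exact hb hu
  have hze : A.entry z e ≠ 0 := fun h0 => hb ⟨fun hzc => absurd hzc (notMem_cols hz), fun _ => h0⟩
  obtain ⟨w, hw, hw'⟩ := exists_unit (entry_mem_elems hA z e) hze
  have hi : Ring.inverse (A.entry z e) = (w⁻¹ : Rˣ) := by rw [← hw', Ring.inverse_unit]
  have hSz : ∀ {y}, y ∈ S → y ≠ z := fun hy => ne_of_mem_of_not_mem hy ho.notMem
  have hSe : ∀ {y}, y ∈ S → y ≠ e := fun hy => ne_of_mem_of_not_mem hy h.e_notMem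
  have hagr := agreeOn_pivot (hx := hz) (hy := h.e_mem) ho.notMem h.e_notMem (Or.inl h.col_e)
  have hfe := h.f_ne_e
  have hge := h.g_ne_e
  have hfz := ho.ne_f.symm
  have hgz := ho.ne_g.symm
  obtain ⟨y0, hy0, hy0'⟩ := hρ
  -- the pivot over `ze` turns `z` into a column that is zero on `S`, with the same ratio
  refine ⟨A.pivot z e hz h.e_mem, f, g, z, pivotEquiv_pivot hze, ⟨h.agree.trans hagr,
    mem_pivot_rows.2 (Or.inr ⟨h.f_mem, hfz⟩), mem_pivot_rows.2 (Or.inr ⟨h.g_mem, hgz⟩),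
    mem_pivot_cols.2 (Or.inl rfl), h.f_ne_g, h.f_notMem, h.g_notMem, ho.notMem,
    fun y hy => ?_, fun y hy => ?_, fun x hx => ?_, ?_⟩,
    fun u hu hub => ⟨hu.ne_f, hu.ne_g, hne hub, ?_, ?_⟩,
    fun u hur hu hub => ⟨fun y hy => ?_, fun v _ hv hvb => ?_⟩, fun u hur hu hub => ?_,
    fun u _ hu hub x hx => ?_, fun u huc hu hub hcon => ?_, fun u huc hu hub hcon => ?_⟩
  · rw [pivot_entry hfz hfe (hSz hy) (hSe hy), hcz y hy, h.row_f y hy]; ring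
  · rw [pivot_entry hgz hge (hSz hy) (hSe hy), hcz y hy, h.row_g y hy]; ring
  · rw [pivot_entry_col (hSz hx) (hSe hx), h.col_e x hx]; ring
  · rw [pivot_entry_col hfz hfe, pivot_entry_col hgz hge, hi]
    constructor
    · rw [neg_ne_zero]
      exact PartialField.mul_ne_zero (coe_mem_elems (P.units.inv_mem hw))
        (units_ne_zero hze _) h.ratio.1
    · intro k hk h0
      apply h.ratio.2 k hk
      apply mul_left_cancel' (coe_mem_elems (P.units.inv_mem hw)) (units_ne_zero hze _)
      linear_combination -h0
  · rw [mem_pivot_rows]; simp [hu.ne_e, hne hub]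
  · rw [mem_pivot_cols]; simp [hu.ne_e, hne hub]
  · rw [pivot_entry (hne hub) hu.ne_e (hSz hy) (hSe hy), hub.2 hur]; ring
  · rw [pivot_entry (hne hub) hu.ne_e (hne hvb) hv.ne_e, hub.2 hur]; ring
  · rw [pivot_entry_col (hne hub) hu.ne_e, hub.2 hur]
    simp [not_conflict_rows hz hur]
  · rw [pivot_entry (hSz hx) (hSe hx) (hne hub) hu.ne_e, h.col_e x hx]; ring
  · have hzu : A.entry z u = 0 := by
      by_contra h0
      refine hcon (Or.inl ⟨hz, huc, y0, hy0, ?_⟩)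
      rw [hcz y0 hy0, zero_mul]
      exact PartialField.mul_ne_zero (entry_mem_elems hA z u) h0 hy0'
    rw [pivot_entry hfz hfe (hne hub) hu.ne_e, pivot_entry hgz hge (hne hub) hu.ne_e, hzu,
      hub.1 huc]
    constructor <;> ring
  · rcases hcon with ⟨_, _, y, hy, h1⟩ | h1
    swap
    · exact absurd h1.1 (notMem_cols hz)
    have hzu : A.entry z u ≠ 0 := by
      intro h0
      apply h1
      rw [hcz y hy, h0, zero_mul, zero_mul]
    rw [pivot_entry hfz hfe (hne hub) hu.ne_e, pivot_entry hgz hge (hne hub) hu.ne_e, hub.1 huc, hi]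
    intro h2
    have h3 : (w⁻¹ : Rˣ) * (A.entry z u * (A.entry g e - A.entry f e)) = 0 := by
      linear_combination h2
    exact PartialField.mul_ne_zero (coe_mem_elems (P.units.inv_mem hw)) (units_ne_zero hze _)
      (PartialField.mul_ne_zero (entry_mem_elems hA z u) hzu h.sub_ne_zero) h3

/-- A label that may join the line side only can always be exchanged into the configuration. Which
of `f`, `g`, `e` it replaces depends on the cross ratios in `K`. -/
theorem LineConfig.canExchange (hA : A.IsMatrixOver P) (hK : P.InvClosed K)
    (hB : LineBase K A₀ f₀ S) (h : LineConfig K A₀ f₀ S A f g e)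
    (ho : IsOutside S A f g e z) (hj : JoinsLine A₀ f₀ S A z) (hb : ¬ JoinsBase A f g e z) :
    CanExchange P K A₀ f₀ S A f g e z := by
  have hs := h.symm hA hK
  have hb' : ¬ JoinsBase A g f e z := fun h0 => hb h0.symm
  rcases mem_ground.1 ho.mem with hz | hz
  · obtain ⟨y0, hy0, hy0'⟩ := hB.exists_ne
    have hρP : A₀.entry f₀ y0 ∈ P.elems := by rw [← h.row_f y0 hy0]; exact entry_mem_elems hA _ _
    by_cases hzy : A.entry z y0 = 0
    -- the row `z` vanishes on `S`
    · refine h.canExchange_row' hA hz ho hb (fun y hy => ?_) hB.exists_ne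
      apply mul_left_cancel' hρP hy0'
      have := hj.2 hz y hy y0 hy0
      rw [hzy] at this
      linear_combination this
    · have hze : A.entry z e ≠ 0 := fun h0 =>
        hb ⟨fun hzc => absurd hzc (notMem_cols hz), fun _ => h0⟩
      -- the row `z` is a nonzero multiple of `f₀`: it cannot form lines over `K` with `f` as well
      -- as with `g`, because the ratio of `f` and `g` is outside `K`
      obtain ⟨u, hu, hu'⟩ := exists_unit (entry_mem_elems hA z y0) hzy
      obtain ⟨v, hv, hv'⟩ := exists_unit hρP hy0'
      have hc : u * v⁻¹ ∈ P.units := P.units.mul_mem hu (P.units.inv_mem hv)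
      have hcz : ∀ y ∈ S, A.entry z y = ((u * v⁻¹ : Rˣ) : R) * A₀.entry f₀ y := by
        intro y hy
        apply mul_left_cancel' hρP hy0'
        have h1 := hj.2 hz y hy y0 hy0
        have h2 : (v : R) * (v⁻¹ : Rˣ) = 1 := by simp
        rw [← hu', ← hv'] at h1
        rw [← hv', Units.val_mul]
        linear_combination h1 - u * A₀.entry f₀ y * h2
      set t := (((u * v⁻¹)⁻¹ : Rˣ) : R) * A.entry z e with ht
      have htP : t ∈ P.elems :=
        mul_mem_elems (coe_mem_elems (P.units.inv_mem hc)) (entry_mem_elems hA z e)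
      have ht0 : t ≠ 0 := PartialField.mul_ne_zero (coe_mem_elems (P.units.inv_mem hc))
        (units_ne_zero hze _) hze
      by_cases hf : NotMultiple K (A.entry f e) t
      · exact h.canExchange_row hA hz ho hb hc hcz hB.exists_ne hf
      · apply CanExchange.symm
        refine hs.canExchange_row hA hz ho.symm hb' hc hcz hB.exists_ne ⟨hs.ratio.1, ?_⟩
        intro k' hk' h1
        apply hf
        refine ⟨h.ratio.1, fun k hk h2 => ?_⟩
        rw [← ht] at h1
        refine h.ratio.false_of_mul_eq hK (p := k') (q := k) hk' hk ?_ ?_ ?_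
        · apply mem_elems_of_mul (entry_mem_elems hA g e) h.ratio.ne_zero
          rw [mul_comm, ← h1]; exact htP
        · rintro rfl
          exact ht0 (by rw [h1, zero_mul])
        · linear_combination h2 - h1
  · by_cases hg0 : A.entry g z = 0
    · exact (hs.canExchange_col' hA hK hB hz ho.symm hj hb' K.zero_mem (by rw [hg0, zero_mul])).symm
    · by_cases hk : ∃ k ∈ K, A.entry f z = k * A.entry g z
      · obtain ⟨k, hk, hkz⟩ := hk
        exact h.canExchange_col' hA hK hB hz ho hj hb hk hkz
      · push Not at hk
        exact h.canExchange_col hz ho hj hb (NotMultiple.symm hK (entry_mem_elems hA g z)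
          (entry_mem_elems hA f z) ⟨hg0, hk⟩)

/-- After an exchange, what remains of a blocking sequence is a blocking sequence, or a tail of it
starts with a label that may not join the side `S` any more. -/
theorem IsExchange.blocks {f' g' e' : α} (h : IsExchange A₀ f₀ S A f g e z A' f' g' e')
    (hg : ∀ t, t ∈ A'.ground ↔ t ∈ A.ground) (l : List α) :
    ∀ u, IsOutside S A f g e u → JoinsBase A f g e u → Blocks A₀ f₀ S A f g e u l →
      Blocks A₀ f₀ S A' f' g' e' u l ∨ ∃ u' l', l'.length ≤ l.length ∧
        IsOutside S A' f' g' e' u' ∧ ¬ JoinsBase A' f' g' e' u' ∧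
        Blocks A₀ f₀ S A' f' g' e' u' l' := by
  have hout : ∀ u, IsOutside S A f g e u → JoinsBase A f g e u → IsOutside S A' f' g' e' u := by
    intro u hu hub
    obtain ⟨h1, h2, h3, h4, h5⟩ := h.outside u hu hub
    exact ⟨(hg u).2 hu.mem, hu.notMem, h1, h2, h3⟩
  induction l with
  | nil =>
    intro u hu hub hl
    left
    obtain ⟨_, _, _, h4, h5⟩ := h.outside u hu hub
    intro hj
    apply hl
    constructor
    · intro huc x hx
      rw [← h.col_entry u huc hu hub x hx]
      exact hj.1 (h5.2 huc) x hx
    · intro hur y hy y' hy'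
      rw [← (h.row_entry u hur hu hub).1 y hy, ← (h.row_entry u hur hu hub).1 y' hy']
      exact hj.2 (h4.2 hur) y hy y' hy'
  | cons v l ih =>
    intro u hu hub hl
    obtain ⟨hv, hvb, hcon, hl⟩ := hl
    obtain ⟨_, _, _, h4, h5⟩ := h.outside v hv hvb
    obtain ⟨_, _, _, h6, h7⟩ := h.outside u hu hub
    rcases ih v hv hvb hl with hl' | ⟨u', l', h1, h2⟩
    swap
    · exact Or.inr ⟨u', l', h1.trans (Nat.le_succ _), h2⟩
    by_cases hzv : Conflict A₀ f₀ S A f z v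
    -- the sequence is cut at the last label in conflict with `z`
    · refine Or.inr ⟨v, l, Nat.le_succ _, hout v hv hvb, fun hj => ?_, hl'⟩
      rcases mem_ground.1 hv.mem with hvr | hvc
      · exact (h.row_e v hvr hv hvb).1 (hj.2 (h4.2 hvr)) hzv
      · exact h.col_ne v hvc hv hvb hzv (hj.1 (h5.2 hvc))
    · refine Or.inl ⟨hout v hv hvb, ⟨fun hvc => ?_, fun hvr => ?_⟩, ?_, hl'⟩
      · obtain ⟨h8, h9⟩ := h.col_fg v (h5.1 hvc) hv hvb hzv
        rw [h8, h9]
      · exact (h.row_e v (h4.1 hvr) hv hvb).2 hzv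
      · rcases hcon with ⟨hur, hvc, y, hy, h8⟩ | ⟨huc, hvr, h8⟩
        · refine Or.inl ⟨h6.2 hur, h5.2 hvc, y, hy, ?_⟩
          rwa [(h.row_entry u hur hu hub).1 y hy, (h.row_entry u hur hu hub).2 v hvc hv hvb,
            (h.col_fg v hvc hv hvb hzv).1]
        · refine Or.inr ⟨h7.2 huc, h4.2 hvr, ?_⟩
          rwa [(h.row_entry v hvr hv hvb).2 u huc hu hub]

/-- A blocking sequence for the 2-separation of a `LineConfig` yields a bad extension of a copy of
`A₀[S ∪ f₀]`, by induction on its length. -/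
theorem LineConfig.hasBadExt (hK : P.InvClosed K) (hB : LineBase K A₀ f₀ S) (n : ℕ) :
    ∀ (A : LabelledMatrix α R) (f g e z : α) (l : List α), l.length ≤ n → A.IsMatrixOver P →
      LineConfig K A₀ f₀ S A f g e → IsOutside S A f g e z → ¬ JoinsBase A f g e z →
      Blocks A₀ f₀ S A f g e z l → HasBadExt P K A₀ f₀ S A := by
  have finish : ∀ (A : LabelledMatrix α R) (f g e z : α), A.IsMatrixOver P →
      LineConfig K A₀ f₀ S A f g e → IsOutside S A f g e z → ¬ JoinsBase A f g e z →
      ¬ JoinsLine A₀ f₀ S A z → HasBadExt P K A₀ f₀ S A := by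
    intro A f g e z hA h ho hb hj
    rcases mem_ground.1 ho.mem with hz | hz
    · apply h.hasBadExt_of_row hA hK hB hz ho.notMem ho.ne_f ho.ne_g
      · by_contra h0
        push Not at h0
        exact hj ⟨fun hzc => absurd hzc (notMem_cols hz), fun _ => h0⟩
      · intro h0
        exact hb ⟨fun hzc => absurd hzc (notMem_cols hz), fun _ => h0⟩
    · apply h.hasBadExt_of_col hA hK hB hz ho.notMem ho.ne_e
      · by_contra h0
        push Not at h0
        exact hj ⟨fun _ => h0, fun hzr => absurd hz (notMem_cols hzr)⟩
      · intro h0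
        exact hb ⟨fun _ => h0, fun hzr => absurd hz (notMem_cols hzr)⟩
  induction n with
  | zero =>
    intro A f g e z l hl hA h ho hb hbl
    rw [Nat.le_zero, List.length_eq_zero_iff] at hl
    subst hl
    exact finish A f g e z hA h ho hb hbl
  | succ n ih =>
    intro A f g e z l hl hA h ho hb hbl
    by_cases hj : JoinsLine A₀ f₀ S A z
    swap
    · exact finish A f g e z hA h ho hb hj
    rcases l with _ | ⟨v, l⟩
    · exact absurd hj hbl
    obtain ⟨hv, hvb, hcon, hbl⟩ := hbl
    -- exchange `z` into the line: its successor may not join the side `S` any more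
    obtain ⟨A', f', g', e', hAA', h', hex⟩ := h.canExchange hA hK hB ho hj hb
    have hA' := hAA'.isMatrixOver hA
    have hl' : l.length ≤ n := by simpa using hl
    apply HasBadExt.of_pivotEquiv hAA'
    have hg : ∀ t, t ∈ A'.ground ↔ t ∈ A.ground := fun t => by rw [hAA'.ground_eq]
    rcases hex.blocks hg l v hv hvb hbl with hbl' | ⟨u', l', h1, h2, h3, h4⟩
    · obtain ⟨h1, h2, h3, h4, h5⟩ := hex.outside v hv hvb
      refine ih A' f' g' e' v l hl' hA' h' ⟨(hg v).2 hv.mem, hv.notMem, h1, h2, h3⟩ ?_ hbl'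
      intro hj
      rcases mem_ground.1 hv.mem with hvr | hvc
      · exact (hex.row_e v hvr hv hvb).1 (hj.2 (h4.2 hvr)) hcon
      · exact hex.col_ne v hvc hv hvb hcon (hj.1 (h5.2 hvc))
    · exact ih A' f' g' e' u' l' (h1.trans hl') hA' h' h2 h3 h4

/-- `A` has no 2-separation for which the block of the rows outside and the columns inside is zero
and the opposite block has rank at most one. -/
def NoTwoSep (A : LabelledMatrix α R) : Prop :=
  ∀ S : Set α, 2 ≤ (A.ground ∩ S).encard → 2 ≤ (A.ground \ S).encard →
    ¬ ((∀ x ∈ A.rows, x ∉ S → ∀ y ∈ A.cols, y ∈ S → A.entry x y = 0) ∧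
      ∀ x ∈ A.rows, x ∈ S → ∀ x' ∈ A.rows, x' ∈ S → ∀ y ∈ A.cols, y ∉ S → ∀ y' ∈ A.cols, y' ∉ S →
        A.entry x y * A.entry x' y' = A.entry x y' * A.entry x' y)

theorem NoTwoSep.transpose (h : NoTwoSep A) : NoTwoSep A.transpose := by
  rintro S h1 h2 ⟨h3, h4⟩
  rw [transpose_ground] at h1 h2
  refine h Sᶜ ?_ ?_ ⟨?_, ?_⟩
  · rwa [← Set.sdiff_eq]
  · rwa [sdiff_compl]
  · intro x hx hxS y hy hyS
    exact h3 y hy hyS x hx (by simpa using hxS)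
  · intro x hx hxS x' hx' hxS' y hy hyS y' hy' hyS'
    have := h4 y hy (by simpa using hyS) y' hy' (by simpa using hyS') x hx hxS x' hx' hxS'
    exact this.trans (mul_comm _ _)

/-- Without a 2-separation there is a blocking sequence: the labels from which no blocking sequence
leads on form, together with `f`, `g`, `e`, one side of a 2-separation. -/
theorem LineConfig.exists_blocks (hA : A.IsMatrixOver P) (hB : LineBase K A₀ f₀ S)
    (h : LineConfig K A₀ f₀ S A f g e) (hsep : NoTwoSep A) (hS : 2 ≤ (A.ground ∩ S).encard) :
    ∃ z l, IsOutside S A f g e z ∧ ¬ JoinsBase A f g e z ∧ Blocks A₀ f₀ S A f g e z l := by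
  by_contra hcon
  push Not at hcon
  -- `U` is the set of labels from which a blocking sequence leads on, and `L` is the line side
  let U : Set α := {z | ∃ l, Blocks A₀ f₀ S A f g e z l}
  have hU1 : ∀ z, IsOutside S A f g e z → z ∈ U → JoinsBase A f g e z := by
    rintro z hz ⟨l, hl⟩
    by_contra h0
    exact hcon z l hz h0 hl
  have hU2 : ∀ z, z ∉ U → JoinsLine A₀ f₀ S A z := by
    intro z hz
    by_contra h0
    exact hz ⟨[], h0⟩
  have hU3 : ∀ z z', IsOutside S A f g e z' → z ∉ U → z' ∈ U → ¬ Conflict A₀ f₀ S A f z z' := by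
    intro z z' hz' hz hz'U h0
    obtain ⟨l, hl⟩ := hz'U
    exact hz ⟨z' :: l, hz', hU1 z' hz' ⟨l, hl⟩, h0, hl⟩
  let L : Set α := {z | z = f ∨ z = g ∨ z = e ∨ (z ∉ S ∧ z ∉ U)}
  have hSL : ∀ z ∈ S, z ∉ L := by
    rintro z hz (rfl | rfl | rfl | h0)
    · exact h.f_notMem hz
    · exact h.g_notMem hz
    · exact h.e_notMem hz
    · exact h0.1 hz
  -- the labels on either side of the separation
  have hin : ∀ z ∈ A.ground, z ∈ L → z = f ∨ z = g ∨ z = e ∨ (IsOutside S A f g e z ∧ z ∉ U) := by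
    intro z hz hzL
    by_cases h1 : z = f
    · exact Or.inl h1
    by_cases h2 : z = g
    · exact Or.inr (Or.inl h2)
    by_cases h3 : z = e
    · exact Or.inr (Or.inr (Or.inl h3))
    have h4 : z ∉ S ∧ z ∉ U := by
      rcases hzL with h4 | h4 | h4 | h4
      · exact absurd h4 h1
      · exact absurd h4 h2
      · exact absurd h4 h3
      · exact h4
    exact Or.inr (Or.inr (Or.inr ⟨⟨hz, h4.1, h1, h2, h3⟩, h4.2⟩))
  have hnot : ∀ z ∈ A.ground, z ∉ L → z ∈ S ∨ (IsOutside S A f g e z ∧ z ∈ U) := by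
    intro z hz hzL
    by_cases hzS : z ∈ S
    · exact Or.inl hzS
    right
    have h1 : z ≠ f := fun h0 => hzL (Or.inl h0)
    have h2 : z ≠ g := fun h0 => hzL (Or.inr (Or.inl h0))
    have h3 : z ≠ e := fun h0 => hzL (Or.inr (Or.inr (Or.inl h0)))
    refine ⟨⟨hz, hzS, h1, h2, h3⟩, ?_⟩
    by_contra h4
    exact hzL (Or.inr (Or.inr (Or.inr ⟨hzS, h4⟩)))
  obtain ⟨y0, hy0, hy0'⟩ := hB.exists_ne
  have hρP : A₀.entry f₀ y0 ∈ P.elems := by rw [← h.row_f y0 hy0]; exact entry_mem_elems hA _ _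
  -- the rows on the line side are multiples of the row `f`
  have hrank : ∀ x ∈ A.rows, x ∈ L → ∀ y ∈ A.cols, y ∉ L →
      A₀.entry f₀ y0 * A.entry x y = A.entry x y0 * A.entry f y := by
    intro x hx hxL y hy hyL
    have hy' := hnot y (mem_ground.2 (Or.inr hy)) hyL
    rcases hin x (mem_ground.2 (Or.inl hx)) hxL with rfl | rfl | rfl | ⟨hxo, hxU⟩
    · rw [h.row_f y0 hy0]
    · rw [h.row_g y0 hy0]
      rcases hy' with hyS | ⟨hyo, hyU⟩
      · rw [h.row_g y hyS, h.row_f y hyS]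
      · rw [(hU1 y hyo hyU).1 hy]
    · exact absurd hx (notMem_rows h.e_mem)
    · rcases hy' with hyS | ⟨hyo, hyU⟩
      · have := (hU2 x hxU).2 hx y hyS y0 hy0
        rw [h.row_f y hyS]
        linear_combination this
      · have := hU3 x y hyo hxU hyU
        by_contra h0
        exact this (Or.inl ⟨hx, hy, y0, hy0, fun h1 => h0 (by linear_combination h1)⟩)
  refine hsep L ?_ ?_ ⟨?_, ?_⟩
  · calc (2 : ℕ∞) = ({f, g} : Set α).encard := (Set.encard_pair h.f_ne_g).symm
      _ ≤ _ := by
        apply Set.encard_le_encard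
        rintro t (rfl | rfl)
        · exact ⟨mem_ground.2 (Or.inl h.f_mem), Or.inl rfl⟩
        · exact ⟨mem_ground.2 (Or.inl h.g_mem), Or.inr (Or.inl rfl)⟩
  · exact hS.trans (Set.encard_le_encard fun t ht => ⟨ht.1, hSL t ht.2⟩)
  · intro x hx hxL y hy hyL
    have hx' := hnot x (mem_ground.2 (Or.inl hx)) hxL
    rcases hin y (mem_ground.2 (Or.inr hy)) hyL with rfl | rfl | rfl | ⟨hyo, hyU⟩
    · exact absurd hy (notMem_cols h.f_mem)
    · exact absurd hy (notMem_cols h.g_mem)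
    · rcases hx' with hxS | ⟨hxo, hxU⟩
      · exact h.col_e x hxS
      · exact (hU1 x hxo hxU).2 hx
    · rcases hx' with hxS | ⟨hxo, hxU⟩
      · exact (hU2 y hyU).1 hy x hxS
      · by_contra h0
        exact hU3 y x hxo hyU hxU (Or.inr ⟨hy, hx, h0⟩)
  · intro x hx hxL x' hx' hxL' y hy hyL y' hy' hyL'
    have h1 := hrank x hx hxL y hy hyL
    have h2 := hrank x hx hxL y' hy' hyL'
    have h3 := hrank x' hx' hxL' y hy hyL
    have h4 := hrank x' hx' hxL' y' hy' hyL'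
    apply mul_left_cancel' hρP hy0'
    apply mul_left_cancel' hρP hy0'
    -- times the square of `f₀y₀`, both products are the product of the entries `xy₀`, `x'y₀`, `fy`,
    -- `fy'`
    linear_combination (A₀.entry f₀ y0 * A.entry x' y') * h1 +
      (A.entry x y0 * A.entry f y) * h4 - (A₀.entry f₀ y0 * A.entry x' y) * h2 -
      (A.entry x y0 * A.entry f y') * h3

end LabelledMatrix

/-! ### Bad extensions by at most two labels -/

namespace LabelledMatrix

variable {α R : Type*} [CommRing R] {P : PartialField R} {K : Subring R}
variable {A : LabelledMatrix α R} {S : Set α}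

/-- Rows `f`, `g` that are linearly independent on `S`: pivoting over `fe` turns the row `g` into
one that cannot be scaled into `K`. -/
theorem badOne_of_not_parallel (hA : A.IsMatrixOver P) (hK : P.InvClosed K) (hS : Conn A S)
    {f g e y y' : α} (hf : f ∈ A.rows) (hg : g ∈ A.rows) (he : e ∈ A.cols) (hfg : f ≠ g)
    (hfS : f ∉ S) (hgS : g ∉ S) (heS : e ∉ S) (hfK : EntriesIn K A (insert f S))
    (hgK : EntriesIn K A (insert g S)) (he0 : ∀ x ∈ S, A.entry x e = 0)
    (hnm : NotMultiple K (A.entry f e) (A.entry g e)) (hy : y ∈ S) (hy' : y' ∈ S)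
    (h : A.entry f y * A.entry g y' ≠ A.entry f y' * A.entry g y) :
    ∃ A', PivotEquiv P A A' ∧ AgreeOn A A' S ∧ BadOne P K A' S := by
  have hag : AgreeOn A (A.pivot f e hf he) S := agreeOn_pivot hfS heS (Or.inl he0)
  have hgr : g ∈ (A.pivot f e hf he).rows := mem_pivot_rows.2 (Or.inr ⟨hg, hfg.symm⟩)
  have hge : g ≠ e := row_ne_col hg he
  refine ⟨A.pivot f e hf he, pivotEquiv_pivot hnm.1, hag, g, mem_ground.2 (Or.inl hgr), hgS, ?_⟩
  intro hsc
  obtain ⟨t, ht, htK⟩ := exists_row_scale (isMatrixOver_pivot hA hnm.1) hK (hag.conn hS)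
    (hag.entriesIn (hfK.mono (Set.subset_insert _ _))) hsc
  have hent : ∀ z ∈ S, (A.pivot f e hf he).entry g z =
      A.entry g z - Ring.inverse (A.entry f e) * A.entry g e * A.entry f z := by
    intro z hz
    exact pivot_entry hfg.symm hge (ne_of_mem_of_not_mem hz hfS) (ne_of_mem_of_not_mem hz heS)
  have h0 : (t : R) ≠ 0 := units_ne_zero hnm.1 t
  have h1 := htK y hy
  have h2 := htK y' hy'
  rw [hent y hy, mul_comm] at h1
  rw [hent y' hy', mul_comm] at h2
  -- the pivot subtracts `τ f` from `g`, where `τ` is the ratio of the entries in the column `e`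
  have hτ := mem_of_sub_mul_mem hK (hfK f (by simp) y (by simp [hy]))
    (hfK f (by simp) y' (by simp [hy'])) (hgK g (by simp) y (by simp [hy]))
    (hgK g (by simp) y' (by simp [hy'])) (det_two_mem_elems hA f g y y') (sub_ne_zero.2 h)
    (coe_mem_elems ht) h0 h1 h2
  refine hnm.2 _ hτ ?_
  linear_combination (-A.entry g e) * inverse_mul_entry hA hnm.1

/-- The configuration `BadThree` can be avoided if there are no 2-separations. If its rows `f`, `g`
are parallel on `S` they form a line attached to `A[S ∪ f]`; a blocking sequence yields two labels
that make `A[S]` bad, and the one that copies `f` is superfluous or part of a `BadTwo`. -/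
theorem badOne_or_badTwo_of_badThree (hA : A.IsMatrixOver P) (hK : P.InvClosed K)
    (hsep : ∀ A', PivotEquiv P A A' → NoTwoSep A') (hcard : 2 ≤ (A.ground ∩ S).encard)
    (hS : Conn A S) (h : BadThree K A S) :
    ∃ A', PivotEquiv P A A' ∧ AgreeOn A A' S ∧ (BadOne P K A' S ∨ BadTwo K A' S) := by
  obtain ⟨f, hf, g, hg, e, he, hfg, hfS, hgS, heS, hfd, hgd, hfK, hgK, he0, hnm⟩ := h
  by_cases hpar : ∃ y ∈ S, ∃ y' ∈ S, A.entry f y * A.entry g y' ≠ A.entry f y' * A.entry g y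
  · obtain ⟨y, hy, y', hy', h0⟩ := hpar
    obtain ⟨A', h1, h2, h3⟩ := badOne_of_not_parallel hA hK hS hf hg he hfg hfS hgS heS hfK hgK he0
      hnm hy hy' h0
    exact ⟨A', h1, h2, Or.inl h3⟩
  push Not at hpar
  -- scale the row `g` such that the rows `f` and `g` agree on `S`
  obtain ⟨y, hy, hfy⟩ := hfd
  obtain ⟨y', hy', hgy'⟩ := hgd
  have hgy : A.entry g y ≠ 0 := by
    intro h0
    have := hpar y hy y' hy'
    rw [h0, mul_zero] at this
    exact mul_ne_zero (entry_mem_elems hA f y) hfy hgy' this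
  obtain ⟨a, ha, ha'⟩ := exists_unit (entry_mem_elems hA f y) hfy
  obtain ⟨b, hb, hb'⟩ := exists_unit (entry_mem_elems hA g y) hgy
  have haK : (a : R) ∈ K := ha' ▸ hfK f (by simp) y (by simp [hy])
  have hbK : (b : R) ∈ K := hb' ▸ hgK g (by simp) y (by simp [hy])
  have hu : a * b⁻¹ ∈ subgroupIn hK :=
    (subgroupIn hK).mul_mem ⟨ha, haK⟩ ((subgroupIn hK).inv_mem ⟨hb, hbK⟩)
  set u := a * b⁻¹ with hu'
  have hub : (u : R) * b = a := by rw [hu']; simp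
  have hAB : PivotEquiv P A (A.scaleAt g u) := pivotEquiv_scaleAt hu.1
  have hne : ∀ z ∈ S, z ≠ g := fun z hz => ne_of_mem_of_not_mem hz hgS
  have heg : e ≠ g := (row_ne_col hg he).symm
  have hline : LineConfig K A f S (A.scaleAt g u) f g e := by
    refine ⟨agreeOn_scaleAt hgS, hf, hg, he, hfg, hfS, hgS, heS, fun z hz => ?_, fun z hz => ?_,
      fun z hz => ?_, ?_⟩
    · rw [scaleAt_entry hfg (hne z hz)]
    · rw [scaleAt_entry_left (hne z hz)]
      have := hpar y hy z hz
      rw [← ha', ← hb', ← hub] at this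
      have h2 : (b : R) * (u * A.entry g z) = b * A.entry f z := by linear_combination this
      exact (Units.mul_right_inj b).1 h2
    · rw [scaleAt_entry (hne z hz) heg, he0 z hz]
    · rw [scaleAt_entry hfg heg, scaleAt_entry_left heg]
      refine ⟨hnm.1, fun k hk h0 => hnm.2 _ (K.mul_mem (hK u hu.1 hu.2) hk) ?_⟩
      rw [mul_assoc, ← h0, ← mul_assoc, Units.inv_mul, one_mul]
  have hbase : LineBase K A f S := ⟨hf, hfS, conn_insert_row hS hf ⟨y, hy, hfy⟩, hfK, y, hy, hfy⟩
  have hB := hAB.isMatrixOver hA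
  obtain ⟨z, l, h1, h2, h3⟩ := hline.exists_blocks hB hbase (hsep _ hAB)
    (by rw [hAB.ground_eq]; exact hcard)
  obtain ⟨A', f', z, h4, h5, h6, h7, h8, h9, h10, h11, h12⟩ :=
    LineConfig.hasBadExt hK hbase l.length _ f g e z l le_rfl hB hline h1 h2 h3
  have hA' := h4.isMatrixOver hB
  -- drop the row that is the copy of `f`
  obtain ⟨A'', h13, h14, h15⟩ := badOne_or_badTwo_of_insert hA' hK (h5.conn hS) h6 h7
    ⟨y, hy, by rwa [h8 y hy]⟩ (LineConfig.entriesIn hbase h5 h6 h8) h9 h10 h11 h12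
  exact ⟨A'', hAB.trans (h4.trans h13), h5.trans h14, h15⟩

theorem transpose_transpose : A.transpose.transpose = A := rfl

/-- If `A` has no 2-separation and cannot be scaled into `K` then, up to pivots that fix `A[S]`, one
or two further labels suffice to see this. -/
theorem exists_badOne_or_badTwo (hA : A.IsMatrixOver P) (hK : P.InvClosed K)
    (hsep : ∀ A', PivotEquiv P A A' → NoTwoSep A') (hconn : Conn A Set.univ)
    (hbad : ¬ ScalesInto P K A Set.univ) (hcard : 2 ≤ (A.ground ∩ S).encard)
    (hS : Conn A S) (hSK : EntriesIn K A S) :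
    ∃ A', PivotEquiv P A A' ∧ AgreeOn A A' S ∧ (BadOne P K A' S ∨ BadTwo K A' S) := by
  obtain ⟨z, hz⟩ : (A.ground ∩ S).Nonempty := by
    rw [← Set.encard_pos]
    exact lt_of_lt_of_le (by norm_num) hcard
  obtain ⟨A', h1, h2, h3⟩ := exists_badExt hK _ A S rfl hA hconn hbad ⟨z, hz⟩ hS hSK
  have hA' := h1.isMatrixOver hA
  have hcard' : 2 ≤ (A'.ground ∩ S).encard := by rwa [h1.ground_eq]
  have hsep' : ∀ B, PivotEquiv P A' B → NoTwoSep B := fun B hB => hsep B (h1.trans hB)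
  rcases h3 with h3 | h3 | h3 | h3
  · exact ⟨A', h1, h2, Or.inl h3⟩
  · exact ⟨A', h1, h2, Or.inr h3⟩
  · obtain ⟨B, h4, h5, h6⟩ := badOne_or_badTwo_of_badThree hA' hK hsep' hcard' (h2.conn hS) h3
    exact ⟨B, h1.trans h4, h2.trans h5, h6⟩
  · obtain ⟨B, h4, h5, h6⟩ := badOne_or_badTwo_of_badThree (isMatrixOver_transpose hA') hK
      (fun B hB => (hsep' _ hB.transpose).transpose) (by rwa [transpose_ground])
      (h2.conn hS).transpose h3
    exact ⟨B.transpose, h1.trans h4.transpose, h2.trans h5.transpose,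
      h6.imp BadOne.transpose BadTwo.transpose⟩

end LabelledMatrix

/-! ### Determinants and the represented matroid -/

namespace LabelledMatrix

variable {α R : Type*} [CommRing R] {P : PartialField R}
variable {A A' : LabelledMatrix α R} {B S : Set α} {M M' : Matroid α}

open Classical in
/-- The columns of `[I A]` labelled by `B` form a nonsingular square matrix. -/
def Nonsing (A : LabelledMatrix α R) (B : Set α) : Prop :=
  ∃ f : A.rows ≃ B, (Matrix.of fun i j : A.rows => A.augEntry i (f j)).det ≠ 0

theorem represents_iff : A.Represents M ↔
    M.E = A.ground ∧ ∀ B, M.IsBase B ↔ B ⊆ A.ground ∧ A.Nonsing B := Iff.rfl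

/-- Whether a determinant vanishes does not depend on the ordering of its rows and columns. -/
theorem nonsing_iff {ι : Type*} [Fintype ι] [DecidableEq ι] (e : ι ≃ A.rows) (w : ι ≃ B) :
    A.Nonsing B ↔ (Matrix.of fun i j => A.augEntry (e i) (w j)).det ≠ 0 := by
  classical
  have key : ∀ f : A.rows ≃ B, ((Matrix.of fun i j : A.rows => A.augEntry i (f j)).det ≠ 0 ↔
      (Matrix.of fun i j => A.augEntry (e i) (w j)).det ≠ 0) := by
    intro f
    have h1 := Matrix.det_submatrix_equiv_self e (Matrix.of fun i j : A.rows => A.augEntry i (f j))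
    have h2 := Matrix.det_permute' (e.trans (f.trans w.symm))
      (Matrix.of fun i j => A.augEntry (e i) (w j))
    have h3 : (Matrix.of fun i j => A.augEntry (e i) (w j)).submatrix id
        (e.trans (f.trans w.symm)) =
        (Matrix.of fun i j : A.rows => A.augEntry i (f j)).submatrix e e := by
      ext i j
      simp
    rw [h3, h1] at h2
    rw [h2]
    rcases Int.units_eq_one_or (Equiv.Perm.sign (e.trans (f.trans w.symm))) with h | h <;> simp [h]
  constructor
  · rintro ⟨f, hf⟩
    refine (key f).1 ?_
    convert hf
  · intro h
    refine ⟨e.symm.trans w, ?_⟩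
    have := (key (e.symm.trans w)).2 h
    convert this

theorem Nonsing.nontrivial (h : A.Nonsing B) : Nontrivial R := by
  obtain ⟨f, hf⟩ := h
  exact ⟨_, _, hf⟩

theorem Represents.nontrivial (h : A.Represents M) : Nontrivial R := by
  obtain ⟨B, hB⟩ := M.exists_isBase
  exact ((represents_iff.1 h).2 B |>.1 hB).2.nontrivial

theorem nonsing_rows [Nontrivial R] : A.Nonsing A.rows := by
  classical
  refine (nonsing_iff (Equiv.refl A.rows) (Equiv.refl A.rows)).2 ?_
  have : (Matrix.of fun i j : A.rows => A.augEntry i j) = 1 := by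
    ext i j
    rw [Matrix.of_apply, augEntry, if_pos j.2, Matrix.one_apply]
    exact if_congr Subtype.ext_iff.symm rfl rfl
  change (Matrix.of fun i j : A.rows => A.augEntry i j).det ≠ 0
  rw [this, Matrix.det_one]
  exact one_ne_zero

/-- Some term of the expansion of a nonzero determinant is nonzero. -/
theorem Nonsing.exists_transversal (h : A.Nonsing B) :
    ∃ f : A.rows ≃ B, ∀ i : A.rows, A.augEntry i (f i) ≠ 0 := by
  classical
  obtain ⟨f, hf⟩ := h
  rw [Matrix.det_apply] at hf
  obtain ⟨σ, _, hσ⟩ := Finset.exists_ne_zero_of_sum_ne_zero hf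
  refine ⟨σ.symm.trans f, fun i h0 => hσ ?_⟩
  rw [Finset.prod_eq_zero (Finset.mem_univ (σ.symm i)), smul_zero]
  simpa using h0

/-- Pivoting preserves the sets of nonsingular columns of `[I A]`. -/
theorem nonsing_pivot {x y : α} {hx : x ∈ A.rows} {hy : y ∈ A.cols} (hA : A.IsMatrixOver P)
    (h0 : A.entry x y ≠ 0) : (A.pivot x y hx hy).Nonsing B ↔ A.Nonsing B := by
  classical
  have h := inverse_mul_entry hA h0
  have hyx : y ≠ x := (row_ne_col hx hy).symm
  -- the row `x` of `A` corresponds to the row `y` of its pivot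
  let e : A.rows ≃ (A.pivot x y hx hy).rows :=
    { toFun := fun i => ⟨if (i : α) = x then y else i, by
        rw [mem_pivot_rows]; split_ifs with hi
        · exact Or.inl rfl
        · exact Or.inr ⟨i.2, hi⟩⟩
      invFun := fun i => ⟨if (i : α) = y then x else i, by
        split_ifs with hi
        · exact hx
        · rcases mem_pivot_rows.1 i.2 with h | h
          · exact absurd h hi
          · exact h.1⟩
      left_inv := by
        intro i
        apply Subtype.ext
        by_cases hi : (i : α) = x
        · simp [hi]
        · have : (i : α) ≠ y := row_ne_col i.2 hy
          simp [hi, this]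
      right_inv := by
        intro i
        apply Subtype.ext
        by_cases hi : (i : α) = y
        · simp [hi]
        · have : (i : α) ≠ x := by
            rintro h
            rcases mem_pivot_rows.1 i.2 with h' | h'
            · exact hi h'
            · exact h'.2 h
          simp [hi, this] }
  have hdet : ∀ w : A.rows ≃ B,
      ((Matrix.of fun i j => (A.pivot x y hx hy).augEntry (e i) (w j)).det ≠ 0 ↔
        (Matrix.of fun i j : A.rows => A.augEntry i (w j)).det ≠ 0) := by
    intro w
    have h1 := det_pivot_augEntry (hx := hx) (hy := hy) h (fun i => (e i : α)) (fun i => (w i : α))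
      (fun i => (e i).2) ⟨x, hx⟩ (by simp [e]) (by
        intro i hi
        apply Subtype.ext
        by_contra hix
        simp only [e, Equiv.coe_fn_mk, hix, if_false] at hi
        exact row_ne_col i.2 hy hi)
    have h2 : (Matrix.of fun i j : A.rows =>
        A.augEntry (if i = ⟨x, hx⟩ then x else (e i : α)) (w j)) =
        Matrix.of fun i j : A.rows => A.augEntry i (w j) := by
      ext i j
      by_cases hi : (i : α) = x
      · have : i = ⟨x, hx⟩ := Subtype.ext hi
        simp [this]
      · have : i ≠ ⟨x, hx⟩ := fun h => hi (by rw [h])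
        simp [e, hi, this]
    rw [h1, h2]
    obtain ⟨u, _, hu⟩ := exists_unit (entry_mem_elems hA x y) h0
    rw [← hu, Ring.inverse_unit, ne_eq, Units.mul_right_eq_zero]
  constructor
  · rintro ⟨f, hf⟩
    have := (nonsing_iff e (e.trans f)).1 ⟨f, hf⟩
    exact (nonsing_iff (Equiv.refl _) (e.trans f)).2 ((hdet _).1 this)
  · rintro ⟨f, hf⟩
    have := (nonsing_iff (Equiv.refl _) f).1 ⟨f, hf⟩
    exact (nonsing_iff e f).2 ((hdet _).2 this)

theorem nonsing_scale {r c : α → Rˣ} : (A.scale r c).Nonsing B ↔ A.Nonsing B := by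
  classical
  have hdet : ∀ w : A.rows ≃ B,
      ((Matrix.of fun i j : A.rows => (A.scale r c).augEntry i (w j)).det ≠ 0 ↔
        (Matrix.of fun i j : A.rows => A.augEntry i (w j)).det ≠ 0) := by
    intro w
    let c' : α → Rˣ := fun z => if z ∈ A.rows then (r z)⁻¹ else c z
    have : (Matrix.of fun i j : A.rows => (A.scale r c).augEntry i (w j)).det =
        ((∏ i : A.rows, c' (w i) : Rˣ) : R) * (((∏ i : A.rows, r i : Rˣ) : R) *
          (Matrix.of fun i j : A.rows => A.augEntry i (w j)).det) := by
      rw [Units.coe_prod, Units.coe_prod, ← Matrix.det_mul_column, ← Matrix.det_mul_row]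
      congr 1
      ext i j
      have hr : (A.scale r c).rows = A.rows := rfl
      simp only [Matrix.of_apply, augEntry, hr, c']
      by_cases h : (w j : α) ∈ A.rows
      · by_cases h' : (i : α) = w j
        · simp [h, h']
        · simp [h, h']
      · simp [h, scale]; ring
    rw [this, ne_eq, Units.mul_right_eq_zero, Units.mul_right_eq_zero]
  constructor
  · rintro ⟨f, hf⟩
    have := (nonsing_iff (A := A.scale r c) (Equiv.refl _) f).1 ⟨f, hf⟩
    exact (nonsing_iff (Equiv.refl A.rows) f).2 ((hdet f).1 this)
  · rintro ⟨f, hf⟩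
    have := (nonsing_iff (Equiv.refl _) f).1 ⟨f, hf⟩
    exact (nonsing_iff (A := A.scale r c) (Equiv.refl _) f).2 ((hdet f).2 this)

theorem PivotEquiv.nonsing (h : PivotEquiv P A A') (hA : A.IsMatrixOver P) :
    A'.Nonsing B ↔ A.Nonsing B := by
  induction h with
  | refl => rfl
  | tail hs h ih =>
    rw [← ih]
    cases h with
    | scale r c hr hc => exact nonsing_scale
    | pivot x y hx hy h => exact nonsing_pivot (PivotEquiv.isMatrixOver hs hA) h

theorem PivotEquiv.represents (h : PivotEquiv P A A') (hA : A.IsMatrixOver P)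
    (hM : A.Represents M) : A'.Represents M := by
  rw [represents_iff] at hM ⊢
  rw [h.ground_eq]
  exact ⟨hM.1, fun B => by rw [hM.2, h.nonsing hA]⟩

theorem Represents.unique (h : A.Represents M) (h' : A.Represents M') : M = M' :=
  Matroid.ext_isBase (h.1.trans h'.1.symm) fun B _ => (h.2 B).trans (h'.2 B).symm

theorem Represents.ground_eq (h : A.Represents M) : M.E = A.ground := h.1

theorem Represents.isBase_rows (h : A.Represents M) : M.IsBase A.rows := by
  have := h.nontrivial
  exact (h.2 _).2 ⟨Set.subset_union_left, nonsing_rows⟩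

/-- The bases are the row sets of the matrices that arise by pivoting. -/
theorem Nonsing.exists_pivotEquiv (hA : A.IsMatrixOver P) (hB : B ⊆ A.ground) (h : A.Nonsing B) :
    ∃ A', PivotEquiv P A A' ∧ (A'.rows : Set α) = B := by
  obtain ⟨n, hn⟩ : ∃ n, (B \ A.rows).ncard = n := ⟨_, rfl⟩
  induction n generalizing A with
  | zero =>
    refine ⟨A, PivotEquiv.refl A, ?_⟩
    have hBf : B.Finite := A.ground_finite.subset hB
    rw [Set.ncard_eq_zero (hBf.subset Set.sdiff_subset), Set.sdiff_eq_empty] at hn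
    obtain ⟨f, _⟩ := h
    have hc := Nat.card_congr f
    refine (Set.eq_of_subset_of_ncard_le hn ?_ A.rows.finite_toSet).symm
    exact le_of_eq hc
  | succ n ih =>
    have hBf : B.Finite := A.ground_finite.subset hB
    obtain ⟨y, hyB, hyr⟩ : (B \ A.rows).Nonempty := by
      rw [← Set.ncard_pos (hBf.subset Set.sdiff_subset)]; omega
    have hyc : y ∈ A.cols := (mem_ground.1 (hB hyB)).resolve_left hyr
    -- the column `y` is nonzero outside `B`, for otherwise there is no transversal
    obtain ⟨x, hx, hxB, hxy⟩ : ∃ x ∈ A.rows, x ∉ B ∧ A.entry x y ≠ 0 := by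
      by_contra hcon
      push Not at hcon
      obtain ⟨f, hf⟩ := h.exists_transversal
      have hfr : ∀ i : A.rows, (f i : α) ∈ A.rows → (f i : α) = i := by
        intro i hi
        by_contra h0
        exact hf i (augEntry_row hi (Ne.symm h0))
      obtain ⟨x, hx⟩ := f.surjective ⟨y, hyB⟩
      have hxB : (x : α) ∈ B := by
        by_contra h0
        apply hf x
        rw [hx, augEntry_of_notMem hyr, hcon x x.2 h0]
      obtain ⟨t, ht⟩ := f.surjective ⟨x, hxB⟩
      have h1 := hfr t (by rw [ht]; exact x.2)
      rw [ht] at h1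
      have h2 : t = x := Subtype.ext h1.symm
      rw [h2, hx] at ht
      have h3 : y = x := congrArg Subtype.val ht
      exact hyr (h3 ▸ x.2)
    obtain ⟨A', h1, h2⟩ := ih (isMatrixOver_pivot (hx := hx) (hy := hyc) hA hxy)
      (by rwa [pivot_ground]) ((nonsing_pivot hA hxy).2 h) (by
        have : B \ (A.pivot x y hx hyc).rows = (B \ A.rows) \ {y} := by
          ext z
          simp only [Set.mem_sdiff, Finset.mem_coe, mem_pivot_rows, Set.mem_singleton_iff]
          have : z ∈ B → z ≠ x := fun hz => ne_of_mem_of_not_mem hz hxB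
          tauto
        rw [this, Set.ncard_sdiff_singleton_of_mem (by exact ⟨hyB, hyr⟩), hn]
        rfl)
    exact ⟨A', (pivotEquiv_pivot hxy).trans h1, h2⟩

theorem cols_eq (A : LabelledMatrix α R) : (A.cols : Set α) = A.ground \ A.rows := by
  ext z
  simp only [Finset.mem_coe, Set.mem_sdiff, mem_ground]
  have : z ∈ A.cols → z ∉ A.rows := notMem_rows
  tauto

/-- The transposed matrix represents the dual matroid. -/
theorem Represents.dual (hA : A.IsMatrixOver P) (h : A.Represents M) :
    A.transpose.Represents M✶ := by
  have := h.nontrivial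
  rw [represents_iff, transpose_ground]
  have hE : M.E = A.ground := h.1
  refine ⟨hE, fun B => ?_⟩
  -- make the base the set of rows; then its complement is the set of rows of the transposed matrix
  have key : ∀ (C : LabelledMatrix α R) (B : Set α), C.IsMatrixOver P → B ⊆ C.ground →
      C.Nonsing B → C.transpose.Nonsing (C.ground \ B) := by
    intro C B hC hB h
    obtain ⟨C', h1, rfl⟩ := h.exists_pivotEquiv hC hB
    rw [← h1.transpose.nonsing (isMatrixOver_transpose hC), ← h1.ground_eq, ← cols_eq]
    exact nonsing_rows (A := C'.transpose)
  rw [Matroid.dual_isBase_iff', hE, (represents_iff.1 h).2]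
  constructor
  · rintro ⟨⟨h1, h2⟩, h3⟩
    refine ⟨h3, ?_⟩
    have := key A _ hA h1 h2
    rwa [Set.sdiff_sdiff_cancel_left h3] at this
  · rintro ⟨h1, h2⟩
    refine ⟨⟨Set.sdiff_subset, ?_⟩, h1⟩
    have := key A.transpose B (isMatrixOver_transpose hA) (by rwa [transpose_ground]) h2
    rwa [transpose_ground, transpose_transpose] at this

/-! ### Submatrices represent minors -/

theorem Represents.delete (h : A.Represents M) {y : α} (hy : y ∈ A.cols) :
    (A.restrict {y}ᶜ).Represents (M.delete {y}) := by
  classical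
  have hE : M.E = A.ground := h.1
  have hrows : ∀ z, z ∈ (A.restrict {y}ᶜ).rows ↔ z ∈ A.rows := by
    intro z
    rw [mem_restrict_rows]
    exact ⟨fun h => h.1, fun hz => ⟨hz, row_ne_col hz hy⟩⟩
  rw [represents_iff]
  refine ⟨by rw [Matroid.delete_ground, hE, restrict_ground]; rfl, fun B => ?_⟩
  -- the rows form a base that avoids `y`, so that the bases of `M \ y` are the bases that avoid `y`
  have hco : M.Coindep {y} := by
    rw [Matroid.coindep_iff_exists (by simp [hE, mem_ground, hy])]
    refine ⟨_, h.isBase_rows, fun z hz => ⟨?_, row_ne_col hz hy⟩⟩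
    rw [hE]; exact mem_ground.2 (Or.inl hz)
  rw [hco.delete_isBase_iff, (represents_iff.1 h).2, Set.disjoint_singleton_right, restrict_ground,
    Set.subset_inter_iff, Set.subset_compl_singleton_iff]
  have key : y ∉ B → (A.Nonsing B ↔ (A.restrict {y}ᶜ).Nonsing B) := by
    intro hyB
    let e : (A.restrict {y}ᶜ).rows ≃ A.rows := Equiv.subtypeEquivRight hrows
    have hdet : ∀ w : A.rows ≃ B, (Matrix.of fun i j => (A.restrict {y}ᶜ).augEntry (e.symm i) (w j))
        = Matrix.of fun i j : A.rows => A.augEntry i (w j) := by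
      intro w
      ext i j
      have h1 : (w j : α) ≠ y := fun h => hyB (h ▸ (w j).2)
      have h2 : (e.symm i : α) = i := rfl
      simp only [Matrix.of_apply, augEntry, hrows, h2]
      rw [restrict_entry (row_ne_col i.2 hy) h1]
    constructor
    · rintro ⟨f, hf⟩
      have : A.Nonsing B := ⟨f, hf⟩
      rw [nonsing_iff (Equiv.refl _) f] at this
      rw [nonsing_iff e.symm f, hdet]
      exact this
    · rintro ⟨f, hf⟩
      have : (A.restrict {y}ᶜ).Nonsing B := ⟨f, hf⟩
      rw [nonsing_iff e.symm (e.symm.trans f), hdet] at this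
      rw [nonsing_iff (Equiv.refl _) (e.symm.trans f)]
      exact this
  constructor
  · rintro ⟨⟨h1, h2⟩, h3⟩
    exact ⟨⟨h1, h3⟩, (key h3).1 h2⟩
  · rintro ⟨⟨h1, h3⟩, h2⟩
    exact ⟨⟨h1, (key h3).2 h2⟩, h3⟩

theorem restrict_transpose : A.transpose.restrict S = (A.restrict S).transpose := by
  refine ext' rfl rfl fun x y => ?_
  by_cases hx : x ∈ S <;> by_cases hy : y ∈ S <;> simp [restrict, transpose, hx, hy]

/-- Contracting a row label is deleting it in the dual. -/
theorem Represents.contract (hA : A.IsMatrixOver P) (h : A.Represents M) {x : α}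
    (hx : x ∈ A.rows) : (A.restrict {x}ᶜ).Represents (M.contract {x}) := by
  have h1 := (h.dual hA).delete (y := x) hx
  rw [restrict_transpose] at h1
  have h2 := h1.dual (isMatrixOver_transpose (isMatrixOver_restrict hA _))
  rwa [transpose_transpose, Matroid.dual_delete, Matroid.dual_dual] at h2

theorem Represents.exists_minor (hA : A.IsMatrixOver P) (h : A.Represents M) (S : Set α) :
    ∃ M', (A.restrict S).Represents M' ∧ M'.IsMinor M := by
  obtain ⟨n, hn⟩ : ∃ n, (A.ground \ S).ncard = n := ⟨_, rfl⟩
  induction n generalizing A M with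
  | zero =>
    rw [Set.ncard_eq_zero (A.ground_finite.subset Set.sdiff_subset), Set.sdiff_eq_empty] at hn
    exact ⟨M, by rwa [restrict_eq_self hn], Matroid.IsMinor.refl⟩
  | succ n ih =>
    obtain ⟨z, hz, hzS⟩ : (A.ground \ S).Nonempty := by
      rw [← Set.ncard_pos (A.ground_finite.subset Set.sdiff_subset)]; omega
    have hrr : (A.restrict {z}ᶜ).restrict S = A.restrict S := by
      rw [restrict_restrict, Set.inter_eq_right.2]
      simpa using hzS
    have hcard : ((A.restrict {z}ᶜ).ground \ S).ncard = n := by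
      have : (A.restrict {z}ᶜ).ground \ S = (A.ground \ S) \ {z} := by
        rw [restrict_ground]; ext t; simp; tauto
      rw [this, Set.ncard_sdiff_singleton_of_mem (by exact ⟨hz, hzS⟩), hn]
      rfl
    obtain ⟨M₁, h1, h2⟩ : ∃ M₁, (A.restrict {z}ᶜ).Represents M₁ ∧ M₁.IsMinor M := by
      rcases mem_ground.1 hz with hz | hz
      · exact ⟨_, h.contract hA hz, by simpa using M.contract_delete_isMinor {z} ∅⟩
      · exact ⟨_, h.delete hz, by simpa using M.contract_delete_isMinor ∅ {z}⟩
    obtain ⟨M', h3, h4⟩ := ih (isMatrixOver_restrict hA _) h1 hcard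
    exact ⟨M', by rwa [hrr] at h3, h4.trans h2⟩

/-! ### Connectivity -/

/-- If the block with rows outside and columns inside `S` is zero then the rank of `S` is at most
the number of its rows. -/
theorem Represents.eRk_le (h : A.Represents M)
    (h0 : ∀ x ∈ A.rows, x ∉ S → ∀ y ∈ A.cols, y ∈ S → A.entry x y = 0) :
    M.eRk S ≤ ((A.rows : Set α) ∩ S).encard := by
  rw [Matroid.eRk_le_iff]
  intro I hIS hI
  obtain ⟨B, hB, hIB⟩ := hI.exists_isBase_superset
  have hB' := (represents_iff.1 h).2 B |>.1 hB
  obtain ⟨f, hf⟩ := hB'.2.exists_transversal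
  have hin : ∀ i : A.rows, (f i : α) ∈ S → (i : α) ∈ S := by
    intro i hi
    by_contra hiS
    apply hf i
    by_cases hr : (f i : α) ∈ A.rows
    · exact augEntry_row hr fun h => hiS (h ▸ hi)
    · rw [augEntry_of_notMem hr]
      exact h0 i i.2 hiS _ ((mem_ground.1 (hB'.1 (f i).2)).resolve_left hr) hi
  let g : I → ((A.rows : Set α) ∩ S : Set α) := fun t =>
    ⟨f.symm ⟨t, hIB t.2⟩, (f.symm ⟨t, hIB t.2⟩).2, hin _ (by simpa using hIS t.2)⟩
  have hg : Function.Injective g := by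
    intro s t hst
    have h1 : (g s : α) = g t := by rw [hst]
    have : f.symm ⟨s, hIB s.2⟩ = f.symm ⟨t, hIB t.2⟩ := Subtype.ext h1
    simpa [Subtype.ext_iff] using this
  exact ENat.card_le_card_of_injective hg

end LabelledMatrix

namespace Matroid

variable {α : Type*} {M N : Matroid α}

theorem IsIsomorphicTo.trans {M₁ M₂ M₃ : Matroid α} (h : M₁.IsIsomorphicTo M₂)
    (h' : M₂.IsIsomorphicTo M₃) : M₁.IsIsomorphicTo M₃ := by
  obtain ⟨f, hf, rfl⟩ := h
  obtain ⟨g, hg, rfl⟩ := h'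
  refine ⟨g ∘ f, ?_, ?_⟩
  · exact hg.comp hf fun x hx => Set.mem_image_of_mem f hx
  · refine ext_indep (Set.image_comp g f M₁.E).symm fun I _ => ?_
    simp only [map_indep_iff]
    constructor
    · rintro ⟨_, ⟨J, hJ, rfl⟩, rfl⟩
      exact ⟨J, hJ, by rw [Set.image_comp]⟩
    · rintro ⟨J, hJ, rfl⟩
      exact ⟨_, ⟨J, hJ, rfl⟩, by rw [Set.image_comp]⟩

theorem IsIsomorphicTo.encard_ground (h : M.IsIsomorphicTo N) : N.E.encard = M.E.encard := by
  obtain ⟨f, hf, rfl⟩ := h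
  exact hf.encard_image

theorem IsIsomorphicTo.isKConnected (h : M.IsIsomorphicTo N) {k : ℕ} (hM : M.IsKConnected k) :
    N.IsKConnected k := by
  obtain ⟨f, hf, rfl⟩ := h
  rintro k' hk' Z ⟨h1, h2, h3, h4⟩
  obtain ⟨Z', hZ', rfl⟩ := Set.subset_image_iff.1 h1
  have hc : (M.map f hf).E \ f '' Z' = f '' (M.E \ Z') := by
    rw [map_ground, ← hf.image_sdiff_subset hZ']
  rw [hc] at h3 h4
  rw [(hf.mono hZ').encard_image] at h2
  rw [(hf.mono Set.sdiff_subset).encard_image] at h3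
  rw [eRk_map M hf hZ', eRk_map M hf Set.sdiff_subset, eRank_map] at h4
  exact hM k' hk' Z' ⟨hZ', h2, h3, h4⟩

theorem IsSeparation.compl {k : ℕ} {Z : Set α} (h : M.IsSeparation k Z) :
    M.IsSeparation k (M.E \ Z) := by
  obtain ⟨h1, h2, h3, h4⟩ := h
  rw [IsSeparation, Set.sdiff_sdiff_cancel_left h1]
  exact ⟨Set.sdiff_subset, h3, h2, by rwa [add_comm (M.eRk _)]⟩

theorem exists_eRk_eq [M.Finite] (X : Set α) : ∃ n : ℕ, M.eRk X = n := by
  have : M.eRk X ≠ ⊤ := eRk_ne_top_iff.2 (M.isRkFinite_set X)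
  exact ⟨_, (ENat.natCast_toNat this).symm⟩

theorem exists_eRank_eq [M.Finite] : ∃ n : ℕ, M.eRank = n := by
  rw [← eRk_ground]; exact exists_eRk_eq _

theorem exists_encard_eq [M.Finite] {X : Set α} (hX : X ⊆ M.E) : ∃ n : ℕ, X.encard = n :=
  ⟨_, (M.ground_finite.subset hX).cast_ncard_eq.symm⟩

theorem IsKConnected.dual [M.Finite] {k : ℕ} (hM : M.IsKConnected k) : M✶.IsKConnected k := by
  rintro k' hk' Z ⟨h1, h2, h3, h4⟩
  rw [dual_ground] at h1 h3 h4
  refine hM k' hk' Z ⟨h1, h2, h3, ?_⟩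
  have e1 := M.eRk_dual_add_eRank Z h1
  have e2 := M.eRk_dual_add_eRank (M.E \ Z) Set.sdiff_subset
  have e3 := M.eRank_add_eRank_dual
  have e4 := Set.encard_sdiff_add_encard_of_subset h1
  rw [Set.sdiff_sdiff_cancel_left h1] at e2
  obtain ⟨a, ha⟩ := exists_eRk_eq (M := M) Z
  obtain ⟨b, hb⟩ := exists_eRk_eq (M := M) (M.E \ Z)
  obtain ⟨a', ha'⟩ := exists_eRk_eq (M := M✶) Z
  obtain ⟨b', hb'⟩ := exists_eRk_eq (M := M✶) (M.E \ Z)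
  obtain ⟨r, hr⟩ := exists_eRank_eq (M := M)
  obtain ⟨r', hr'⟩ := exists_eRank_eq (M := M✶)
  obtain ⟨m, hm⟩ := exists_encard_eq h1
  obtain ⟨m', hm'⟩ := exists_encard_eq (M := M) (X := M.E \ Z) Set.sdiff_subset
  obtain ⟨n, hn⟩ := exists_encard_eq (M := M) (X := M.E) subset_rfl
  simp only [ha, hb, ha', hb', hr, hr', hm, hm', hn] at *
  norm_cast at *
  omega

/-- A matroid with a 3-connected deletion `M \ w`, where `w` is neither a loop nor a coloop and has
no parallel element, is 3-connected. Elements parallel to `w` only matter if `M \ w` has at least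
three elements. -/
theorem isKConnected_of_delete [M.Finite] {w : α} (hw : w ∈ M.E)
    (h : (M.delete {w}).IsKConnected 3) (hB : ∃ B, M.IsBase B ∧ w ∈ B)
    (hB' : ∃ B, M.IsBase B ∧ w ∉ B)
    (hno : 3 ≤ (M.E \ {w}).encard → ∀ p ∈ M.E, p ≠ w → ∃ B, M.IsBase B ∧ w ∈ B ∧ p ∈ B) :
    M.IsKConnected 3 := by
  have hrk : ∀ X ⊆ M.E, w ∉ X → (M.delete {w}).eRk X = M.eRk X := by
    intro X hX hwX
    rw [delete_eq_restrict, restrict_eRk_eq]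
    exact Set.subset_sdiff_singleton hX hwX
  have hr : M.eRk (M.E \ {w}) = M.eRank := by
    obtain ⟨B, hB, hwB⟩ := hB'
    apply le_antisymm (M.eRk_le_eRank _)
    rw [← hB.eRk_eq_eRank]
    exact M.eRk_mono (Set.subset_sdiff_singleton hB.subset_ground hwB)
  have hr' : (M.delete {w}).eRank = M.eRank := by
    rw [← hr, ← eRk_ground, delete_ground, hrk _ Set.sdiff_subset (by simp)]
  -- a separation of `M` restricts to one of `M \ w`, unless the side of `w` is too small
  have key : ∀ k' < 3, ∀ Z, w ∈ Z → ¬ M.IsSeparation k' Z := by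
    rintro k' hk' Z hwZ ⟨h1, h2, h3, h4⟩
    have hc : (M.E \ {w}) \ (Z \ {w}) = M.E \ Z := by
      ext t; simp only [Set.mem_sdiff, Set.mem_singleton_iff]
      have : t = w → t ∈ Z := fun h => h ▸ hwZ
      tauto
    have h5 := h k' hk' (Z \ {w})
    have h6 : ¬ (k' : ℕ∞) ≤ (Z \ {w}).encard := by
      intro h6
      refine h5 ⟨Set.sdiff_subset_sdiff_left h1, h6, ?_, ?_⟩
      · rw [delete_ground, hc]; exact h3
      · rw [delete_ground, hc, hr', hrk _ (Set.sdiff_subset.trans h1) (by simp),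
          hrk _ Set.sdiff_subset (by simp [hwZ])]
        exact lt_of_le_of_lt (add_le_add_left (M.eRk_mono Set.sdiff_subset) _) h4
    have h7 := Set.encard_sdiff_singleton_add_one hwZ
    obtain ⟨m, hm⟩ := exists_encard_eq (M := M) (X := Z \ {w}) (Set.sdiff_subset.trans h1)
    obtain ⟨a, ha⟩ := exists_eRk_eq (M := M) Z
    obtain ⟨b, hb⟩ := exists_eRk_eq (M := M) (M.E \ Z)
    obtain ⟨r, hrr⟩ := exists_eRank_eq (M := M)
    have hmk : m + 1 = k' := by
      rw [← h7, hm] at h2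
      rw [hm] at h6
      norm_cast at h2 h6
      omega
    have hm1 : m = 0 ∨ m = 1 := by omega
    rcases hm1 with rfl | rfl
    -- the side of `w` is `{w}`, and `w` is not a loop
    · have hZ : Z = {w} := by
        rw [Nat.cast_zero, Set.encard_eq_zero, Set.sdiff_eq_empty] at hm
        exact Set.Subset.antisymm hm (by simpa using hwZ)
      obtain ⟨B, hB, hwB⟩ := hB
      have h8 := (hB.indep.subset (by simpa using hwB : ({w} : Set α) ⊆ B)).eRk_eq_encard
      rw [hZ, hr, h8, Set.encard_singleton, ← hmk, add_comm, zero_add] at h4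
      exact lt_irrefl _ h4
    · obtain ⟨p, hp⟩ := Set.encard_eq_one.1 (by simpa using hm)
      have hpZ : p ∈ Z ∧ p ≠ w := by
        have : p ∈ Z \ {w} := by rw [hp]; rfl
        simpa using this
      -- the side of `w` is a pair `{w, p}`: it is independent, so that `p` is a coloop of `M \ w`
      have hZ : Z = {w, p} := by
        rw [← Set.insert_sdiff_self_of_mem hwZ, hp]
      have hEp : (M.E \ {w}) \ {p} = M.E \ Z := by
        rw [hZ, Set.sdiff_sdiff, Set.singleton_union]
      obtain ⟨c, hc⟩ := exists_encard_eq (M := M) (X := M.E \ Z) Set.sdiff_subset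
      have h3c : 2 ≤ c := by
        rw [← hmk, hc] at h3
        exact_mod_cast h3
      have hpE : p ∈ M.E \ {w} := Set.mem_sdiff_singleton.2 ⟨h1 hpZ.1, hpZ.2⟩
      obtain ⟨B, hB, hwB, hpB⟩ := hno (by
        rw [← Set.encard_sdiff_singleton_add_one (a := p) (s := M.E \ {w}) hpE, hEp, hc]
        norm_cast
        omega) p (h1 hpZ.1) hpZ.2
      have h8 := (hB.indep.subset (by rw [hZ]; exact Set.pair_subset hwB hpB : Z ⊆ B)).eRk_eq_encard
      rw [← h7, hm] at h8
      refine h 1 (by norm_num) {p} ⟨Set.singleton_subset_iff.2 hpE, by simp, ?_, ?_⟩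
      · rw [delete_ground, hEp, hc]
        norm_cast
        omega
      · rw [delete_ground, hEp, hr', hrk {p} (by simpa using h1 hpZ.1) (by simpa using hpZ.2.symm),
          hrk _ Set.sdiff_subset (by simp [hwZ])]
        refine lt_of_le_of_lt (add_le_add_left (M.eRk_singleton_le p) _) ?_
        rw [h8, ← hmk, hb, hrr] at h4
        rw [hb, hrr]
        norm_cast at h4 ⊢
        omega
  intro k' hk' Z hZ
  by_cases hwZ : w ∈ Z
  · exact key k' hk' Z hwZ hZ
  · exact key k' hk' _ (show w ∈ M.E \ Z from ⟨hw, hwZ⟩) hZ.compl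

end Matroid

namespace LabelledMatrix

variable {α R : Type*} [CommRing R] {P : PartialField R} {K : Subring R}
variable {A A' : LabelledMatrix α R} {B S : Set α} {M M' : Matroid α}

theorem Represents.finite (h : A.Represents M) : M.Finite :=
  ⟨by rw [h.ground_eq]; exact A.ground_finite⟩

theorem Represents.encard_add (h : A.Represents M) (S : Set α) :
    ((A.rows : Set α) ∩ S).encard + ((A.rows : Set α) ∩ Sᶜ).encard = M.eRank := by
  rw [← h.isBase_rows.encard_eq_eRank, ← Set.sdiff_eq, add_comm,
    Set.encard_sdiff_add_encard_inter]

theorem Represents.eRk_compl_le (h : A.Represents M)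
    (h0 : ∀ x ∈ A.rows, x ∈ S → ∀ y ∈ A.cols, y ∉ S → A.entry x y = 0) :
    M.eRk (M.E \ S) ≤ ((A.rows : Set α) ∩ Sᶜ).encard := by
  rw [Set.sdiff_eq, M.eRk_ground_inter]
  exact h.eRk_le fun x hx hxS => h0 x hx (by simpa using hxS)

/-- A disconnected bipartite graph gives a 1-separation. -/
theorem Represents.conn (h : A.Represents M) (hM : M.IsKConnected 3) : Conn A Set.univ := by
  rintro W hW ⟨z, hz, _, hzW⟩ t ht _
  by_contra htW
  have h1 := h.eRk_le (S := W) (by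
    intro x _ hxW y _ hyW
    by_contra h0
    exact hxW ((hW x trivial y trivial h0).2 hyW))
  have h2 := h.eRk_compl_le (S := W) (by
    intro x _ hxW y _ hyW
    by_contra h0
    exact hyW ((hW x trivial y trivial h0).1 hxW))
  refine hM 1 (by norm_num) (M.E ∩ W) ⟨Set.inter_subset_left, ?_, ?_, ?_⟩
  · rw [Nat.cast_one, Set.one_le_encard_iff_nonempty]
    exact ⟨z, h.ground_eq ▸ hz, hzW⟩
  · rw [Nat.cast_one, Set.one_le_encard_iff_nonempty]
    exact ⟨t, h.ground_eq ▸ ht, fun h => htW h.2⟩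
  · rw [M.eRk_ground_inter, Set.sdiff_self_inter]
    have := h.finite
    obtain ⟨r, hr⟩ := M.exists_eRank_eq
    refine lt_of_le_of_lt ((add_le_add h1 h2).trans (h.encard_add W).le) ?_
    rw [hr]
    norm_cast
    omega

/-- A 2-separation in the sense of `NoTwoSep` is one of the matroid, as one sees after pivoting over
a nonzero entry of the block of rank one. -/
theorem Represents.noTwoSep (hA : A.IsMatrixOver P) (h : A.Represents M)
    (hM : M.IsKConnected 3) : NoTwoSep A := by
  rintro S h1 h2 ⟨h3, h4⟩
  have h5 := h.eRk_le h3
  have h6 : M.eRk (M.E \ S) ≤ ((A.rows : Set α) ∩ Sᶜ).encard + 1 := by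
    by_cases h0 : ∀ x ∈ A.rows, x ∈ S → ∀ y ∈ A.cols, y ∉ S → A.entry x y = 0
    · exact (h.eRk_compl_le h0).trans le_self_add
    push Not at h0
    -- the pivot over `xy` clears the block of rank one, and moves one element of the base across
    obtain ⟨x, hx, hxS, y, hy, hyS, hxy⟩ := h0
    have hxy' : x ≠ y := row_ne_col hx hy
    have h7 := ((pivotEquiv_pivot (hx := hx) (hy := hy) hxy).represents hA h).eRk_compl_le (S := S)
      (by
        intro u hu huS v hv hvS
        have huy : u ≠ y := ne_of_mem_of_not_mem huS hyS
        have hvx : v ≠ x := (ne_of_mem_of_not_mem hxS hvS).symm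
        have hu' := (mem_pivot_rows.1 hu).resolve_left huy
        have hv' := (mem_pivot_cols.1 hv).resolve_left hvx
        rw [pivot_entry hu'.2 huy hvx hv'.2]
        have := h4 u hu'.1 huS x hx hxS v hv'.1 hvS y hy hyS
        linear_combination Ring.inverse (A.entry x y) * this -
          A.entry u v * inverse_mul_entry hA hxy)
    refine h7.trans ((Set.encard_le_encard ?_).trans
      (Set.encard_insert_le ((A.rows : Set α) ∩ Sᶜ) y))
    rintro t ⟨ht, htS⟩
    rcases mem_pivot_rows.1 ht with rfl | ht
    · exact Or.inl rfl
    · exact Or.inr ⟨ht.1, htS⟩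
  refine hM 2 (by norm_num) (M.E ∩ S) ⟨Set.inter_subset_left, ?_, ?_, ?_⟩
  · rw [h.ground_eq]; exact h1
  · rw [h.ground_eq, Set.sdiff_self_inter]; exact h2
  · rw [M.eRk_ground_inter, Set.sdiff_self_inter]
    have := h.finite
    obtain ⟨r, hr⟩ := M.exists_eRank_eq
    refine lt_of_le_of_lt (add_le_add h5 h6) ?_
    rw [← add_assoc, h.encard_add, hr]
    norm_cast
    omega

/-- Independent columns `w` and `p` belong to a common base. -/
theorem Represents.exists_isBase_of_cols (hA : A.IsMatrixOver P) (h : A.Represents M)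
    {w p x x' : α} (hwp : w ≠ p)
    (hne : A.entry x w * A.entry x' p ≠ A.entry x p * A.entry x' w) :
    ∃ B, M.IsBase B ∧ w ∈ B ∧ p ∈ B := by
  have key : ∀ x x', A.entry x w * A.entry x' p ≠ A.entry x p * A.entry x' w → A.entry x w ≠ 0 →
      ∃ B, M.IsBase B ∧ w ∈ B ∧ p ∈ B := by
    intro x x' hne hxw
    have hx := mem_rows_of_entry hxw
    have hw := mem_cols_of_entry hxw
    have hpp : p ∈ A.cols := by
      by_contra hp
      exact hne (by rw [entry_eq_zero_of_col hp, entry_eq_zero_of_col hp]; ring)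
    have hx' : x' ∈ A.rows := by
      by_contra hx'
      exact hne (by rw [entry_eq_zero_of_row hx', entry_eq_zero_of_row hx']; ring)
    have hxx' : x' ≠ x := by
      rintro rfl
      exact hne (mul_comm _ _)
    have hpx : p ≠ x := (row_ne_col hx hpp).symm
    have hpiv := pivotEquiv_pivot (P := P) (hx := hx) (hy := hw) hxw
    have hA' := hpiv.isMatrixOver hA
    have hent : (A.pivot x w hx hw).entry x' p ≠ 0 := by
      rw [pivot_entry hxx' (row_ne_col hx' hw) hpx hwp.symm]
      intro h0
      apply hne
      linear_combination A.entry x w * h0 +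
        (A.entry x' w * A.entry x p) * inverse_mul_entry hA hxw
    have hp' : p ∈ (A.pivot x w hx hw).cols := mem_cols_of_entry hent
    have hx'' : x' ∈ (A.pivot x w hx hw).rows := mem_rows_of_entry hent
    refine ⟨_, ((hpiv.trans (pivotEquiv_pivot (hx := hx'') (hy := hp') hent)).represents
      hA h).isBase_rows, ?_, ?_⟩
    · exact mem_pivot_rows.2 (Or.inr ⟨mem_pivot_rows.2 (Or.inl rfl), (row_ne_col hx' hw).symm⟩)
    · exact mem_pivot_rows.2 (Or.inl rfl)
  by_cases hxw : A.entry x w = 0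
  · apply key x' x
    · intro h0
      apply hne
      linear_combination -h0
    · intro h0
      apply hne
      rw [hxw, h0]
      ring
  · exact key x x' hne hxw

/-- A column `w` and a row `p` belong to a common base if `w` is nonzero outside the row `p`. -/
theorem Represents.exists_isBase_of_col_row (hA : A.IsMatrixOver P) (h : A.Represents M)
    {w p x : α} (hp : p ∈ A.rows) (hxp : x ≠ p) (hne : A.entry x w ≠ 0) :
    ∃ B, M.IsBase B ∧ w ∈ B ∧ p ∈ B := by
  have hx := mem_rows_of_entry hne
  have hw := mem_cols_of_entry hne
  refine ⟨_, ((pivotEquiv_pivot (P := P) (hx := hx) (hy := hw) hne).represents hA h).isBase_rows,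
    ?_, ?_⟩
  · exact mem_pivot_rows.2 (Or.inl rfl)
  · exact mem_pivot_rows.2 (Or.inr ⟨hp, hxp.symm⟩)

/-! ### Relabelling -/

/-- `A'` is `A` with the labels renamed by `φ`. -/
structure Relabels (φ : α → α) (A A' : LabelledMatrix α R) : Prop where
  injOn : Set.InjOn φ A.ground
  rows : (A'.rows : Set α) = φ '' A.rows
  cols : (A'.cols : Set α) = φ '' A.cols
  entry : ∀ x ∈ A.rows, ∀ y ∈ A.cols, A'.entry (φ x) (φ y) = A.entry x y

theorem Relabels.transpose {φ : α → α} (h : Relabels φ A A') :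
    Relabels φ A.transpose A'.transpose :=
  ⟨by rw [transpose_ground]; exact h.injOn, h.cols, h.rows,
    fun x hx y hy => h.entry y hy x hx⟩

theorem Relabels.isIsomorphicTo {φ : α → α} (h : Relabels φ A A') (hM : A.Represents M)
    (hM' : A'.Represents M') : M.IsIsomorphicTo M' := by
  classical
  have hE : M.E = A.ground := hM.1
  have hφ : Set.InjOn φ M.E := by rw [hE]; exact h.injOn
  have hg : A'.ground = φ '' A.ground := by
    rw [ground, ground, h.rows, h.cols, Set.image_union]
  refine ⟨φ, hφ, Matroid.ext_isBase ?_ ?_⟩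
  · rw [hM'.ground_eq, Matroid.map_ground, hE, hg]
  intro B' hB'
  rw [hM'.ground_eq, hg] at hB'
  obtain ⟨B, hB, rfl⟩ := Set.subset_image_iff.1 hB'
  rw [Matroid.map_image_isBase_iff (by rwa [hE]), (represents_iff.1 hM).2, (represents_iff.1 hM').2]
  have hr : (A.rows : Set α) ⊆ A.ground := Set.subset_union_left
  let e : A.rows ≃ A'.rows :=
    (Equiv.Set.imageOfInjOn φ A.rows (h.injOn.mono hr)).trans (Equiv.setCongr h.rows.symm)
  let w : B ≃ φ '' B := Equiv.Set.imageOfInjOn φ B (h.injOn.mono hB)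
  have hdet : ∀ f : A.rows ≃ B, (Matrix.of fun i j => A'.augEntry (e i) (w (f j))) =
      Matrix.of fun i j : A.rows => A.augEntry i (f j) := by
    intro f
    ext i j
    have h1 : (e i : α) = φ i := rfl
    have h2 : (w (f j) : α) = φ (f j) := rfl
    have hfj := hB (f j).2
    have h3 : φ (f j) ∈ A'.rows ↔ (f j : α) ∈ A.rows := by
      rw [← Finset.mem_coe, h.rows]
      exact h.injOn.mem_image_iff hr hfj
    have h4 : φ i = φ (f j) ↔ (i : α) = f j := h.injOn.eq_iff (hr i.2) hfj
    simp only [Matrix.of_apply, augEntry, h1, h2, h3, h4]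
    split_ifs with h5
    · rfl
    · rfl
    · exact h.entry i i.2 _ ((mem_ground.1 hfj).resolve_left h5)
  have hnon : A.Nonsing B ↔ A'.Nonsing (φ '' B) := by
    constructor
    · rintro ⟨f, hf⟩
      have : A.Nonsing B := ⟨f, hf⟩
      rw [nonsing_iff (Equiv.refl _) f] at this
      rw [nonsing_iff e (f.trans w)]
      have h0 := hdet f
      simp only [Equiv.trans_apply]
      rw [h0]
      exact this
    · rintro ⟨f, hf⟩
      have : A'.Nonsing (φ '' B) := ⟨f, hf⟩
      rw [nonsing_iff e ((e.trans (f.trans w.symm)).trans w)] at this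
      have h0 := hdet (e.trans (f.trans w.symm))
      simp only [Equiv.trans_apply] at this h0
      rw [h0] at this
      rw [nonsing_iff (Equiv.refl _) (e.trans (f.trans w.symm))]
      exact this
  rw [hnon, hg]
  exact ⟨fun h => ⟨hB, h.2⟩, fun h => ⟨Set.image_mono hB, h.2⟩⟩

end LabelledMatrix

/-! ### Extensions by one label -/

namespace LabelledMatrix

variable {α R : Type*} [CommRing R] {P : PartialField R} {K : Subring R}
variable {A B : LabelledMatrix α R} {S T : Set α} {M N N₀ : Matroid α} {p s u v w : α}

theorem scalesInto_restrict_iff : ScalesInto P K (A.restrict S) Set.univ ↔ ScalesInto P K A S := by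
  constructor
  · rintro ⟨r, c, hr, hc, h⟩
    refine ⟨r, c, hr, hc, fun x hx y hy => ?_⟩
    have := h x trivial y trivial
    rwa [restrict_entry hx hy] at this
  · rintro ⟨r, c, hr, hc, h⟩
    refine ⟨r, c, hr, hc, fun x _ y _ => ?_⟩
    by_cases hx : x ∈ S
    · by_cases hy : y ∈ S
      · rw [restrict_entry hx hy]
        exact h x hx y hy
      · simp [restrict, hy]
    · simp [restrict, hx]

theorem Conn.of_restrict (h : Conn (A.restrict S) Set.univ) : Conn A S := by
  rintro W hW ⟨z, hz, hzS, hzW⟩ t ht htS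
  refine h W ?_ ⟨z, by rw [restrict_ground]; exact ⟨hz, hzS⟩, trivial, hzW⟩ t
    (by rw [restrict_ground]; exact ⟨ht, htS⟩) trivial
  intro x _ y _ hxy
  have hx := (mem_restrict_rows.1 (mem_rows_of_entry hxy)).2
  have hy := (mem_restrict_cols.1 (mem_cols_of_entry hxy)).2
  rw [restrict_entry hx hy] at hxy
  exact hW x hx y hy hxy

theorem Conn.exists_entry_col (h : Conn A S) (hp : p ∈ A.cols) (hpS : p ∈ S)
    (hz : ∃ z ∈ A.ground, z ∈ S ∧ z ≠ p) : ∃ x ∈ S, A.entry x p ≠ 0 := by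
  by_contra hcon
  push Not at hcon
  obtain ⟨z, hz, hzS, hzp⟩ := hz
  refine hzp (h {p} ?_ ⟨p, mem_ground.2 (Or.inr hp), hpS, rfl⟩ z hz hzS)
  intro x hx y _ hxy
  have h1 : x ≠ p := row_ne_col (mem_rows_of_entry hxy) hp
  have h2 : y ≠ p := by
    rintro rfl
    exact hxy (hcon x hx)
  simp [h1, h2]

theorem Conn.exists_entry_row (h : Conn A S) (hp : p ∈ A.rows) (hpS : p ∈ S)
    (hz : ∃ z ∈ A.ground, z ∈ S ∧ z ≠ p) : ∃ y ∈ S, A.entry p y ≠ 0 :=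
  h.transpose.exists_entry_col hp hpS (by rwa [transpose_ground])

theorem scalesInto_insert_col (hv : v ∈ A.cols) (hvS : v ∉ S) (hS : EntriesIn K A S) {g : Rˣ}
    (hg : g ∈ P.units) (h : ∀ x ∈ S, A.entry x v * g ∈ K) : ScalesInto P K A (insert v S) := by
  refine ScalesInto.of_scaleAt (v := v) hg (EntriesIn.scalesInto ?_)
  refine EntriesIn.insert_col (by exact hv) ((agreeOn_scaleAt hvS).entriesIn hS) fun x hx => ?_
  rw [scaleAt_entry_right (ne_of_mem_of_not_mem hx hvS)]
  exact h x hx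

/-- If a column is added to a matrix over `K` that represents a 3-connected matroid, and the result
cannot be scaled into `K`, then it represents a 3-connected matroid: a zero column, a unit vector
and a multiple of another column could be scaled into `K`. -/
theorem Represents.isKConnected_of_delete (hA : A.IsMatrixOver P) (h : A.Represents M)
    (hv : v ∈ A.cols) (h3 : (M.delete {v}).IsKConnected 3) (hvK : EntriesIn K A {v}ᶜ)
    (hbad : ¬ ScalesInto P K A Set.univ) : M.IsKConnected 3 := by
  have huniv : insert v ({v}ᶜ : Set α) = Set.univ := by
    rw [Set.insert_eq, Set.union_compl_self]
  have hconn : Conn A {v}ᶜ := ((h.delete hv).conn h3).of_restrict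
  have hscale : ∀ g ∈ P.units, ∃ x, x ≠ v ∧ A.entry x v * (g : R) ∉ K := by
    intro g hg
    by_contra hcon
    push Not at hcon
    exact hbad (huniv ▸ scalesInto_insert_col hv (by simp) hvK hg fun x hx => hcon x hx)
  obtain ⟨x₁, hx₁⟩ : ∃ x, A.entry x v ≠ 0 := by
    by_contra hcon
    push Not at hcon
    obtain ⟨x, _, hx⟩ := hscale 1 P.units.one_mem
    rw [hcon x, zero_mul] at hx
    exact hx K.zero_mem
  have hx₁r := mem_rows_of_entry hx₁
  have hvE : v ∈ M.E := by rw [h.ground_eq]; exact mem_ground.2 (Or.inr hv)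
  obtain ⟨b, hb, hb'⟩ := exists_unit (entry_mem_elems hA x₁ v) hx₁
  have := h.finite
  refine Matroid.isKConnected_of_delete hvE h3 ?_ ⟨_, h.isBase_rows, notMem_rows hv⟩ ?_
  · exact ⟨_, ((pivotEquiv_pivot (P := P) (hx := hx₁r) (hy := hv) hx₁).represents hA h).isBase_rows,
      mem_pivot_rows.2 (Or.inl rfl)⟩
  intro hcard p hp hpv
  by_contra hcon
  push Not at hcon
  rw [h.ground_eq] at hp
  rcases mem_ground.1 hp with hp | hp
  -- `v` is parallel to the row `p`: its only nonzero entry could be scaled to `1`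
  · have h0 : ∀ x, x ≠ p → A.entry x v = 0 := by
      intro x hxp
      by_contra h0
      obtain ⟨B, h1, h2, h3⟩ := h.exists_isBase_of_col_row hA hp hxp h0
      exact hcon B h1 h2 h3
    have hpx : x₁ = p := by
      by_contra hne
      exact hx₁ (h0 x₁ hne)
    obtain ⟨x, _, hx⟩ := hscale b⁻¹ (P.units.inv_mem hb)
    apply hx
    by_cases hxp : x = p
    · rw [hxp, ← hpx, ← hb', Units.mul_inv]
      exact K.one_mem
    · rw [h0 x hxp, zero_mul]
      exact K.zero_mem
  -- `v` is parallel to the column `p`, and could be scaled to equal it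
  · have h0 : ∀ x x', A.entry x v * A.entry x' p = A.entry x p * A.entry x' v := by
      intro x x'
      by_contra h0
      obtain ⟨B, h1, h2, h3⟩ := h.exists_isBase_of_cols hA hpv.symm h0
      exact hcon B h1 h2 h3
    obtain ⟨x₀, hx₀v, hx₀⟩ := hconn.exists_entry_col hp hpv (by
      by_contra hz
      push Not at hz
      have : M.E \ {v} ⊆ {p} := by
        rintro t ⟨ht, htv⟩
        rw [h.ground_eq] at ht
        exact hz t ht htv
      have h4 := hcard.trans (Set.encard_le_encard this)
      rw [Set.encard_singleton] at h4
      exact absurd h4 (by norm_num))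
    have hx₁p : A.entry x₁ p ≠ 0 := by
      intro h4
      have h5 := h0 x₁ x₀
      rw [h4, zero_mul] at h5
      exact mul_ne_zero (entry_mem_elems hA x₁ v) hx₁ hx₀ h5
    obtain ⟨a, ha, ha'⟩ := exists_unit (entry_mem_elems hA x₁ p) hx₁p
    obtain ⟨x, hxv, hx⟩ := hscale (a * b⁻¹) (P.units.mul_mem ha (P.units.inv_mem hb))
    apply hx
    have h5 := h0 x₁ x
    rw [← ha', ← hb'] at h5
    have h6 : A.entry x v * ((a * b⁻¹ : Rˣ) : R) = A.entry x p := by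
      rw [Units.val_mul]
      linear_combination (-((b⁻¹ : Rˣ) : R)) * h5 + A.entry x p * b.mul_inv
    rw [h6]
    exact hvK x hxv p hpv

/-- The dual of `Represents.isKConnected_of_delete`. -/
theorem Represents.isKConnected_of_contract (hA : A.IsMatrixOver P) (h : A.Represents M)
    (hv : v ∈ A.rows) (h3 : (M.contract {v}).IsKConnected 3) (hvK : EntriesIn K A {v}ᶜ)
    (hbad : ¬ ScalesInto P K A Set.univ) : M.IsKConnected 3 := by
  have h1 := h.dual hA
  have := (h.contract hA hv).finite
  have := h.finite
  have h2 := h1.isKConnected_of_delete (isMatrixOver_transpose hA) hv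
    (by rw [← Matroid.dual_contract]; exact h3.dual) hvK.transpose fun h => hbad h.transpose
  have := h2.dual
  rwa [Matroid.dual_dual] at this

theorem EntriesIn.restrict (h : EntriesIn K A (S ∩ T)) : EntriesIn K (A.restrict S) T := by
  intro x hx y hy
  by_cases hxS : x ∈ S
  · by_cases hyS : y ∈ S
    · rw [restrict_entry hxS hyS]
      exact h x ⟨hxS, hx⟩ y ⟨hyS, hy⟩
    · simp [LabelledMatrix.restrict, hyS, K.zero_mem]
  · simp [LabelledMatrix.restrict, hxS, K.zero_mem]

theorem insert_inter_compl_singleton (hv : v ∉ S) : insert v S ∩ {v}ᶜ = S := by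
  ext t
  simp only [Set.mem_inter_iff, Set.mem_insert_iff, Set.mem_compl_iff, Set.mem_singleton_iff]
  have : t = v → t ∉ S := by rintro rfl; exact hv
  tauto

theorem Represents.delete_insert (h : (A.restrict (insert v S)).Represents M) (hv : v ∈ A.cols)
    (hvS : v ∉ S) : (A.restrict S).Represents (M.delete {v}) := by
  have := h.delete (mem_restrict_cols.2 ⟨hv, Set.mem_insert v S⟩)
  rwa [restrict_restrict, insert_inter_compl_singleton hvS] at this

theorem Represents.contract_insert (hA : A.IsMatrixOver P)
    (h : (A.restrict (insert v S)).Represents M) (hv : v ∈ A.rows)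
    (hvS : v ∉ S) : (A.restrict S).Represents (M.contract {v}) := by
  have := h.contract (isMatrixOver_restrict hA _) (mem_restrict_rows.2 ⟨hv, Set.mem_insert v S⟩)
  rwa [restrict_restrict, insert_inter_compl_singleton hvS] at this

/-- A label that makes a copy of a 3-connected matroid over `K` bad extends it to a 3-connected
matroid. -/
theorem Represents.isKConnected_insert (hA : A.IsMatrixOver P)
    (h : (A.restrict (insert v S)).Represents M) (h₀ : (A.restrict S).Represents N₀)
    (h3 : N₀.IsKConnected 3) (hv : v ∈ A.ground) (hvS : v ∉ S) (hSK : EntriesIn K A S)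
    (hbad : ¬ ScalesInto P K A (insert v S)) : M.IsKConnected 3 := by
  have hC := isMatrixOver_restrict hA (insert v S)
  have hCK : EntriesIn K (A.restrict (insert v S)) {v}ᶜ := by
    apply EntriesIn.restrict
    rwa [insert_inter_compl_singleton hvS]
  have hCb : ¬ ScalesInto P K (A.restrict (insert v S)) Set.univ := by
    rwa [scalesInto_restrict_iff]
  rcases mem_ground.1 hv with hv | hv
  · have := (h.contract_insert hA hv hvS).unique h₀
    exact h.isKConnected_of_contract hC (mem_restrict_rows.2 ⟨hv, Set.mem_insert v S⟩)
      (by rwa [this]) hCK hCb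
  · have := (h.delete_insert hv hvS).unique h₀
    exact h.isKConnected_of_delete hC (mem_restrict_cols.2 ⟨hv, Set.mem_insert v S⟩)
      (by rwa [this]) hCK hCb

/-- Up to scaling and pivoting, `A` contains a submatrix over `K` that represents a copy of `N`,
inside a submatrix that cannot be scaled into `K` and represents a 3-connected matroid with at most
one row and at most one column more. -/
def HasWitness (P : PartialField R) (K : Subring R) (A : LabelledMatrix α R) (N : Matroid α) :
    Prop :=
  ∃ (A' : LabelledMatrix α R) (S T : Set α) (N₀ M' : Matroid α), PivotEquiv P A A' ∧
    (A'.restrict S).Represents N₀ ∧ N.IsIsomorphicTo N₀ ∧ EntriesIn K A' S ∧ S ⊆ T ∧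
    (A'.restrict T).Represents M' ∧ M'.IsKConnected 3 ∧ ¬ ScalesInto P K A' T ∧
    ((∃ x ∈ M'.E, N₀ = M'.contract {x}) ∨ (∃ y ∈ M'.E, N₀ = M'.delete {y}) ∨
      ∃ x ∈ M'.E, ∃ y ∈ M'.E, x ≠ y ∧ N₀ = (M'.contract {x}).delete {y} ∧
        ((M'.contract {x}).IsKConnected 3 ∨ (M'.delete {y}).IsKConnected 3))

theorem HasWitness.of_pivotEquiv (h : PivotEquiv P A B) (hB : HasWitness P K B N) :
    HasWitness P K A N := by
  obtain ⟨A', S, T, N₀, M', h1, h2⟩ := hB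
  exact ⟨A', S, T, N₀, M', h.trans h1, h2⟩

/-- One bad label is a witness: the extended matroid is 3-connected. -/
theorem hasWitness_of_insert (hA : A.IsMatrixOver P) (hM : A.Represents M)
    (h₀ : (A.restrict S).Represents N₀) (hN₀ : N.IsIsomorphicTo N₀) (h3 : N.IsKConnected 3)
    (hv : v ∈ A.ground) (hvS : v ∉ S) (hSK : EntriesIn K A S)
    (hbad : ¬ ScalesInto P K A (insert v S)) : HasWitness P K A N := by
  obtain ⟨M', h1, _⟩ := hM.exists_minor hA (insert v S)
  have h2 := h1.isKConnected_insert hA h₀ (hN₀.isKConnected h3) hv hvS hSK hbad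
  have hvM : v ∈ M'.E := by
    rw [h1.ground_eq, restrict_ground]
    exact ⟨hv, Set.mem_insert v S⟩
  refine ⟨A, S, insert v S, N₀, M', PivotEquiv.refl A, h₀, hN₀, hSK, Set.subset_insert _ _, h1, h2,
    hbad, ?_⟩
  rcases mem_ground.1 hv with hv | hv
  · exact Or.inl ⟨v, hvM, h₀.unique (h1.contract_insert hA hv hvS)⟩
  · exact Or.inr (Or.inl ⟨v, hvM, h₀.unique (h1.delete_insert hv hvS)⟩)

/-- Up to scaling and pivoting, `A` contains a copy of `A[S]` with a bad extension by one label. -/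
def HasBadCopy (P : PartialField R) (K : Subring R) (A : LabelledMatrix α R) (S : Set α) : Prop :=
  ∃ (B : LabelledMatrix α R) (S' : Set α) (φ : α → α) (u : α), PivotEquiv P A B ∧
    Relabels φ (A.restrict S) (B.restrict S') ∧ EntriesIn K B S' ∧ u ∈ B.ground ∧ u ∉ S' ∧
    ¬ ScalesInto P K B (insert u S')

theorem HasBadCopy.transpose (h : HasBadCopy P K A S) : HasBadCopy P K A.transpose S := by
  obtain ⟨B, S', φ, u, h1, h2, h3, h4, h5, h6⟩ := h
  refine ⟨B.transpose, S', φ, u, h1.transpose, ?_, h3.transpose, by rwa [transpose_ground], h5,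
    fun h => h6 h.transpose⟩
  rw [restrict_transpose, restrict_transpose]
  exact h2.transpose

/-- The relabelled copy represents a matroid isomorphic to `N`, and is extended by one bad label. -/
theorem HasBadCopy.hasWitness (h : HasBadCopy P K A S) (hA : A.IsMatrixOver P)
    (hM : A.Represents M) (h₀ : (A.restrict S).Represents N₀) (hN₀ : N.IsIsomorphicTo N₀)
    (h3 : N.IsKConnected 3) : HasWitness P K A N := by
  obtain ⟨B, S', φ, u, h1, h2, h4, h5, h6, h7⟩ := h
  have hB := h1.isMatrixOver hA
  have hMB := h1.represents hA hM
  obtain ⟨N₁, h8, _⟩ := hMB.exists_minor hB S'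
  exact (hasWitness_of_insert hB hMB h8 (hN₀.trans (h2.isIsomorphicTo h₀ h8)) h3 h5 h6 h4
    h7).of_pivotEquiv h1

/-- Exchanging a label `p` for one with the same entries. -/
theorem exists_relabels {A' : LabelledMatrix α R} (hw : w ∉ S \ {p}) (hp : p ∈ S)
    (h : AgreeOn A A' (S \ {p})) (hr : w ∈ A'.rows ↔ p ∈ A.rows) (hc : w ∈ A'.cols ↔ p ∈ A.cols)
    (h1 : ∀ y ∈ S \ {p}, A'.entry w y = A.entry p y)
    (h2 : ∀ x ∈ S \ {p}, A'.entry x w = A.entry x p) :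
    ∃ φ, Relabels φ (A.restrict S) (A'.restrict (insert w (S \ {p}))) := by
  classical
  have hφ : ∀ z, z ≠ p → Function.update id p w z = z := fun z hz => by simp [hz]
  have hφp : Function.update (id : α → α) p w p = w := by simp
  have himage : ∀ (X X' : Finset α), (w ∈ X' ↔ p ∈ X) → (∀ z ∈ S \ {p}, (z ∈ X' ↔ z ∈ X)) →
      {z | z ∈ X' ∧ z ∈ insert w (S \ {p})} =
        Function.update (id : α → α) p w '' {z | z ∈ X ∧ z ∈ S} := by
    intro X X' h3 h4
    ext z
    constructor
    · rintro ⟨hz, rfl | hzS⟩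
      · exact ⟨p, ⟨h3.1 hz, hp⟩, hφp⟩
      · exact ⟨z, ⟨(h4 z hzS).1 hz, hzS.1⟩, hφ z hzS.2⟩
    · rintro ⟨t, ⟨ht, htS⟩, rfl⟩
      by_cases htp : t = p
      · rw [htp, hφp]
        exact ⟨h3.2 (htp ▸ ht), Or.inl rfl⟩
      · rw [hφ t htp]
        exact ⟨(h4 t ⟨htS, htp⟩).2 ht, Or.inr ⟨htS, htp⟩⟩
  have hset : ∀ (C : LabelledMatrix α R) (T : Set α),
      ((C.restrict T).rows : Set α) = {z | z ∈ C.rows ∧ z ∈ T} ∧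
        ((C.restrict T).cols : Set α) = {z | z ∈ C.cols ∧ z ∈ T} :=
    fun C T => ⟨Set.ext fun z => mem_restrict_rows, Set.ext fun z => mem_restrict_cols⟩
  have hwT : w ∈ insert w (S \ {p}) := Set.mem_insert _ _
  have hT : S \ {p} ⊆ insert w (S \ {p}) := Set.subset_insert _ _
  refine ⟨Function.update id p w, ?_, ?_, ?_, ?_⟩
  · intro x hx y hy hxy
    rw [restrict_ground] at hx hy
    by_cases hxp : x = p
    · by_cases hyp : y = p
      · rw [hxp, hyp]
      · rw [hxp, hφp, hφ y hyp] at hxy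
        exact absurd (show w ∈ S \ {p} from hxy ▸ ⟨hy.2, hyp⟩) hw
    · by_cases hyp : y = p
      · rw [hyp, hφp, hφ x hxp] at hxy
        exact absurd (show w ∈ S \ {p} from hxy ▸ ⟨hx.2, hxp⟩) hw
      · rwa [hφ x hxp, hφ y hyp] at hxy
  · rw [(hset A S).1, (hset A' _).1]
    exact himage _ _ hr h.rows
  · rw [(hset A S).2, (hset A' _).2]
    exact himage _ _ hc h.cols
  · intro x hx y hy
    rw [mem_restrict_rows] at hx
    rw [mem_restrict_cols] at hy
    rw [restrict_entry hx.2 hy.2]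
    by_cases hxp : x = p
    · have hyp : y ≠ p := by
        rintro rfl
        exact row_ne_col hx.1 hy.1 hxp
      have hyS : y ∈ S \ {p} := ⟨hy.2, hyp⟩
      rw [hxp, hφp, hφ y hyp, restrict_entry hwT (hT hyS), h1 y hyS]
    · have hxS : x ∈ S \ {p} := ⟨hx.2, hxp⟩
      rw [hφ x hxp]
      by_cases hyp : y = p
      · rw [hyp, hφp, restrict_entry (hT hxS) hwT, h2 x hxS]
      · have hyS : y ∈ S \ {p} := ⟨hy.2, hyp⟩
        rw [hφ y hyp, restrict_entry (hT hxS) (hT hyS), h.entry x hxS y hyS]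

end LabelledMatrix

/-! ### Parallel and series elements -/

namespace LabelledMatrix

variable {α R : Type*} [CommRing R] {P : PartialField R} {K : Subring R}
variable {A B : LabelledMatrix α R} {S T : Set α} {M N N₀ Mv Mw : Matroid α} {p s u v w x y : α}

/-- If the column `w` is parallel to a column `p` of `A[S]` then it may take the place of `p`, and
the row `v` alone is a bad extension of the copy. -/
theorem hasBadCopy_of_parallel (hA : A.IsMatrixOver P) (hK : P.InvClosed K) (hS : Conn A S)
    (hv : v ∈ A.rows) (hw : w ∈ A.cols) (hvS : v ∉ S) (hwS : w ∉ S)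
    (hvK : EntriesIn K A (insert v S)) (hwK : EntriesIn K A (insert w S)) (hne : A.entry v w ∉ K)
    (hp : p ∈ A.cols) (hpS : p ∈ S)
    (hpar : ∀ x ∈ S, ∀ x' ∈ S, A.entry x w * A.entry x' p = A.entry x p * A.entry x' w)
    (hwd : ∃ x ∈ S, A.entry x w ≠ 0) (hvd : ∃ j ∈ S, j ≠ p ∧ A.entry v j ≠ 0) :
    HasBadCopy P K A S := by
  obtain ⟨x₀, hx₀, hx₀w⟩ := hwd
  obtain ⟨j, hj, hjp, hvj⟩ := hvd
  obtain ⟨x₁, hx₁, hx₁p⟩ := hS.exists_entry_col hp hpS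
    ⟨j, mem_ground.2 (Or.inr (mem_cols_of_entry hvj)), hj, hjp⟩
  have hx₀p : A.entry x₀ p ≠ 0 := by
    intro h0
    have := hpar x₀ hx₀ x₁ hx₁
    rw [h0, zero_mul] at this
    exact mul_ne_zero (entry_mem_elems hA x₀ w) hx₀w hx₁p this
  have hne' : ∀ z ∈ S, z ≠ w := fun z hz => ne_of_mem_of_not_mem hz hwS
  obtain ⟨a, ha, ha'⟩ := exists_unit (entry_mem_elems hA x₀ p) hx₀p
  obtain ⟨b, hb, hb'⟩ := exists_unit (entry_mem_elems hA x₀ w) hx₀w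
  have haK : (a : R) ∈ K := ha' ▸ hwK x₀ (Or.inr hx₀) p (Or.inr hpS)
  have hbK : (b : R) ∈ K := hb' ▸ hwK x₀ (Or.inr hx₀) w (Or.inl rfl)
  have hg : a * b⁻¹ ∈ subgroupIn hK :=
    (subgroupIn hK).mul_mem ⟨ha, haK⟩ ((subgroupIn hK).inv_mem ⟨hb, hbK⟩)
  set g := a * b⁻¹ with hg'
  have hAB : PivotEquiv P A (A.scaleAt w g) := pivotEquiv_scaleAt hg.1
  have hag : AgreeOn A (A.scaleAt w g) (S \ {p}) :=
    (agreeOn_scaleAt hwS).mono Set.sdiff_subset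
  -- scaling `w` by `g`, an element of `G ∩ K`, makes it equal to the column `p`
  have hcol : ∀ x ∈ S, (A.scaleAt w g).entry x w = A.entry x p := by
    intro x hx
    rw [scaleAt_entry_right (hne' x hx), hg', Units.val_mul]
    have := hpar x₀ hx₀ x hx
    rw [← ha', ← hb'] at this
    linear_combination (-((b⁻¹ : Rˣ) : R)) * this + A.entry x p * b.mul_inv
  have hwS' : w ∉ S \ {p} := fun h => hwS h.1
  have hpS' : p ∉ S \ {p} := fun h => h.2 rfl
  have hins : insert p (S \ {p}) = S := by rw [Set.insert_sdiff_self_of_mem hpS]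
  obtain ⟨φ, hφ⟩ := exists_relabels hwS' hpS hag
    ⟨fun h => absurd hw (notMem_cols h), fun h => absurd hp (notMem_cols h)⟩
    ⟨fun _ => hp, fun _ => hw⟩ (fun y _ => by
      rw [entry_eq_zero_of_row (notMem_rows hp), entry_eq_zero_of_row (notMem_rows (by exact hw))])
    (fun x hx => hcol x hx.1)
  have hSK : EntriesIn K A S := hvK.mono (Set.subset_insert _ _)
  have hSK' : EntriesIn K (A.scaleAt w g) (insert w (S \ {p})) :=
    EntriesIn.insert_col (by exact hw) (hag.entriesIn (hSK.mono Set.sdiff_subset)) fun x hx => by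
      rw [hcol x hx.1]; exact hSK x hx.1 p hpS
  have hconn : Conn (A.scaleAt w g) (insert w (S \ {p})) :=
    (conn_relabel_row hag.transpose hp hpS' (f := w) hw hwS' (fun x hx => hcol x hx.1)
      (by rw [hins]; exact hS.transpose)).transpose
  have hvw : v ≠ w := row_ne_col hv hw
  refine ⟨_, _, φ, v, hAB, hφ, hSK', mem_ground.2 (Or.inl hv), ?_, fun hsc => ?_⟩
  · rintro (h | h)
    · exact hvw h
    · exact hvS h.1
  -- the entry `vj` forces the scaling factor of the row `v` into `K`, but then `vw` is in `K`
  · obtain ⟨t, ht, htK⟩ := exists_row_scale (hAB.isMatrixOver hA) hK hconn hSK' hsc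
    have h1 := htK j (Or.inr ⟨hj, hjp⟩)
    rw [scaleAt_entry hvw (hne' j hj)] at h1
    have h2 := mem_of_mul_mem hK (entry_mem_elems hA v j) hvj
      (hvK v (Or.inl rfl) j (Or.inr hj)) h1
    have h3 := htK w (Or.inl rfl)
    rw [scaleAt_entry_right hvw] at h3
    refine hne (mem_of_mul_mem hK (a := ((g * t : Rˣ) : R))
      (coe_mem_elems (P.units.mul_mem hg.1 ht)) (units_ne_zero hvj _) ?_ ?_)
    · rw [Units.val_mul]
      exact K.mul_mem hg.2 h2
    · convert h3 using 1
      rw [Units.val_mul]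
      ring

/-- If the column `w` is nonzero on `S` in the row `p` only and the row `v` is parallel to the row
`p`, then the rows `p`, `v` and the column `w` form a line attached to `A[S]`. -/
theorem hasBadCopy_of_line (hA : A.IsMatrixOver P) (hK : P.InvClosed K)
    (hsep : ∀ A', PivotEquiv P A A' → NoTwoSep A') (hcard : 3 ≤ (A.ground ∩ S).encard)
    (hS : Conn A S) (hv : v ∈ A.rows) (hw : w ∈ A.cols) (hvS : v ∉ S) (hwS : w ∉ S)
    (hvK : EntriesIn K A (insert v S)) (hwK : EntriesIn K A (insert w S)) (hne : A.entry v w ∉ K)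
    (hp : p ∈ A.rows) (hpS : p ∈ S) (hcol : ∀ x ∈ S, x ≠ p → A.entry x w = 0)
    (hpar : ∀ y ∈ S, ∀ y' ∈ S, A.entry v y * A.entry p y' = A.entry p y * A.entry v y')
    (hwd : ∃ x ∈ S, A.entry x w ≠ 0) (hvd : ∃ y ∈ S, A.entry v y ≠ 0) :
    HasBadCopy P K A S := by
  obtain ⟨x₀, hx₀, hx₀w⟩ := hwd
  have hpw : A.entry p w ≠ 0 := by
    by_cases h : x₀ = p
    · rwa [← h]
    · exact absurd (hcol x₀ hx₀ h) hx₀w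
  obtain ⟨y, hy, hvy⟩ := hvd
  have hcard' : 2 ≤ (A.ground ∩ (S \ {p})).encard := by
    have h1 : A.ground ∩ (S \ {p}) = (A.ground ∩ S) \ {p} := by
      rw [Set.inter_sdiff_assoc]
    have h2 := Set.encard_sdiff_singleton_add_one
      (show p ∈ A.ground ∩ S from ⟨mem_ground.2 (Or.inl hp), hpS⟩)
    rw [h1]
    rw [← h2] at hcard
    have h3 : (2 : ℕ∞) + 1 ≤ ((A.ground ∩ S) \ {p}).encard + 1 := by
      convert hcard using 1
      norm_num
    exact (ENat.add_le_add_iff_right (by simp)).1 h3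
  obtain ⟨y₁, hy₁, hpy₁⟩ := hS.exists_entry_row hp hpS
    ⟨y, mem_ground.2 (Or.inr (mem_cols_of_entry hvy)), hy,
      (row_ne_col hp (mem_cols_of_entry hvy)).symm⟩
  have hpy : A.entry p y ≠ 0 := by
    intro h0
    have := hpar y hy y₁ hy₁
    rw [h0, zero_mul] at this
    exact mul_ne_zero (entry_mem_elems hA v y) hvy hpy₁ this
  have hyc := mem_cols_of_entry hpy
  have hyp : y ≠ p := (row_ne_col hp hyc).symm
  have hne' : ∀ z ∈ S, z ≠ v := fun z hz => ne_of_mem_of_not_mem hz hvS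
  have hSK : EntriesIn K A S := hvK.mono (Set.subset_insert _ _)
  obtain ⟨a, ha, ha'⟩ := exists_unit (entry_mem_elems hA p y) hpy
  obtain ⟨b, hb, hb'⟩ := exists_unit (entry_mem_elems hA v y) hvy
  have haK : (a : R) ∈ K := ha' ▸ hSK p hpS y hy
  have hbK : (b : R) ∈ K := hb' ▸ hvK v (Or.inl rfl) y (Or.inr hy)
  have hg : a * b⁻¹ ∈ subgroupIn hK :=
    (subgroupIn hK).mul_mem ⟨ha, haK⟩ ((subgroupIn hK).inv_mem ⟨hb, hbK⟩)
  set g := a * b⁻¹ with hg'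
  have hAB : PivotEquiv P A (A.scaleAt v g) := pivotEquiv_scaleAt hg.1
  -- scaling `v` by `g`, an element of `G ∩ K`, makes it equal to the row `p`
  have hrow : ∀ z ∈ S, (A.scaleAt v g).entry v z = A.entry p z := by
    intro z hz
    rw [scaleAt_entry_left (hne' z hz), hg', Units.val_mul]
    have := hpar y hy z hz
    rw [← ha', ← hb'] at this
    linear_combination (-((b⁻¹ : Rˣ) : R)) * this + A.entry p z * b.mul_inv
  have hpv : p ≠ v := hne' p hpS
  have hwv : w ≠ v := (row_ne_col hv hw).symm
  have hpS' : p ∉ S \ {p} := fun h => h.2 rfl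
  have hins : insert p (S \ {p}) = S := by rw [Set.insert_sdiff_self_of_mem hpS]
  -- the configuration is attached to `A[S]`, with `p` in the roles of `f₀` and of its copy `f`
  have hline : LineConfig K A p (S \ {p}) (A.scaleAt v g) p v w := by
    refine ⟨(agreeOn_scaleAt hvS).mono Set.sdiff_subset, hp, hv, hw, hpv, hpS', fun h => hvS h.1,
      fun h => hwS h.1, fun z hz => ?_, fun z hz => hrow z hz.1, fun z hz => ?_, ?_⟩
    · rw [scaleAt_entry hpv (hne' z hz.1)]
    · rw [scaleAt_entry (hne' z hz.1) hwv]
      exact hcol z hz.1 hz.2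
    · rw [scaleAt_entry hpv hwv, scaleAt_entry_left hwv]
      refine ⟨hpw, fun k hk h0 => hne ?_⟩
      refine mem_of_mul_mem hK (coe_mem_elems hg.1) (units_ne_zero hpw _) hg.2 ?_
      rw [h0]
      exact K.mul_mem hk (hwK p (Or.inr hpS) w (Or.inl rfl))
  have hbase : LineBase K A p (S \ {p}) :=
    ⟨hp, hpS', by rwa [hins], by rwa [hins], y, ⟨hy, hyp⟩, hpy⟩
  have hB := hAB.isMatrixOver hA
  obtain ⟨z, l, h1, h2, h3⟩ := hline.exists_blocks hB hbase (hsep _ hAB)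
    (by rw [hAB.ground_eq]; exact hcard')
  obtain ⟨A', f, z, h4, h5, h6, h7, h8, h9, h10, h11, h12⟩ :=
    LineConfig.hasBadExt hK hbase l.length _ p v w z l le_rfl hB hline h1 h2 h3
  obtain ⟨φ, hφ⟩ := exists_relabels h7 hpS h5 ⟨fun _ => hp, fun _ => h6⟩
    ⟨fun h => absurd h (notMem_cols h6), fun h => absurd h (notMem_cols hp)⟩ h8 (fun x _ => by
      rw [entry_eq_zero_of_col (notMem_cols hp), entry_eq_zero_of_col (notMem_cols h6)])
  refine ⟨A', _, φ, z, hAB.trans h4, hφ, LineConfig.entriesIn hbase h5 h6 h8, h9, ?_, h12⟩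
  rintro (h | h)
  · exact h10 h
  · exact h11 h

/-- A row `v` and a column `w` as in `BadTwo` such that `w` is parallel to the element `p` in the
matroid `Mv` of `A[S ∪ w]`, and `v` is in series with the element `s` in the matroid `Mw` of
`A[S ∪ v]`. -/
structure ParallelSeries (K : Subring R) (A : LabelledMatrix α R) (S : Set α) (v w p s : α)
    (N₀ Mv Mw : Matroid α) : Prop where
  v_mem : v ∈ A.rows
  w_mem : w ∈ A.cols
  v_notMem : v ∉ S
  w_notMem : w ∉ S
  p_mem : p ∈ A.ground
  p_mem' : p ∈ S
  s_mem : s ∈ A.ground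
  s_mem' : s ∈ S
  v_entries : EntriesIn K A (insert v S)
  w_entries : EntriesIn K A (insert w S)
  v_ne : ∃ y ∈ S, A.entry v y ≠ 0
  w_ne : ∃ x ∈ S, A.entry x w ≠ 0
  entry : A.entry v w ∉ K
  rep : (A.restrict S).Represents N₀
  rep_v : (A.restrict (insert w S)).Represents Mv
  rep_w : (A.restrict (insert v S)).Represents Mw
  parallel : ∀ B, Mv.IsBase B → w ∈ B → p ∉ B
  series : ∀ B, Mw.IsBase B → v ∉ B → s ∈ B

/-- Pivoting over an entry of `A[S]` commutes with taking the submatrix. -/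
theorem restrict_pivot {hx : x ∈ A.rows} {hy : y ∈ A.cols} (hxS : x ∈ S) (hyS : y ∈ S) :
    (A.pivot x y hx hy).restrict S = (A.restrict S).pivot x y (mem_restrict_rows.2 ⟨hx, hxS⟩)
      (mem_restrict_cols.2 ⟨hy, hyS⟩) := by
  apply ext'
  · ext z
    simp only [mem_restrict_rows, mem_pivot_rows]
    have : z = y → z ∈ S := fun h => h ▸ hyS
    tauto
  · ext z
    simp only [mem_restrict_cols, mem_pivot_cols]
    have : z = x → z ∈ S := fun h => h ▸ hxS
    tauto
  · intro u v
    by_cases hu : u ∈ S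
    · by_cases hv : v ∈ S
      · rw [restrict_entry hu hv]
        by_cases h1 : u = y
        · by_cases h2 : v = x
          · rw [h1, h2, pivot_entry_pivot, pivot_entry_pivot, restrict_entry hxS hyS]
          · by_cases h3 : v = y
            · rw [h3, entry_eq_zero_of_col, entry_eq_zero_of_col]
              · simp only [mem_pivot_cols]; rintro (h | h)
                · exact row_ne_col hx hy h.symm
                · exact h.2 rfl
              · simp only [mem_pivot_cols]; rintro (h | h)
                · exact row_ne_col hx hy h.symm
                · exact h.2 rfl
            · rw [h1, pivot_entry_row h2 h3, pivot_entry_row h2 h3, restrict_entry hxS hyS,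
                restrict_entry hxS hv]
        · by_cases h2 : u = x
          · rw [h2, entry_eq_zero_of_row, entry_eq_zero_of_row]
            · simp only [mem_pivot_rows]; rintro (h | h)
              · exact row_ne_col hx hy h
              · exact h.2 rfl
            · simp only [mem_pivot_rows]; rintro (h | h)
              · exact row_ne_col hx hy h
              · exact h.2 rfl
          · by_cases h3 : v = x
            · rw [h3, pivot_entry_col h2 h1, pivot_entry_col h2 h1, restrict_entry hxS hyS,
                restrict_entry hu hyS]
            · by_cases h4 : v = y
              · rw [h4, entry_eq_zero_of_col, entry_eq_zero_of_col]
                · simp only [mem_pivot_cols]; rintro (h | h)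
                  · exact row_ne_col hx hy h.symm
                  · exact h.2 rfl
                · simp only [mem_pivot_cols]; rintro (h | h)
                  · exact row_ne_col hx hy h.symm
                  · exact h.2 rfl
              · rw [pivot_entry h2 h1 h3 h4, pivot_entry h2 h1 h3 h4, restrict_entry hxS hyS,
                  restrict_entry hu hv, restrict_entry hu hyS, restrict_entry hxS hv]
      · rw [entry_eq_zero_of_col, entry_eq_zero_of_col]
        · simp only [mem_pivot_cols, mem_restrict_cols]
          have : v ≠ x := fun h => hv (h ▸ hxS)
          tauto
        · simp only [mem_restrict_cols]
          tauto
    · rw [entry_eq_zero_of_row, entry_eq_zero_of_row]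
      · simp only [mem_pivot_rows, mem_restrict_rows]
        have : u ≠ y := fun h => hu (h ▸ hyS)
        tauto
      · simp only [mem_restrict_rows]
        tauto

theorem Represents.restrict_pivot {hx : x ∈ A.rows} {hy : y ∈ A.cols} (hA : A.IsMatrixOver P)
    (h : (A.restrict S).Represents M) (hxS : x ∈ S) (hyS : y ∈ S) (h0 : A.entry x y ≠ 0) :
    ((A.pivot x y hx hy).restrict S).Represents M := by
  rw [LabelledMatrix.restrict_pivot hxS hyS]
  exact (pivotEquiv_pivot (by rwa [restrict_entry hxS hyS])).represents
    (isMatrixOver_restrict hA S) h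

theorem EntriesIn.pivot {hx : x ∈ A.rows} {hy : y ∈ A.cols} (hA : A.IsMatrixOver P)
    (hK : P.InvClosed K) (h : EntriesIn K A S) (hxS : x ∈ S) (hyS : y ∈ S) :
    EntriesIn K (A.pivot x y hx hy) S := by
  classical
  have hi := inverse_mem hK (entry_mem_elems hA x y) (h x hxS y hyS)
  intro u hu v hv
  simp only [LabelledMatrix.pivot, mk']
  split_ifs
  · exact hi
  · exact K.mul_mem hi (h x hxS v hv)
  · exact K.neg_mem (K.mul_mem hi (h u hu y hyS))
  · exact K.sub_mem (h u hu v hv) (K.mul_mem (K.mul_mem hi (h u hu y hyS)) (h x hxS v hv))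
  · exact K.zero_mem

/-- Pivots inside `A[S]` do not change the matroids, and keep entries in `K`. They are used to make
`p` a column and `s` a row. -/
theorem ParallelSeries.pivot {hx : x ∈ A.rows} {hy : y ∈ A.cols} (hA : A.IsMatrixOver P)
    (hK : P.InvClosed K) (h : ParallelSeries K A S v w p s N₀ Mv Mw) (hxS : x ∈ S) (hyS : y ∈ S)
    (h0 : A.entry x y ≠ 0) :
    ParallelSeries K (A.pivot x y hx hy) S v w p s N₀ Mv Mw := by
  have hwx : w ≠ x := (ne_of_mem_of_not_mem hxS h.w_notMem).symm
  have hwy : w ≠ y := (ne_of_mem_of_not_mem hyS h.w_notMem).symm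
  have hvx : v ≠ x := (ne_of_mem_of_not_mem hxS h.v_notMem).symm
  have hvy : v ≠ y := (ne_of_mem_of_not_mem hyS h.v_notMem).symm
  obtain ⟨a, _, ha⟩ := exists_unit (inverse_mem_elems (entry_mem_elems hA x y))
    (inverse_ne_zero (entry_mem_elems hA x y) h0)
  refine ⟨mem_pivot_rows.2 (Or.inr ⟨h.v_mem, hvx⟩), mem_pivot_cols.2 (Or.inr ⟨h.w_mem, hwy⟩),
    h.v_notMem, h.w_notMem, by rw [pivot_ground]; exact h.p_mem, h.p_mem',
    by rw [pivot_ground]; exact h.s_mem, h.s_mem',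
    h.v_entries.pivot hA hK (Or.inr hxS) (Or.inr hyS),
    h.w_entries.pivot hA hK (Or.inr hxS) (Or.inr hyS), ?_, ?_, ?_,
    h.rep.restrict_pivot hA hxS hyS h0, h.rep_v.restrict_pivot hA (Or.inr hxS) (Or.inr hyS) h0,
    h.rep_w.restrict_pivot hA (Or.inr hxS) (Or.inr hyS) h0, h.parallel, h.series⟩
  · by_contra hcon
    push Not at hcon
    obtain ⟨z, hz, hvz⟩ := h.v_ne
    have h1 := hcon x hxS
    rw [pivot_entry_col hvx hvy, ← ha, neg_eq_zero, Units.mul_right_eq_zero] at h1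
    have hzy : z ≠ y := by rintro rfl; exact hvz h1
    have hzx : z ≠ x := (row_ne_col hx (mem_cols_of_entry hvz)).symm
    have h2 := hcon z hz
    rw [pivot_entry hvx hvy hzx hzy, h1] at h2
    apply hvz
    simpa using h2
  · by_contra hcon
    push Not at hcon
    obtain ⟨z, hz, hzw⟩ := h.w_ne
    have h1 := hcon y hyS
    rw [pivot_entry_row hwx hwy, ← ha, Units.mul_right_eq_zero] at h1
    have hzx : z ≠ x := by rintro rfl; exact hzw h1
    have hzy : z ≠ y := row_ne_col (mem_rows_of_entry hzw) hy
    have h2 := hcon z hz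
    rw [pivot_entry hzx hzy hwx hwy, h1] at h2
    apply hzw
    simpa using h2
  · rw [pivot_entry hvx hvy hwx hwy]
    intro h1
    apply h.entry
    have h2 := K.mul_mem (K.mul_mem (inverse_mem hK (entry_mem_elems hA x y)
      (h.v_entries x (Or.inr hxS) y (Or.inr hyS))) (h.v_entries v (Or.inl rfl) y (Or.inr hyS)))
      (h.w_entries x (Or.inr hxS) w (Or.inl rfl))
    simpa using K.add_mem h1 h2

theorem ParallelSeries.parallel_col (hA : A.IsMatrixOver P)
    (h : ParallelSeries K A S v w p s N₀ Mv Mw) :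
    ∀ x ∈ S, ∀ x' ∈ S, A.entry x w * A.entry x' p = A.entry x p * A.entry x' w := by
  intro x hx x' hx'
  by_contra h0
  obtain ⟨B, h1, h2, h3⟩ := h.rep_v.exists_isBase_of_cols (isMatrixOver_restrict hA _)
    (ne_of_mem_of_not_mem h.p_mem' h.w_notMem).symm (x := x) (x' := x') (by
      have hw : w ∈ insert w S := Set.mem_insert _ _
      have hS : S ⊆ insert w S := Set.subset_insert _ _
      rwa [restrict_entry (hS hx) hw, restrict_entry (hS hx') (hS h.p_mem'),
        restrict_entry (hS hx) (hS h.p_mem'), restrict_entry (hS hx') hw])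
  exact h.parallel B h1 h2 h3

theorem ParallelSeries.parallel_row (hA : A.IsMatrixOver P)
    (h : ParallelSeries K A S v w p s N₀ Mv Mw) (hp : p ∈ A.rows) :
    ∀ x ∈ S, x ≠ p → A.entry x w = 0 := by
  intro x hx hxp
  by_contra h0
  obtain ⟨B, h1, h2, h3⟩ := h.rep_v.exists_isBase_of_col_row (isMatrixOver_restrict hA _)
    (mem_restrict_rows.2 ⟨hp, Or.inr h.p_mem'⟩) hxp (w := w)
    (by rwa [restrict_entry (Set.mem_insert_of_mem w hx) (Set.mem_insert _ _)])
  exact h.parallel B h1 h2 h3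

/-- The transposed matrix has `w` in series with `p` and `v` parallel to `s`. -/
theorem ParallelSeries.transpose (hA : A.IsMatrixOver P)
    (h : ParallelSeries K A S v w p s N₀ Mv Mw) :
    ParallelSeries K A.transpose S w v s p N₀✶ Mw✶ Mv✶ := by
  refine ⟨h.w_mem, h.v_mem, h.w_notMem, h.v_notMem, by rw [transpose_ground]; exact h.s_mem,
    h.s_mem', by rw [transpose_ground]; exact h.p_mem, h.p_mem', h.w_entries.transpose,
    h.v_entries.transpose, h.w_ne, h.v_ne, h.entry, ?_, ?_, ?_, fun B hB hv hs => ?_,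
    fun B hB hw => ?_⟩
  · rw [restrict_transpose]; exact h.rep.dual (isMatrixOver_restrict hA _)
  · rw [restrict_transpose]; exact h.rep_w.dual (isMatrixOver_restrict hA _)
  · rw [restrict_transpose]; exact h.rep_v.dual (isMatrixOver_restrict hA _)
  · exact (h.series _ (Matroid.dual_isBase_iff'.1 hB).1 fun h => h.2 hv).2 hs
  · by_contra hp
    refine h.parallel _ (Matroid.dual_isBase_iff'.1 hB).1 ⟨?_, hw⟩ ⟨?_, hp⟩
    · rw [h.rep_v.ground_eq, restrict_ground]
      exact ⟨mem_ground.2 (Or.inr h.w_mem), Set.mem_insert _ _⟩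
    · rw [h.rep_v.ground_eq, restrict_ground]
      exact ⟨h.p_mem, Or.inr h.p_mem'⟩

/-- A column `p` and a row `s`: as `A[S]` is connected and has a third element, `w` may take the
place of `p`, or `v` the place of `s`. -/
theorem ParallelSeries.hasBadCopy_of_ne (hA : A.IsMatrixOver P) (hK : P.InvClosed K)
    (h : ParallelSeries K A S v w p s N₀ Mv Mw) (hS : Conn A S)
    (hcard : 3 ≤ (A.ground ∩ S).encard) (hp : p ∈ A.cols) (hs : s ∈ A.rows) :
    HasBadCopy P K A S := by
  have hpar := h.parallel_col hA
  have hser := (h.transpose hA).parallel_col (isMatrixOver_transpose hA)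
  by_cases h1 : ∃ j ∈ S, j ≠ p ∧ A.entry v j ≠ 0
  · exact hasBadCopy_of_parallel hA hK hS h.v_mem h.w_mem h.v_notMem h.w_notMem h.v_entries
      h.w_entries h.entry hp h.p_mem' hpar h.w_ne h1
  by_cases h2 : ∃ i ∈ S, i ≠ s ∧ A.entry i w ≠ 0
  · exact (hasBadCopy_of_parallel (isMatrixOver_transpose hA) hK hS.transpose h.w_mem h.v_mem
      h.w_notMem h.v_notMem h.w_entries.transpose h.v_entries.transpose h.entry hs h.s_mem' hser
      h.v_ne h2).transpose
  push Not at h1 h2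
  exfalso
  have hvp : A.entry v p ≠ 0 := by
    obtain ⟨y, hy, hvy⟩ := h.v_ne
    by_cases hyp : y = p
    · rwa [← hyp]
    · exact absurd (h1 y hy hyp) hvy
  have hsw : A.entry s w ≠ 0 := by
    obtain ⟨x, hx, hxw⟩ := h.w_ne
    by_cases hxs : x = s
    · rwa [← hxs]
    · exact absurd (h2 x hx hxs) hxw
  -- the row `s` and the column `p` are nonzero on `S` in the entry `sp` only
  have h3 : ∀ i ∈ S, i ≠ s → A.entry i p = 0 := by
    intro i hi his
    by_contra h0
    have := hpar i hi s h.s_mem'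
    rw [h2 i hi his, zero_mul] at this
    exact mul_ne_zero (entry_mem_elems hA i p) h0 hsw this.symm
  have h4 : ∀ j ∈ S, j ≠ p → A.entry s j = 0 := by
    intro j hj hjp
    by_contra h0
    have : A.entry v j * A.entry s p = A.entry s j * A.entry v p := hser j hj p h.p_mem'
    rw [h1 j hj hjp, zero_mul] at this
    exact mul_ne_zero (entry_mem_elems hA s j) h0 hvp this.symm
  have hsub : A.ground ∩ S ⊆ {s, p} := by
    rintro t ⟨ht, htS⟩
    refine hS {s, p} ?_ ⟨p, h.p_mem, h.p_mem', by simp⟩ t ht htS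
    intro x hx y hy hxy
    have hxp : x ≠ p := row_ne_col (mem_rows_of_entry hxy) hp
    have hys : y ≠ s := (row_ne_col hs (mem_cols_of_entry hxy)).symm
    simp only [Set.mem_insert_iff, Set.mem_singleton_iff, hxp, hys, or_false, false_or]
    constructor
    · rintro rfl
      by_contra hyp
      exact hxy (h4 y hy hyp)
    · rintro rfl
      by_contra hxs
      exact hxy (h3 x hx hxs)
  have h5 := hcard.trans (Set.encard_le_encard hsub)
  rw [Set.encard_pair (row_ne_col hs hp)] at h5
  exact absurd h5 (by norm_num)

/-- If neither the row `v` nor the column `w` extends the copy of `N` to a 3-connected matroid,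
another copy of `N` is extended by a single bad label. -/
theorem ParallelSeries.hasWitness (hA : A.IsMatrixOver P) (hK : P.InvClosed K)
    (hM : A.Represents M) (hM3 : M.IsKConnected 3)
    (h : ParallelSeries K A S v w p s N₀ Mv Mw) (hN₀ : N.IsIsomorphicTo N₀) (h3 : N.IsKConnected 3)
    (hcard : 3 ≤ N₀.E.encard) : HasWitness P K A N := by
  have hN3 := hN₀.isKConnected h3
  have conn : ∀ {C : LabelledMatrix α R}, ParallelSeries K C S v w p s N₀ Mv Mw → Conn C S :=
    fun hC => (hC.rep.conn hN3).of_restrict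
  have card : ∀ {C : LabelledMatrix α R}, ParallelSeries K C S v w p s N₀ Mv Mw →
      3 ≤ (C.ground ∩ S).encard := by
    intro C hC
    rwa [hC.rep.ground_eq, restrict_ground] at hcard
  have third : ∀ {C : LabelledMatrix α R}, ParallelSeries K C S v w p s N₀ Mv Mw → ∀ q,
      ∃ z ∈ C.ground, z ∈ S ∧ z ≠ q := by
    intro C hC q
    by_contra hcon
    push Not at hcon
    have h1 : C.ground ∩ S ⊆ {q} := fun t ht => hcon t ht.1 ht.2
    have h2 := (card hC).trans (Set.encard_le_encard h1)
    rw [Set.encard_singleton] at h2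
    exact absurd h2 (by norm_num)
  have done : ∀ {C : LabelledMatrix α R}, C.IsMatrixOver P → C.Represents M →
      ParallelSeries K C S v w p s N₀ Mv Mw → HasBadCopy P K C S → HasWitness P K C N :=
    fun hC hMC hPS hb => hb.hasWitness hC hMC hPS.rep hN₀ h3
  -- a label of `S` can be turned from a row to a column by a pivot in `A[S]`, and conversely
  by_cases hps : p = s
  · subst hps
    have row : ∀ {C : LabelledMatrix α R}, C.IsMatrixOver P → C.Represents M →
        ParallelSeries K C S v w p p N₀ Mv Mw → p ∈ C.rows → HasWitness P K C N := by
      intro C hC hMC hPS hp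
      refine done hC hMC hPS (hasBadCopy_of_line hC hK (fun A' hA' => (hA'.represents hC
        hMC).noTwoSep (hA'.isMatrixOver hC) hM3) (card hPS) (conn hPS) hPS.v_mem hPS.w_mem
        hPS.v_notMem hPS.w_notMem hPS.v_entries hPS.w_entries hPS.entry hp hPS.p_mem'
        (hPS.parallel_row hC hp) ((hPS.transpose hC).parallel_col (isMatrixOver_transpose hC))
        hPS.w_ne hPS.v_ne)
    rcases mem_ground.1 h.p_mem with hp | hp
    · exact row hA hM h hp
    · obtain ⟨x, hxS, hxp⟩ := (conn h).exists_entry_col hp h.p_mem' (third h p)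
      have hpiv := pivotEquiv_pivot (P := P) (hx := mem_rows_of_entry hxp) (hy := hp) hxp
      exact (row (hpiv.isMatrixOver hA) (hpiv.represents hA hM) (h.pivot hA hK hxS h.p_mem' hxp)
        (mem_pivot_rows.2 (Or.inl rfl))).of_pivotEquiv hpiv
  · have col_row : ∀ {C : LabelledMatrix α R}, C.IsMatrixOver P → C.Represents M →
        ParallelSeries K C S v w p s N₀ Mv Mw → p ∈ C.cols → s ∈ C.rows → HasWitness P K C N :=
      fun hC hMC hPS hp hs => done hC hMC hPS
        (hPS.hasBadCopy_of_ne hC hK (conn hPS) (card hPS) hp hs)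
    have col : ∀ {C : LabelledMatrix α R}, C.IsMatrixOver P → C.Represents M →
        ParallelSeries K C S v w p s N₀ Mv Mw → p ∈ C.cols → HasWitness P K C N := by
      intro C hC hMC hPS hp
      rcases mem_ground.1 hPS.s_mem with hs | hs
      · exact col_row hC hMC hPS hp hs
      · obtain ⟨x, hxS, hxs⟩ := (conn hPS).exists_entry_col hs hPS.s_mem' (third hPS s)
        have hpiv := pivotEquiv_pivot (P := P) (hx := mem_rows_of_entry hxs) (hy := hs) hxs
        exact (col_row (hpiv.isMatrixOver hC) (hpiv.represents hC hMC)
          (hPS.pivot hC hK hxS hPS.s_mem' hxs) (mem_pivot_cols.2 (Or.inr ⟨hp, hps⟩))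
          (mem_pivot_rows.2 (Or.inl rfl))).of_pivotEquiv hpiv
    rcases mem_ground.1 h.p_mem with hp | hp
    · obtain ⟨y, hyS, hpy⟩ := (conn h).exists_entry_row hp h.p_mem' (third h p)
      have hpiv := pivotEquiv_pivot (P := P) (hx := hp) (hy := mem_cols_of_entry hpy) hpy
      exact (col (hpiv.isMatrixOver hA) (hpiv.represents hA hM) (h.pivot hA hK h.p_mem' hyS hpy)
        (mem_pivot_cols.2 (Or.inl rfl))).of_pivotEquiv hpiv
    · exact col hA hM h hp

end LabelledMatrix

/-! ### Existence of a witness -/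

namespace LabelledMatrix

variable {α R : Type*} [CommRing R] {P : PartialField R} {K : Subring R}
variable {A A₁ A' B : LabelledMatrix α R} {S T : Set α} {M N N₀ Mv Mw : Matroid α}
variable {p s u v w x y : α}

/-- If adding the nonzero column `w` to a 3-connected matroid does not give a 3-connected one, then
`w` is parallel to some element `p`. -/
theorem Represents.exists_parallel (hA : A.IsMatrixOver P)
    (h : (A.restrict (insert w S)).Represents M) (h₀ : (A.restrict S).Represents N₀)
    (h3 : N₀.IsKConnected 3) (hM3 : ¬ M.IsKConnected 3) (hw : w ∈ A.cols) (hwS : w ∉ S)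
    (hwd : ∃ x ∈ S, A.entry x w ≠ 0) :
    3 ≤ N₀.E.encard ∧ ∃ p ∈ A.ground, p ∈ S ∧ ∀ B, M.IsBase B → w ∈ B → p ∉ B := by
  have hd := (h.delete_insert hw hwS).unique h₀
  obtain ⟨x, hx, hxw⟩ := hwd
  have hwT : w ∈ insert w S := Set.mem_insert _ _
  have hw' : w ∈ (A.restrict (insert w S)).cols := mem_restrict_cols.2 ⟨hw, hwT⟩
  have hxw' : (A.restrict (insert w S)).entry x w ≠ 0 := by
    rwa [restrict_entry (Set.mem_insert_of_mem w hx) hwT]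
  have hE : M.E = A.ground ∩ insert w S := by rw [h.ground_eq, restrict_ground]
  have hwE : w ∈ M.E := by rw [hE]; exact ⟨mem_ground.2 (Or.inr hw), hwT⟩
  have := h.finite
  by_contra hcon
  apply hM3
  refine Matroid.isKConnected_of_delete hwE (by rwa [hd]) ?_ ⟨_, h.isBase_rows, notMem_rows hw'⟩ ?_
  · exact ⟨_, ((pivotEquiv_pivot (P := P) (hx := mem_rows_of_entry hxw') (hy := hw')
      hxw').represents (isMatrixOver_restrict hA _) h).isBase_rows, mem_pivot_rows.2 (Or.inl rfl)⟩
  · intro hcard q hq hqw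
    by_contra hcon'
    push Not at hcon'
    rw [hE] at hq
    exact hcon ⟨by rw [← hd]; exact hcard, q, hq.1, hq.2.resolve_left hqw, hcon'⟩

theorem conn_insert_col (hS : Conn A S) (hw : w ∈ A.cols) (hwd : ∃ x ∈ S, A.entry x w ≠ 0) :
    Conn A (insert w S) :=
  (conn_insert_row (A := A.transpose) hS.transpose hw hwd).transpose

/-- In a `BadTwo` all entries other than `vw` are in `K`; by rigidity no scaling of the row `v`
moves the entry `vw` into `K`. -/
theorem not_scalesInto_insert_insert (hA : A.IsMatrixOver P) (hK : P.InvClosed K) (hS : Conn A S)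
    (hw : w ∈ A.cols) (hwd : ∃ x ∈ S, A.entry x w ≠ 0) (hvd : ∃ y ∈ S, A.entry v y ≠ 0)
    (hvK : EntriesIn K A (insert v S)) (hwK : EntriesIn K A (insert w S)) (hne : A.entry v w ∉ K) :
    ¬ ScalesInto P K A (insert v (insert w S)) := by
  intro h
  obtain ⟨g, hg, hgK⟩ := exists_row_scale hA hK (conn_insert_col hS hw hwd) hwK h
  obtain ⟨y, hy, hvy⟩ := hvd
  have h1 := mem_of_mul_mem hK (entry_mem_elems hA v y) hvy (hvK v (Or.inl rfl) y (Or.inr hy))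
    (hgK y (Or.inr hy))
  refine hne (mem_of_mul_mem hK (coe_mem_elems hg) (units_ne_zero hvy g) h1 ?_)
  rw [mul_comm]
  exact hgK w (Or.inl rfl)

/-- If the row `v` or the column `w` of a `BadTwo` extends the copy of `N` to a 3-connected matroid
then so do both together; otherwise they are in series and in parallel with elements of the copy. -/
theorem BadTwo.hasWitness (h : BadTwo K A S) (hA : A.IsMatrixOver P) (hK : P.InvClosed K)
    (hM : A.Represents M) (hM3 : M.IsKConnected 3) (h₀ : (A.restrict S).Represents N₀)
    (hN₀ : N.IsIsomorphicTo N₀) (h3 : N.IsKConnected 3) : HasWitness P K A N := by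
  obtain ⟨v, hv, w, hw, hvS, hwS, hvd, hwd, hvK, hwK, hne⟩ := h
  have hN3 := hN₀.isKConnected h3
  have hS : Conn A S := (h₀.conn hN3).of_restrict
  have hSK : EntriesIn K A S := hvK.mono (Set.subset_insert _ _)
  have hvw : v ≠ w := row_ne_col hv hw
  have hvS' : v ∉ insert w S := by rintro (h | h); exacts [hvw h, hvS h]
  have hwS' : w ∉ insert v S := by rintro (h | h); exacts [hvw h.symm, hwS h]
  have hbad := not_scalesInto_insert_insert hA hK hS hw hwd hvd hvK hwK hne
  obtain ⟨M', h1, _⟩ := hM.exists_minor hA (insert v (insert w S))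
  have h1' := h1
  rw [Set.insert_comm] at h1'
  have hMv := h1.contract_insert hA hv hvS'
  have hMw := h1'.delete_insert hw hwS'
  have hd : N₀ = (M'.contract {v}).delete {w} := h₀.unique (hMv.delete_insert hw hwS)
  have hE : M'.E = A.ground ∩ insert v (insert w S) := by rw [h1.ground_eq, restrict_ground]
  have hvE : v ∈ M'.E := by rw [hE]; exact ⟨mem_ground.2 (Or.inl hv), Set.mem_insert _ _⟩
  have hwE : w ∈ M'.E := by
    rw [hE]; exact ⟨mem_ground.2 (Or.inr hw), Or.inr (Set.mem_insert _ _)⟩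
  have finish : M'.IsKConnected 3 →
      ((M'.contract {v}).IsKConnected 3 ∨ (M'.delete {w}).IsKConnected 3) → HasWitness P K A N :=
    fun hM' hor => ⟨A, S, _, N₀, M', PivotEquiv.refl A, h₀, hN₀, hSK,
      (Set.subset_insert _ _).trans (Set.subset_insert _ _), h1, hM', hbad,
      Or.inr (Or.inr ⟨v, hvE, w, hwE, hvw, hd, hor⟩)⟩
  by_cases hv3 : (M'.contract {v}).IsKConnected 3
  · exact finish (h1.isKConnected_insert hA hMv hv3 (mem_ground.2 (Or.inl hv)) hvS' hwK hbad)
      (Or.inl hv3)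
  by_cases hw3 : (M'.delete {w}).IsKConnected 3
  · rw [Set.insert_comm] at hbad
    exact finish (h1'.isKConnected_insert hA hMw hw3 (mem_ground.2 (Or.inr hw)) hwS' hvK hbad)
      (Or.inr hw3)
  obtain ⟨hcard, p, hp, hpS, hpar⟩ := hMv.exists_parallel hA h₀ hN3 hv3 hw hwS hwd
  have hMw' := hMw.dual (isMatrixOver_restrict hA _)
  have h₀' := h₀.dual (isMatrixOver_restrict hA _)
  rw [← restrict_transpose] at hMw' h₀'
  have := h₀.finite
  have := hMw.finite
  obtain ⟨_, s, hs, hsS, hser⟩ := hMw'.exists_parallel (isMatrixOver_transpose hA) h₀' hN3.dual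
    (fun h => hw3 (by simpa using h.dual)) hv hvS hvd
  rw [transpose_ground] at hs
  refine ParallelSeries.hasWitness hA hK hM hM3 (v := v) (w := w) (p := p) (s := s)
    ⟨hv, hw, hvS, hwS, hp, hpS, hs, hsS, hvK, hwK, hvd, hwd, hne, h₀, hMv, hMw, hpar, ?_⟩ hN₀ h3
    hcard
  intro B hB hvB
  by_contra hsB
  have hEw : (M'.delete {w}).E = A.ground ∩ insert v S := by
    rw [hMw.ground_eq, restrict_ground]
  refine hser _ hB.compl_isBase_dual ⟨?_, hvB⟩ ⟨?_, hsB⟩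
  · rw [hEw]; exact ⟨mem_ground.2 (Or.inl hv), Set.mem_insert _ _⟩
  · rw [hEw]; exact ⟨hs, Or.inr hsS⟩

/-- A matrix that represents a 3-connected matroid, contains a matrix over `K` that represents a
copy of `N`, and cannot be scaled into `K`, contains a small submatrix with this property. -/
theorem hasWitness_of_not_scalesInto (hA : A.IsMatrixOver P) (hK : P.InvClosed K)
    (hM : A.Represents M) (hM3 : M.IsKConnected 3) (h₀ : (A.restrict S).Represents N₀)
    (hN₀ : N.IsIsomorphicTo N₀) (h3 : N.IsKConnected 3) (hcard : 2 ≤ N.E.encard)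
    (hSK : EntriesIn K A S) (hbad : ¬ ScalesInto P K A Set.univ) : HasWitness P K A N := by
  have hS : Conn A S := (h₀.conn (hN₀.isKConnected h3)).of_restrict
  have hcard' : 2 ≤ (A.ground ∩ S).encard := by
    rwa [← restrict_ground, ← h₀.ground_eq, hN₀.encard_ground]
  obtain ⟨A', h1, h2, h4⟩ := exists_badOne_or_badTwo hA hK
    (fun A' hA' => (hA'.represents hA hM).noTwoSep (hA'.isMatrixOver hA) hM3) (hM.conn hM3) hbad
    hcard' hS hSK
  have hA' := h1.isMatrixOver hA
  have hM' := h1.represents hA hM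
  rw [← h2.restrict_eq] at h₀
  refine HasWitness.of_pivotEquiv h1 ?_
  rcases h4 with ⟨v, hv, hvS, h5⟩ | h5
  · exact hasWitness_of_insert hA' hM' h₀ hN₀ h3 hv hvS (h2.entriesIn hSK) h5
  · exact h5.hasWitness hA' hK hM' hM3 h₀ hN₀ h3

/-! ### Minors of labelled matrices -/

theorem deleteRow_eq_restrict (hx : x ∈ A.rows) : A.deleteRow x = A.restrict {x}ᶜ := by
  classical
  apply ext'
  · ext z
    simp [deleteRow, mk', mem_restrict_rows, and_comm]
  · ext z
    rw [mem_restrict_cols]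
    exact ⟨fun hz => ⟨hz, (row_ne_col hx hz).symm⟩, fun hz => hz.1⟩
  · intro u v
    by_cases hv : v ∈ A.cols
    · have hvx : v ≠ x := (row_ne_col hx hv).symm
      by_cases hux : u = x
      · rw [entry_eq_zero_of_row, entry_eq_zero_of_row]
        · rw [mem_restrict_rows]; simp [hux]
        · simp [deleteRow, mk', hux]
      · rw [restrict_entry hux hvx]
        by_cases hu : u ∈ A.rows
        · simp [deleteRow, mk', hux, hu, hv]
        · simp [deleteRow, mk', hu, entry_eq_zero_of_row hu]
    · rw [entry_eq_zero_of_col, entry_eq_zero_of_col]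
      · rw [mem_restrict_cols]; tauto
      · exact hv

theorem deleteCol_transpose : (A.deleteCol y).transpose = A.transpose.deleteRow y := by
  classical
  refine ext' (by rfl) (by rfl) fun u v => ?_
  simp only [LabelledMatrix.transpose, deleteCol, deleteRow, mk', and_comm]

theorem deleteCol_eq_restrict (hy : y ∈ A.cols) : A.deleteCol y = A.restrict {y}ᶜ := by
  have h := deleteRow_eq_restrict (A := A.transpose) hy
  rw [← deleteCol_transpose, restrict_transpose] at h
  exact congrArg LabelledMatrix.transpose h

open Classical in
theorem scaleRow_eq_scale {g : Rˣ} :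
    A.scaleRow x g = A.scale (fun z => if z = x then g else 1) fun _ => 1 := by
  refine ext' rfl rfl fun u v => ?_
  by_cases hu : u ∈ A.rows
  · by_cases hv : v ∈ A.cols
    · by_cases hux : u = x <;> simp [scaleRow, mk', scale, hu, hv, hux]
      subst hux
      simp [hu]
    · simp [scaleRow, mk', scale, hv, entry_eq_zero_of_col hv]
  · simp [scaleRow, mk', scale, hu, entry_eq_zero_of_row hu]

open Classical in
theorem scaleCol_eq_scale {g : Rˣ} :
    A.scaleCol y g = A.scale (fun _ => 1) fun z => if z = y then g else 1 := by
  refine ext' rfl rfl fun u v => ?_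
  by_cases hu : u ∈ A.rows
  · by_cases hv : v ∈ A.cols
    · by_cases hvy : v = y
      · subst hvy
        simp [scaleCol, mk', scale, hu, hv, mul_comm]
      · simp [scaleCol, mk', scale, hu, hv, hvy]
    · simp [scaleCol, mk', scale, hv, entry_eq_zero_of_col hv]
  · simp [scaleCol, mk', scale, hu, entry_eq_zero_of_row hu]

theorem restrict_scale {r c : α → Rˣ} : (A.scale r c).restrict S = (A.restrict S).scale r c := by
  refine ext' rfl rfl fun x y => ?_
  by_cases hx : x ∈ S <;> by_cases hy : y ∈ S <;> simp [restrict, scale, hx, hy]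

/-- Deletions can be postponed: a minor is a submatrix of a matrix obtained by scaling and
pivoting. -/
theorem IsMinorOver.exists_restrict (h : IsMinorOver P A₁ A) :
    ∃ A' S, PivotEquiv P A A' ∧ A₁ = A'.restrict S := by
  classical
  induction h with
  | refl => exact ⟨A, Set.univ, PivotEquiv.refl A, (restrict_eq_self (Set.subset_univ _)).symm⟩
  | tail _ hstep ih =>
    obtain ⟨A', S, h1, rfl⟩ := ih
    have hite : ∀ (a : α) (g : Rˣ), g ∈ P.units → ∀ z, (if z = a then g else 1) ∈ P.units := by
      intro a g hg z
      split_ifs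
      · exact hg
      · exact P.units.one_mem
    cases hstep with
    | scaleRow x hx g hg =>
      obtain ⟨g, hg, rfl⟩ := hg
      exact ⟨_, S, h1.trans (pivotEquiv_scale (hite x g hg) fun _ => P.units.one_mem),
        by rw [restrict_scale, scaleRow_eq_scale]⟩
    | scaleCol y hy g hg =>
      obtain ⟨g, hg, rfl⟩ := hg
      exact ⟨_, S, h1.trans (pivotEquiv_scale (fun _ => P.units.one_mem) (hite y g hg)),
        by rw [restrict_scale, scaleCol_eq_scale]⟩
    | deleteRow x hx => exact ⟨A', _, h1, by rw [deleteRow_eq_restrict hx, restrict_restrict]⟩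
    | deleteCol y hy => exact ⟨A', _, h1, by rw [deleteCol_eq_restrict hy, restrict_restrict]⟩
    | pivot x y hx hy h0 =>
      have hx' := mem_restrict_rows.1 hx
      have hy' := mem_restrict_cols.1 hy
      rw [restrict_entry hx'.2 hy'.2] at h0
      exact ⟨_, S, h1.trans (pivotEquiv_pivot (hx := hx'.1) (hy := hy'.1) h0),
        by rw [restrict_pivot hx'.2 hy'.2]⟩

theorem isMinorOver_restrict (A : LabelledMatrix α R) (S : Set α) :
    IsMinorOver P (A.restrict S) A := by
  obtain ⟨n, hn⟩ : ∃ n, (A.ground \ S).ncard = n := ⟨_, rfl⟩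
  induction n generalizing A with
  | zero =>
    rw [Set.ncard_eq_zero (A.ground_finite.subset Set.sdiff_subset), Set.sdiff_eq_empty] at hn
    rw [restrict_eq_self hn]
    exact Relation.ReflTransGen.refl
  | succ n ih =>
    obtain ⟨z, hz, hzS⟩ : (A.ground \ S).Nonempty := by
      rw [← Set.ncard_pos (A.ground_finite.subset Set.sdiff_subset)]; omega
    have hrr : (A.restrict {z}ᶜ).restrict S = A.restrict S := by
      rw [restrict_restrict, Set.inter_eq_right.2]
      simpa using hzS
    have hcard : ((A.restrict {z}ᶜ).ground \ S).ncard = n := by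
      have : (A.restrict {z}ᶜ).ground \ S = (A.ground \ S) \ {z} := by
        rw [restrict_ground]; ext t; simp; tauto
      rw [this, Set.ncard_sdiff_singleton_of_mem (by exact ⟨hz, hzS⟩), hn]
      rfl
    have h1 := ih (A.restrict {z}ᶜ) hcard
    rw [hrr] at h1
    refine Relation.ReflTransGen.head ?_ h1
    rcases mem_ground.1 hz with hz | hz
    · rw [← deleteRow_eq_restrict hz]
      exact MinorStep.deleteRow A z hz
    · rw [← deleteCol_eq_restrict hz]
      exact MinorStep.deleteCol A z hz

/-- If `A` is scaled into `K`, a pivot of `A` is scaled into `K` by interchanging the inverses of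
the factors of the pivot row and the pivot column. -/
theorem ScalesInto.pivot {hx : x ∈ A.rows} {hy : y ∈ A.cols} (hA : A.IsMatrixOver P)
    (hK : P.InvClosed K) (h0 : A.entry x y ≠ 0) (h : ScalesInto P K A Set.univ) :
    ScalesInto P K (A.pivot x y hx hy) Set.univ := by
  classical
  obtain ⟨r, c, hr, hc, h⟩ := h
  obtain ⟨a, ha, ha'⟩ := exists_unit (entry_mem_elems hA x y) h0
  have ht := h x trivial y trivial
  rw [← ha', ← Units.val_mul, ← Units.val_mul] at ht
  have hi := hK _ (P.units.mul_mem (P.units.mul_mem (hr x) ha) (hc y)) ht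
  rw [mul_inv, mul_inv, Units.val_mul, Units.val_mul] at hi
  refine ⟨fun z => if z = y then (c y)⁻¹ else r z, fun z => if z = x then (r x)⁻¹ else c z, ?_, ?_,
    fun u _ v _ => ?_⟩
  · intro z
    beta_reduce
    split_ifs
    exacts [P.units.inv_mem (hc y), hr z]
  · intro z
    beta_reduce
    split_ifs
    exacts [P.units.inv_mem (hr x), hc z]
  have hux := h u trivial y trivial
  have hxv := h x trivial v trivial
  have huv := h u trivial v trivial
  simp only [LabelledMatrix.pivot, mk', ← ha', Ring.inverse_unit]
  by_cases hin : u ∈ insert y (A.rows.erase x) ∧ v ∈ insert x (A.cols.erase y)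
  swap
  · rw [if_neg hin, mul_zero, zero_mul]
    exact K.zero_mem
  rw [if_pos hin]
  by_cases h1 : u = y
  · by_cases h2 : v = x
    · simp only [h1, h2, if_true]
      convert hi using 1
      ring
    · simp only [h1, h2, if_true, if_false]
      convert K.mul_mem hi hxv using 1
      linear_combination (-(((c y)⁻¹ : Rˣ) : R) * (a⁻¹ : Rˣ) * A.entry x v * c v) * (r x).inv_mul
  · by_cases h2 : v = x
    · simp only [h1, h2, if_true, if_false]
      convert K.neg_mem (K.mul_mem hi hux) using 1
      linear_combination
        ((((r x)⁻¹ : Rˣ) : R) * (a⁻¹ : Rˣ) * A.entry u y * r u) * (c y).inv_mul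
    · simp only [h1, h2, if_false]
      convert K.sub_mem huv (K.mul_mem (K.mul_mem hi hux) hxv) using 1
      linear_combination
        ((a⁻¹ : Rˣ) * A.entry u y * A.entry x v * r u * c v : R) * (r x).inv_mul +
        ((a⁻¹ : Rˣ) * A.entry u y * A.entry x v * r u * c v * (((r x)⁻¹ : Rˣ) * r x) : R) *
          (c y).inv_mul

theorem ScalesInto.scale {r c : α → Rˣ} (hr : ∀ x, r x ∈ P.units) (hc : ∀ y, c y ∈ P.units)
    (h : ScalesInto P K A S) : ScalesInto P K (A.scale r c) S := by
  refine ScalesInto.of_scale (A := A.scale r c) (r := fun x => (r x)⁻¹) (c := fun y => (c y)⁻¹)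
    (fun x => P.units.inv_mem (hr x)) (fun y => P.units.inv_mem (hc y)) ?_
  convert h using 1
  exact ext' rfl rfl fun x y => by simp [LabelledMatrix.scale, mul_assoc]

/-- Scaling and pivoting can be undone, so that they do not make a bad matrix good. -/
theorem ScalesInto.of_pivotEquiv (h : PivotEquiv P A A') (hA : A.IsMatrixOver P)
    (hK : P.InvClosed K)
    (hs : ScalesInto P K A' Set.univ) : ScalesInto P K A Set.univ := by
  induction h with
  | refl => exact hs
  | tail hAB h ih =>
    have hB := PivotEquiv.isMatrixOver hAB hA
    cases h with
    | scale r c hr hc => exact ih (ScalesInto.of_scale hr hc hs)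
    | pivot x y hx hy h =>
      refine ih ?_
      have hne := inverse_ne_zero (entry_mem_elems hB x y) h
      rw [← pivot_entry_pivot (hx := hx) (hy := hy)] at hne
      have := ScalesInto.pivot (hx := mem_pivot_rows.2 (Or.inl rfl))
        (hy := mem_pivot_cols.2 (Or.inl rfl)) (isMatrixOver_pivot hB h) hK hne hs
      rwa [pivot_pivot hB h] at this

/-- A minor of a matrix that can be scaled into `K` can be scaled into `K`. -/
theorem IsMinorOver.scalesInto (h : IsMinorOver P A₁ A) (hA : A.IsMatrixOver P)
    (hK : P.InvClosed K) (hs : ScalesInto P K A Set.univ) : ScalesInto P K A₁ Set.univ := by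
  obtain ⟨A', S, h1, rfl⟩ := h.exists_restrict
  rw [scalesInto_restrict_iff]
  refine ScalesInto.mono ?_ (Set.subset_univ S)
  clear h
  induction h1 with
  | refl => exact hs
  | tail hAB h ih =>
    cases h with
    | scale r c hr hc => exact ScalesInto.scale hr hc ih
    | pivot x y hx hy h => exact ScalesInto.pivot (PivotEquiv.isMatrixOver hAB hA) hK h ih

end LabelledMatrix

/-! ### Induced sub-partial fields -/

namespace PartialField

variable {R : Type*} [CommRing R] {P : PartialField R} {R' R'' : Subring R} {P' : PartialField R'}

/-- A subring that induces a sub-partial field contains the inverses of its elements of `G`: they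
are the inverses in `G'`. -/
theorem invClosed_of_eq (h : R'.subtype '' P'.unitSet = P.unitSet ∩ (R'' : Set R)) :
    P.InvClosed R'' := by
  intro u hu huR
  have h1 : (u : R) ∈ R'.subtype '' P'.unitSet := by rw [h]; exact ⟨⟨u, hu, rfl⟩, huR⟩
  obtain ⟨_, ⟨u', hu', rfl⟩, huu'⟩ := h1
  have h2 : R'.subtype ((u'⁻¹ : R'ˣ) : R') ∈ R'.subtype '' P'.unitSet :=
    ⟨_, ⟨u'⁻¹, P'.units.inv_mem hu', rfl⟩, rfl⟩
  rw [h] at h2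
  have h3 : ((u⁻¹ : Rˣ) : R) = R'.subtype ((u'⁻¹ : R'ˣ) : R') := by
    rw [Units.inv_eq_of_mul_eq_one_right]
    rw [← huu', ← map_mul, Units.mul_inv, map_one]
  rw [h3]
  exact h2.2

end PartialField

namespace LabelledMatrix

variable {α R : Type*} [CommRing R] {P : PartialField R} {R' R'' : Subring R}
variable {P' : PartialField R'} {A : LabelledMatrix α R} {B : LabelledMatrix α R'} {M N : Matroid α}

/-- The entries of a `P'`-matrix lie in `G' ∪ {0}`, hence in `R''`. -/
theorem entry_map_mem (h : R'.subtype '' P'.unitSet = P.unitSet ∩ (R'' : Set R))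
    (hB : B.IsMatrixOver P') (x y : α) : (B.map R'.subtype).entry x y ∈ R'' := by
  rcases entry_mem_elems hB x y with h1 | h1
  · have h2 : R'.subtype (B.entry x y) ∈ R'.subtype '' P'.unitSet := ⟨_, h1, rfl⟩
    rw [h] at h2
    exact h2.2
  · have h2 : B.entry x y = 0 := h1
    change R'.subtype (B.entry x y) ∈ R''
    rw [h2, map_zero]
    exact R''.zero_mem

/-- A matrix over `P` with entries in `R''` is a matrix over `G ∩ R''`. -/
theorem exists_map_eq (hle : R'' ≤ R') (h : R'.subtype '' P'.unitSet = P.unitSet ∩ (R'' : Set R))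
    (hA : A.IsMatrixOver P) (hAK : ∀ x y, A.entry x y ∈ R'') :
    ∃ B : LabelledMatrix α R', B.IsMatrixOver P' ∧ B.map R'.subtype = A := by
  refine ⟨⟨A.rows, A.cols, A.disjoint, fun x y => ⟨A.entry x y, hle (hAK x y)⟩,
    fun x y hxy => Subtype.ext (A.entry_eq_zero x y hxy)⟩, ?_, ext' rfl rfl fun _ _ => rfl⟩
  intro n f g
  have h1 := hA n f g
  set D : R' := (Matrix.of fun i j => (⟨A.entry (f i) (g j), hle (hAK _ _)⟩ : R')).det with hD
  have h2 : (D : R) = (Matrix.of fun i j => A.entry (f i) (g j)).det := by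
    change R'.subtype D = _
    rw [hD, RingHom.map_det]
    rfl
  have h3 : (D : R) ∈ R'' := by
    rw [h2, Matrix.det_apply]
    refine R''.sum_mem fun σ _ => ?_
    rw [Units.smul_def]
    exact R''.zsmul_mem (R''.prod_mem fun i _ => hAK _ _) _
  rw [← h2] at h1
  rcases h1 with h1 | h1
  · have h4 : (D : R) ∈ R'.subtype '' P'.unitSet := by rw [h]; exact ⟨h1, h3⟩
    obtain ⟨d, hd, hdD⟩ := h4
    have : d = D := Subtype.ext hdD
    exact Or.inl (this ▸ hd)
  · exact Or.inr (Subtype.ext h1)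

/-- The inclusion of `R'` is injective, so that it preserves whether determinants vanish. -/
theorem represents_map_iff : (B.map R'.subtype).Represents M ↔ B.Represents M := by
  classical
  have hinj : Function.Injective R'.subtype := Subtype.val_injective
  have haug : ∀ x z, (B.map R'.subtype).augEntry x z = R'.subtype (B.augEntry x z) := by
    intro x z
    have hr : (B.map R'.subtype).rows = B.rows := rfl
    simp only [augEntry, hr]
    split_ifs
    · exact (map_one _).symm
    · exact (map_zero _).symm
    · rfl
  have hnon : ∀ C : Set α, (B.map R'.subtype).Nonsing C ↔ B.Nonsing C := by
    intro C
    refine exists_congr fun f => ?_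
    have : (Matrix.of fun i j : B.rows => (B.map R'.subtype).augEntry i (f j)) =
        R'.subtype.mapMatrix (Matrix.of fun i j : B.rows => B.augEntry i (f j)) := by
      ext i j
      exact haug i (f j)
    change (Matrix.of fun i j : B.rows => (B.map R'.subtype).augEntry i (f j)).det ≠ 0 ↔ _
    rw [this, ← RingHom.map_det, ne_eq, map_eq_zero_iff _ hinj]
    exact Iff.rfl
  rw [represents_iff, represents_iff]
  exact and_congr Iff.rfl (forall_congr' fun C => by rw [hnon]; rfl)

/-- Being a scaled `P'`-matrix means that the entries can be scaled into `R''`. -/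
theorem isScaledMatrix_iff (hle : R'' ≤ R')
    (h : R'.subtype '' P'.unitSet = P.unitSet ∩ (R'' : Set R)) (hA : A.IsMatrixOver P) :
    IsScaledMatrix P P' A ↔ ScalesInto P R'' A Set.univ := by
  constructor
  · rintro ⟨B, hB, _, _, r, c, hr, hc, hrc⟩
    choose r' hr' hrr' using hr
    choose c' hc' hcc' using hc
    refine ⟨r', c', hr', hc', fun x _ y _ => ?_⟩
    rw [hrr', hcc', ← hrc]
    exact entry_map_mem h hB x y
  · rintro ⟨r, c, hr, hc, hrc⟩
    obtain ⟨B, hB, hBA⟩ := exists_map_eq (A := A.scale r c) hle h (isMatrixOver_scale hA hr hc)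
      fun x y => hrc x trivial y trivial
    refine ⟨B, hB, ?_⟩
    rw [hBA]
    exact ⟨rfl, rfl, fun x => r x, fun y => c y, fun x => ⟨r x, hr x, rfl⟩,
      fun y => ⟨c y, hc y, rfl⟩, fun _ _ => rfl⟩

end LabelledMatrix

open LabelledMatrix

theorem theorem1p4 {α : Type*} {R : Type*} [CommRing R] (P : PartialField R)
    {R' : Subring R} (P' : PartialField R') (hP : P'.IsInducedSubPartialField P)
    (M N : Matroid α) [M.Finite] (hM : M.IsKConnected 3) (hN : N.IsKConnected 3)
    (hNM : N.IsMinor M) (hcard : 2 ≤ N.E.encard) :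
    Xor (Matroid.Confines P P' N M)
      (∃ M' : Matroid α, M'.IsMinor M ∧ M'.IsKConnected 3 ∧
        ¬ Matroid.Confines P P' N M' ∧
        (∃ (A A' : LabelledMatrix α R) (B : LabelledMatrix α R'),
          A.IsMatrixOver P ∧ A.Represents M ∧
          A'.IsMatrixOver P ∧ A'.Represents M' ∧ LabelledMatrix.IsMinorOver P A' A ∧
          B.IsRepresentationOf P' N ∧
          LabelledMatrix.IsMinorOver P (B.map R'.subtype) A' ∧
          ¬ LabelledMatrix.IsScaledMatrix P P' A') ∧
        ((∃ x ∈ M'.E, N.IsIsomorphicTo (M'.contract {x})) ∨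
          (∃ y ∈ M'.E, N.IsIsomorphicTo (M'.delete {y})) ∨
          (∃ x ∈ M'.E, ∃ y ∈ M'.E, x ≠ y ∧
            N.IsIsomorphicTo ((M'.contract {x}).delete {y}) ∧
            ((M'.contract {x}).IsKConnected 3 ∨ (M'.delete {y}).IsKConnected 3)))) := by
  obtain ⟨_, K, hle, hK⟩ := hP
  have hinv := invClosed_of_eq hK
  by_cases hconf : Matroid.Confines P P' N M
  -- a minor of a scaled `P'`-matrix is a scaled `P'`-matrix
  · refine Or.inl ⟨hconf, ?_⟩
    rintro ⟨M', _, _, _, ⟨A, A', B, hA, hAM, hA', _, hA'A, hB, hBA', hbad⟩, _⟩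
    have h1 := hconf B hB A hA hAM (Relation.ReflTransGen.trans hA'A hBA')
    rw [isScaledMatrix_iff hle hK hA] at h1
    exact hbad ((isScaledMatrix_iff hle hK hA').2 (hA'A.scalesInto hA hinv h1))
  refine Or.inr ⟨?_, hconf⟩
  rw [Matroid.Confines] at hconf
  push Not at hconf
  obtain ⟨B, ⟨hB, N₀, hBN₀, hNN₀⟩, hconf⟩ := hconf
  rw [LabelledMatrix.Confines] at hconf
  push Not at hconf
  obtain ⟨A, hA, hAM, hBA, hbad⟩ := hconf
  rw [isScaledMatrix_iff hle hK hA] at hbad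
  -- postpone the deletions: the copy of `N` is a submatrix of a matrix equivalent to `A`
  obtain ⟨A₁, S, hAA₁, hBS⟩ := hBA.exists_restrict
  have hA₁ := hAA₁.isMatrixOver hA
  have hSK : EntriesIn K A₁ S := by
    intro x hx y hy
    rw [← restrict_entry hx hy, ← hBS]
    exact entry_map_mem hK hB x y
  have hN₀ : (A₁.restrict S).Represents N₀ := by
    rw [← hBS]; exact represents_map_iff.2 hBN₀
  have hbad₁ : ¬ ScalesInto P K A₁ Set.univ := by
    exact fun h => hbad (ScalesInto.of_pivotEquiv hAA₁ hA hinv h)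
  obtain ⟨A₂, S, T, N₁, M', h1, h2, h3, h4, h5, h6, h7, h8, h9⟩ :=
    hasWitness_of_not_scalesInto hA₁ hinv (hAA₁.represents hA hAM) hM hN₀ hNN₀ hN hcard hSK hbad₁
  have hAA₂ := hAA₁.trans h1
  have hA₂ := hAA₂.isMatrixOver hA
  have hA₂M := hAA₂.represents hA hAM
  have hA₂T := isMatrixOver_restrict hA₂ T
  obtain ⟨B', hB', hB'S⟩ := exists_map_eq (A := A₂.restrict S) hle hK
    (isMatrixOver_restrict hA₂ S) (by
      intro x y
      have h4' : EntriesIn K A₂ (S ∩ Set.univ) := by rwa [Set.inter_univ]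
      exact h4'.restrict x trivial y trivial)
  have hrep : B'.IsRepresentationOf P' N :=
    ⟨hB', N₁, represents_map_iff.1 (by rw [hB'S]; exact h2), h3⟩
  have hmin : IsMinorOver P (B'.map R'.subtype) (A₂.restrict T) := by
    have : (A₂.restrict T).restrict S = A₂.restrict S := by
      rw [restrict_restrict, Set.inter_eq_right.2 h5]
    rw [hB'S, ← this]
    exact isMinorOver_restrict _ S
  have hbadT : ¬ IsScaledMatrix P P' (A₂.restrict T) := by
    rwa [isScaledMatrix_iff hle hK hA₂T, scalesInto_restrict_iff]
  refine ⟨M', ?_, h7, fun hc => hbadT (hc B' hrep _ hA₂T h6 hmin), ⟨A₂, A₂.restrict T, B', hA₂,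
    hA₂M, hA₂T, h6, isMinorOver_restrict _ T, hrep, hmin, hbadT⟩, ?_⟩
  · obtain ⟨M'', h10, h11⟩ := hA₂M.exists_minor hA₂ T
    rwa [h6.unique h10]
  · rcases h9 with ⟨x, hx, rfl⟩ | ⟨y, hy, rfl⟩ | ⟨x, hx, y, hy, hxy, rfl, hor⟩
    · exact Or.inl ⟨x, hx, h3⟩
    · exact Or.inr (Or.inl ⟨y, hy, h3⟩)
    · exact Or.inr (Or.inr ⟨x, hx, y, hy, hxy, h3, hor⟩)
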